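/- **Setting.** Let $N=2^n$ with $n\in\mathbb N$ and $V_N=\{0,\dots,N-1\}^2\subset\mathbb Z^2$. For $j\ge 0$ let $\mathcal B_j$ be the set of all boxes $\{a_1,\dots,a_1+2^j-1\}\times\{a_2,\dots,a_2+2^j-1\}$ with $(a_1,a_2)\in\mathbb Z^2$, and for $z\in\mathbb Z^2$ let $\mathcal B_j(z)$ be the set of those $B\in\mathcal B_j$ that contain $z$. Let $\{b_{j,B}: j\ge 0,\ B\in\mathcal B_j\}$ be independent centered Gaussian random variables with $\operatorname{Var}(b_{j,B})=2^{-2j}$. For $K=2^k$ with an integer $k\ge 1$, the $K$-coarse modified branching random walk on $V_N$ is $$\varphi_{N,z}=\sum_{j=0}^{\lfloor n/k\rfloor-1}\ \sum_{B\in\mathcal B_{jk}(z)}\sqrt{k}\,b_{jk,B},\qquad z\in V_N .$$ For $\gamma>0$ let $\mu_\gamma$ be the random probability measure on $V_N$ with $\mu_\gamma(\{v\})=e^{\gamma\varphi_{N,v}}/\sum_{w\in V_N}e^{\gamma\varphi_{N,w}}$, and for $u,v\in V_N$ let $$d_\gamma(u,v)=\min_P\sum_{w\in P}e^{\gamma\varphi_{N,w}},$$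 where the minimum is over all nearest-neighbour paths $P$ in $V_N$ from $u$ to $v$ and the sum is over all vertices of $P$, including the end points. **Theorem 1.1.** Fix $0<\gamma<\tfrac12$. For every $\varepsilon>0$ there are $K(\varepsilon)$ and $\rho=\rho(\varepsilon)>0$ such that for every $K\ge K(\varepsilon)$ of the form $K=2^k$ with an integer $k\ge 1$, the $K$-coarse modified branching random walk satisfies $$\lim_{N\to\infty}\mathbb P\Big(\mu_\gamma\times\mu_\gamma\big(\{(u,v): N^{1-\varepsilon}\le d_\gamma(u,v)\le N^{1+\varepsilon}\}\big)\ \ge\ 1-N^{-\rho}\Big)=1,$$ where $N$ runs through the powers $2^n$, $n\to\infty$. -/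

import Mathlib

open MeasureTheory ProbabilityTheory Filter Topology
open scoped NNReal

noncomputable section

/-- The box of side length `2 ^ l` in `ℤ²` with left bottom corner `a`; it has `2 ^ l * 2 ^ l`
lattice points. The boxes of side length `2 ^ l` are identified with their left bottom corners. -/
def dyadicBox (l : ℕ) (a : ℤ × ℤ) : Finset (ℤ × ℤ) :=
  Finset.Ico a.1 (a.1 + 2 ^ l) ×ˢ Finset.Ico a.2 (a.2 + 2 ^ l)

/-- The (left bottom corners of the) boxes of side length `2 ^ l` that contain `z`. -/
def boxesContaining (l : ℕ) (z : ℤ × ℤ) : Finset (ℤ × ℤ) :=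
  Finset.Ioc (z.1 - 2 ^ l) z.1 ×ˢ Finset.Ioc (z.2 - 2 ^ l) z.2

theorem mem_boxesContaining (l : ℕ) (z a : ℤ × ℤ) :
    a ∈ boxesContaining l z ↔ z ∈ dyadicBox l a := by
  simp only [boxesContaining, dyadicBox, Finset.mem_product, Finset.mem_Ioc, Finset.mem_Ico]
  constructor <;> rintro ⟨⟨h1, h2⟩, h3, h4⟩ <;> refine ⟨⟨?_, ?_⟩, ?_, ?_⟩ <;> linarith

/-- `b (l, a)`, for `l ≥ 0` and `a ∈ ℤ²`, are independent centered Gaussian variables, the one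
attached to the box of side length `2 ^ l` with corner `a` having variance `2 ^ (-2 l)`. -/
def IsBoxNoise {Ω : Type*} [MeasurableSpace Ω] (P : Measure Ω) (b : ℕ × (ℤ × ℤ) → Ω → ℝ) : Prop :=
  iIndepFun b P ∧
    ∀ (l : ℕ) (a : ℤ × ℤ), HasLaw (b (l, a)) (gaussianReal 0 (((2 : ℝ≥0) ^ (2 * l))⁻¹)) P

/-- The vertex set `V_N = {0, …, N - 1}²`. -/
abbrev LatticeBox (N : ℕ) : Type := Fin N × Fin N

/-- The nearest neighbour graph of `ℤ²` restricted to `V_N`. -/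
def latticeGraph (N : ℕ) : SimpleGraph (LatticeBox N) where
  Adj u v := |((u.1 : ℕ) : ℤ) - ((v.1 : ℕ) : ℤ)| + |((u.2 : ℕ) : ℤ) - ((v.2 : ℕ) : ℤ)| = 1
  symm := ⟨fun u v h => by
    rw [abs_sub_comm ((v.1 : ℕ) : ℤ), abs_sub_comm ((v.2 : ℕ) : ℤ)]; exact h⟩
  loopless := ⟨fun u h => by simp at h⟩

/-- The `K`-coarse modified branching random walk on `V_N`, for `K = 2 ^ k` and `N = 2 ^ n`,
built from the values `b` of the box variables. (`n / k` is the integer part.) -/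
def coarseMBRW (k n : ℕ) (b : ℕ × (ℤ × ℤ) → ℝ) (z : LatticeBox (2 ^ n)) : ℝ :=
  ∑ j ∈ Finset.range (n / k),
    ∑ a ∈ boxesContaining (j * k) (((z.1 : ℕ) : ℤ), ((z.2 : ℕ) : ℤ)),
      Real.sqrt k * b (j * k, a)

/-- The first passage percolation distance with vertex weights `exp (γ * φ w)`: the minimum over
the (finitely many) self-avoiding paths in `V_N` from `u` to `v`, both end points included, of the
sum of the weights of the vertices of the path. -/
def fppDist {N : ℕ} (γ : ℝ) (φ : LatticeBox N → ℝ) (u v : LatticeBox N) : ℝ :=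
  ⨅ p : (latticeGraph N).Path u v,
    ((p : (latticeGraph N).Walk u v).support.map fun w => Real.exp (γ * φ w)).sum

/-- The probability measure on `V_N` proportional to `exp (γ * φ v)`, given by its point masses. -/
def lqgMass {N : ℕ} (γ : ℝ) (φ : LatticeBox N → ℝ) (v : LatticeBox N) : ℝ :=
  Real.exp (γ * φ v) / ∑ w, Real.exp (γ * φ w)

open Classical in
/-- The mass that the product of the above probability measure with itself gives to a set of
pairs of vertices. -/
def lqgPairMass {N : ℕ} (γ : ℝ) (φ : LatticeBox N → ℝ) (S : Set (LatticeBox N × LatticeBox N)) :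
    ℝ :=
  ∑ p with p ∈ S, lqgMass γ φ p.1 * lqgMass γ φ p.2

end

/-! Write `K = 2 ^ k` and `J = n / k`, and call the squares of side `K ^ i` cells of scale `i`. The
field is a sum of `J` independent levels of variance `k`. The supremum of one level over a cell of
its own scale has a Gaussian tail with variance of order `k` (`boxLaw_highOn_le`, by the reflection
principle). So for fixed small `η` a level exceeds `η * k` in absolute value somewhere on a cell
with probability of order `exp (-c * η ^ 2 * k)`, which for large `K` beats every fixed
combinatorial constant. A deviation of `η * k` changes costs by a factor `exp (γ * η * k)`, a small
power of `K`. Over all scales this is a small power of `N`.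

Lower bound for distances. A path that leaves the neighbourhood of a cell of scale `j + 1` runs
through a chain of order `K` distinct cells of scale `j`. A Peierls count (`boxLaw_hasBadChain_le`)
shows that with high probability at least half of the first `K / 4` cells of such a chain are
neither cheap to leave nor touched by a very low value of level `j`. Hence the cost of leaving grows
by about `K / 8 * exp (-(γ * x))` per scale, while the probability of an exceptionally cheap cell
stays below one fixed constant (`boxLaw_thin_le`). For two distant points of the box the same count,
with chains whose length is of order `n`, makes the failure probability smaller than any union bound
needs (`le_fppDist_of_not_hasBadChain`).

Upper bound for distances. In every cell a grid of roads of at most `6 * K` of its `K ^ 2` subcells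
is laid out, along rows and columns on which the level is not high whenever such lines are
available. Road cells of road cells, over all scales, together with all subcells of the cells that
contain `u` or `v`, form a connected set joining `u` to `v` (`isPreconn_netSet`), which is covered
by a network of `u` and a network of `v`. The expectation of `exp (γ * φ u)` times the weight of the
network of `u` factorises over the levels and gains about `K * exp (γ * x + γ ^ 2 * k / 2)` per
scale (`lintegral_exp_mul_netWeight_le`). The factor `exp (γ ^ 2 * k / 2)` is the growth of the
total mass, so by Markov's inequality all but a small part of the mass sits on points with network
weight at most about `N ^ (1 + ε)`.

Normalisation. For `γ ≤ 1 / 2` the total mass has a good second moment: it is not much below its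
mean (`boxLaw_sum_exp_le`), and pairs of points that are too close carry little of the squared mass
(`boxLaw_close_ge_le`). The coarsest levels do not average out. A small fraction of them is split
off and controlled by a union bound over the points of the box (`boxLaw_exists_low_le`). The error
events are collected in `boxLaw_lqgPairMass_lt_le`. -/

/-! ### The canonical space of box variables -/

/-- Indices of the box variables: the scale and the corner of a box. -/
abbrev BoxIdx : Type := ℕ × (ℤ × ℤ)

/-- Configurations of the box variables. -/
abbrev BoxCfg : Type := BoxIdx → ℝ

/-- The variance of the variable of a box. -/
noncomputable def boxVar (i : BoxIdx) : ℝ≥0 := ((2 : ℝ≥0) ^ (2 * i.1))⁻¹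

/-- The joint law of the box variables. -/
noncomputable def boxLaw : Measure BoxCfg :=
  Measure.infinitePi fun i => gaussianReal 0 (boxVar i)

instance : IsProbabilityMeasure boxLaw := by unfold boxLaw; infer_instance

theorem measurePreserving_coord (i : BoxIdx) :
    MeasurePreserving (fun ω : BoxCfg => ω i) boxLaw (gaussianReal 0 (boxVar i)) :=
  measurePreserving_eval_infinitePi _ i

theorem iIndepFun_coord : iIndepFun (fun (i : BoxIdx) (ω : BoxCfg) => ω i) boxLaw :=
  iIndepFun_infinitePi (X := fun _ x => x) (by fun_prop)

theorem IsBoxNoise.aemeasurable {Ω : Type*} [MeasurableSpace Ω] {P : Measure Ω}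
    {b : BoxIdx → Ω → ℝ} (hb : IsBoxNoise P b) : AEMeasurable (fun ω i => b i ω) P :=
  aemeasurable_pi_iff.2 fun i => (hb.2 i.1 i.2).aemeasurable

theorem IsBoxNoise.map_eq {Ω : Type*} [MeasurableSpace Ω] {P : Measure Ω}
    {b : BoxIdx → Ω → ℝ} (hb : IsBoxNoise P b) : P.map (fun ω i => b i ω) = boxLaw := by
  rw [hb.1.map_fun_eq_infinitePi_map₀ hb.aemeasurable, boxLaw]
  congr 1
  ext1 i
  exact (hb.2 i.1 i.2).map_eq

/-- One inequality is enough to transfer small probabilities of exceptional events, and it holds for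
arbitrary sets. Thus the event of the theorem never has to be shown measurable. -/
theorem IsBoxNoise.measure_preimage_le {Ω : Type*} [MeasurableSpace Ω] {P : Measure Ω}
    {b : BoxIdx → Ω → ℝ} (hb : IsBoxNoise P b) (S : Set BoxCfg) :
    P {ω | (fun i => b i ω) ∈ S} ≤ boxLaw S := by
  rw [← hb.map_eq]
  exact Measure.le_map_apply hb.aemeasurable S

/-! ### Independence of the variables of disjoint sets of boxes -/

/-- The `σ`-algebra generated by the variables of the boxes in `A`. -/
@[reducible] def coordAlg (A : Set BoxIdx) : MeasurableSpace BoxCfg :=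
  ⨆ i ∈ A, MeasurableSpace.comap (fun ω : BoxCfg => ω i) inferInstance

theorem coordAlg_le (A : Set BoxIdx) : coordAlg A ≤ (inferInstance : MeasurableSpace BoxCfg) :=
  iSup₂_le fun i _ => (measurable_pi_apply i).comap_le

theorem coordAlg_mono {A B : Set BoxIdx} (h : A ⊆ B) : coordAlg A ≤ coordAlg B :=
  biSup_mono fun _ hi => h hi

theorem measurable_coord {A : Set BoxIdx} {i : BoxIdx} (hi : i ∈ A) :
    Measurable[coordAlg A] fun ω : BoxCfg => ω i :=
  (comap_measurable fun ω : BoxCfg => ω i).mono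
    (le_iSup₂ (f := fun i (_ : i ∈ A) => MeasurableSpace.comap (fun ω : BoxCfg => ω i)
      inferInstance) i hi) le_rfl

theorem indep_coordAlg {A B : Set BoxIdx} (h : Disjoint A B) :
    Indep (coordAlg A) (coordAlg B) boxLaw :=
  indep_iSup_of_disjoint (fun i => (measurable_pi_apply i).comap_le)
    ((iIndepFun_iff_iIndep _ _ _).1 iIndepFun_coord) h

theorem boxLaw_biInter_of_disjoint {α : Type*} [DecidableEq α] (T : Finset α)
    (A : α → Set BoxIdx) (E : α → Set BoxCfg)
    (hE : ∀ c ∈ T, MeasurableSet[coordAlg (A c)] (E c))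
    (hA : ∀ c ∈ T, ∀ c' ∈ T, c ≠ c' → Disjoint (A c) (A c')) :
    boxLaw (⋂ c ∈ T, E c) = ∏ c ∈ T, boxLaw (E c) := by
  induction T using Finset.induction_on with
  | empty => simp
  | insert c T hc ih =>
    rw [Finset.prod_insert hc, ← ih (fun c' h => hE c' (Finset.mem_insert_of_mem h))
      (fun c₁ h₁ c₂ h₂ => hA c₁ (Finset.mem_insert_of_mem h₁) c₂ (Finset.mem_insert_of_mem h₂)),
      Finset.set_biInter_insert]
    have hd : Disjoint (A c) (⋃ c' ∈ T, A c') := by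
      simp only [Set.disjoint_iUnion_right]
      intro c' hc'
      exact hA c (Finset.mem_insert_self _ _) c' (Finset.mem_insert_of_mem hc')
        (fun h => hc (h ▸ hc'))
    refine (Indep_iff _ _ _).1 (indep_coordAlg hd) _ _ (hE c (Finset.mem_insert_self _ _)) ?_
    refine Finset.measurableSet_biInter T fun c' hc' => ?_
    exact coordAlg_mono (Set.subset_biUnion_of_mem (u := fun c' => A c') hc') _
      (hE c' (Finset.mem_insert_of_mem hc'))

theorem lintegral_prod_of_disjoint {α : Type*} [DecidableEq α] (T : Finset α)
    (A : α → Set BoxIdx) (f : α → BoxCfg → ENNReal)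
    (hf : ∀ c ∈ T, Measurable[coordAlg (A c)] (f c))
    (hA : ∀ c ∈ T, ∀ c' ∈ T, c ≠ c' → Disjoint (A c) (A c')) :
    ∫⁻ ω, ∏ c ∈ T, f c ω ∂boxLaw = ∏ c ∈ T, ∫⁻ ω, f c ω ∂boxLaw := by
  induction T using Finset.induction_on with
  | empty => simp
  | insert c T hc ih =>
    simp only [Finset.prod_insert hc]
    rw [← ih (fun c' h => hf c' (Finset.mem_insert_of_mem h))
      (fun c₁ h₁ c₂ h₂ => hA c₁ (Finset.mem_insert_of_mem h₁) c₂ (Finset.mem_insert_of_mem h₂))]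
    have hd : Disjoint (A c) (⋃ c' ∈ T, A c') := by
      simp only [Set.disjoint_iUnion_right]
      intro c' hc'
      exact hA c (Finset.mem_insert_self _ _) c' (Finset.mem_insert_of_mem hc')
        (fun h => hc (h ▸ hc'))
    refine lintegral_mul_eq_lintegral_mul_lintegral_of_independent_measurableSpace
      (coordAlg_le _) (coordAlg_le _) (indep_coordAlg hd) (hf c (Finset.mem_insert_self _ _)) ?_
    refine Finset.measurable_prod T fun c' hc' => ?_
    exact (hf c' (Finset.mem_insert_of_mem hc')).mono
      (coordAlg_mono (Set.subset_biUnion_of_mem (u := fun c' => A c') hc')) le_rfl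

/-! ### Linear functionals of the box variables -/

/-- The linear functional of the box variables with coefficients `t`. -/
noncomputable def lin (ω : BoxCfg) : (BoxIdx →₀ ℝ) →ₗ[ℝ] ℝ := Finsupp.linearCombination ℝ ω

/-- The covariance of two linear functionals of the box variables. -/
noncomputable def linCov : (BoxIdx →₀ ℝ) →ₗ[ℝ] (BoxIdx →₀ ℝ) →ₗ[ℝ] ℝ :=
  Finsupp.linearCombination ℝ fun i => (boxVar i : ℝ) • Finsupp.lapply i

theorem lin_apply (ω : BoxCfg) (t : BoxIdx →₀ ℝ) : lin ω t = ∑ i ∈ t.support, t i * ω i := rfl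

theorem lin_single (ω : BoxCfg) (i : BoxIdx) (x : ℝ) : lin ω (Finsupp.single i x) = x * ω i := by
  simp [lin]

theorem linCov_self (t : BoxIdx →₀ ℝ) :
    linCov t t = ∑ i ∈ t.support, t i ^ 2 * (boxVar i : ℝ) := by
  simp only [linCov, Finsupp.linearCombination_apply, Finsupp.sum, LinearMap.sum_apply,
    LinearMap.smul_apply, Finsupp.lapply_apply, smul_eq_mul]
  exact Finset.sum_congr rfl fun i _ => by ring

theorem linCov_single (i j : BoxIdx) (x y : ℝ) :
    linCov (Finsupp.single i x) (Finsupp.single j y) =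
      if i = j then x * y * (boxVar i : ℝ) else 0 := by
  simp only [linCov, Finsupp.linearCombination_single, LinearMap.smul_apply,
    Finsupp.lapply_apply, smul_eq_mul, Finsupp.single_apply, eq_comm (a := j)]
  split_ifs <;> ring

theorem measurable_lin (t : BoxIdx →₀ ℝ) : Measurable fun ω => lin ω t := by
  simp only [lin_apply]
  fun_prop

theorem mgf_coord (i : BoxIdx) (t : ℝ) :
    mgf (fun ω : BoxCfg => ω i) boxLaw t = Real.exp (boxVar i * t ^ 2 / 2) := by
  rw [mgf_gaussianReal (measurePreserving_coord i).map_eq]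
  simp

theorem integrable_exp_coord (i : BoxIdx) (t : ℝ) :
    Integrable (fun ω : BoxCfg => Real.exp (t * ω i)) boxLaw :=
  (measurePreserving_coord i).integrable_comp_of_integrable
    (g := fun x => Real.exp (t * x)) (integrable_exp_mul_gaussianReal t)

theorem integrable_exp_lin (t : BoxIdx →₀ ℝ) :
    Integrable (fun ω => Real.exp (lin ω t)) boxLaw := by
  have hi : iIndepFun (fun i (ω : BoxCfg) => t i * ω i) boxLaw :=
    iIndepFun_coord.comp (fun i x => t i * x) fun i => by fun_prop
  have := hi.integrable_exp_mul_sum (t := 1) (s := t.support) (fun i => by fun_prop)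
    (fun i _ => by simpa using integrable_exp_coord i (t i))
  simpa [lin_apply] using this

theorem integral_exp_lin (t : BoxIdx →₀ ℝ) :
    ∫ ω, Real.exp (lin ω t) ∂boxLaw = Real.exp (linCov t t / 2) := by
  have hi : iIndepFun (fun i (ω : BoxCfg) => t i * ω i) boxLaw :=
    iIndepFun_coord.comp (fun i x => t i * x) fun i => by fun_prop
  have h := hi.mgf_sum (t := 1) (fun i => by fun_prop) t.support
  have h1 : ∀ i, mgf (fun ω : BoxCfg => t i * ω i) boxLaw 1 =
      Real.exp (t i ^ 2 * boxVar i / 2) := by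
    intro i
    rw [mgf_const_mul, mgf_coord]
    congr 1
    ring
  simp only [h1, ← Real.exp_sum, ← Finset.sum_div] at h
  rw [linCov_self, ← h, mgf]
  simp [lin_apply]

theorem lintegral_exp_lin (t : BoxIdx →₀ ℝ) :
    ∫⁻ ω, ENNReal.ofReal (Real.exp (lin ω t)) ∂boxLaw =
      ENNReal.ofReal (Real.exp (linCov t t / 2)) := by
  rw [← ofReal_integral_eq_lintegral_ofReal (integrable_exp_lin t)
    (ae_of_all _ fun ω => (Real.exp_pos _).le), integral_exp_lin]

/-- Chernoff's bound. The exponent `l` stays free, so that later it can be fitted to an upper bound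
for the variance. -/
theorem boxLaw_lin_ge (t : BoxIdx →₀ ℝ) (x l : ℝ) (hl : 0 ≤ l) :
    boxLaw {ω | x ≤ lin ω t} ≤ ENNReal.ofReal (Real.exp (l ^ 2 * linCov t t / 2 - l * x)) := by
  have h : {ω | x ≤ lin ω t} ⊆
      {ω | ENNReal.ofReal (Real.exp (l * x)) ≤ ENNReal.ofReal (Real.exp (lin ω (l • t)))} := by
    intro ω hω
    simp only [Set.mem_ofPred_eq, map_smul, smul_eq_mul] at hω ⊢
    exact ENNReal.ofReal_le_ofReal (Real.exp_le_exp.2 (mul_le_mul_of_nonneg_left hω hl))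
  refine (measure_mono h).trans ((meas_ge_le_lintegral_div
    (measurable_lin (l • t)).exp.ennreal_ofReal.aemeasurable ?_ ENNReal.ofReal_ne_top).trans ?_)
  · simp [Real.exp_pos]
  · rw [lintegral_exp_lin, ← ENNReal.ofReal_div_of_pos (Real.exp_pos _), ← Real.exp_sub]
    simp only [map_smul, LinearMap.smul_apply, smul_eq_mul]
    exact ENNReal.ofReal_le_ofReal (Real.exp_le_exp.2 (le_of_eq (by ring)))

theorem boxLaw_abs_lin_ge (t : BoxIdx →₀ ℝ) (x l : ℝ) (hl : 0 ≤ l) :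
    boxLaw {ω | x ≤ |lin ω t|} ≤
      2 * ENNReal.ofReal (Real.exp (l ^ 2 * linCov t t / 2 - l * x)) := by
  have h : {ω | x ≤ |lin ω t|} ⊆ {ω | x ≤ lin ω t} ∪ {ω | x ≤ lin ω (-t)} := by
    intro ω hω
    simpa [le_abs] using hω
  refine (measure_mono h).trans ((measure_union_le _ _).trans ?_)
  rw [two_mul]
  refine add_le_add (boxLaw_lin_ge t x l hl) ?_
  simpa using boxLaw_lin_ge (-t) x l hl

/-! ### Sign flips -/

/-- Changing the signs of the variables of the boxes in `A`. -/
noncomputable def flipSign (A : Set BoxIdx) (ω : BoxCfg) : BoxCfg :=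
  open Classical in fun i => if i ∈ A then -ω i else ω i

theorem measurePreserving_flipSign (A : Set BoxIdx) :
    MeasurePreserving (flipSign A) boxLaw boxLaw := by
  classical
  have hm : ∀ i, Measurable fun x : ℝ => if i ∈ A then -x else x := fun i => by
    split_ifs <;> fun_prop
  refine ⟨measurable_pi_iff.2 fun i => (hm i).comp (measurable_pi_apply i), ?_⟩
  have := Measure.infinitePi_map_pi (fun i => gaussianReal 0 (boxVar i)) (f := fun i x =>
    if i ∈ A then -x else x) hm
  have h2 : ∀ i, (gaussianReal 0 (boxVar i)).map (fun x : ℝ => if i ∈ A then -x else x) =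
      gaussianReal 0 (boxVar i) := by
    intro i
    split_ifs
    · have := gaussianReal_map_neg (μ := 0) (v := boxVar i)
      simpa using this
    · simp
  simp only [h2] at this
  exact this

/-- The reflection principle: a maximal inequality for partial sums of symmetric variables. -/
theorem boxLaw_exists_norm_ge_le {V : Type*} [NormedAddCommGroup V] [NormedSpace ℝ V] [MeasurableSpace V]
    [BorelSpace V] (n : ℕ) (S : ℕ → BoxCfg → V)
    (hS : ∀ i ≤ n, Measurable (S i)) (F : ℕ → BoxCfg → BoxCfg)
    (hF : ∀ i, MeasurePreserving (F i) boxLaw boxLaw)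
    (h₁ : ∀ i ≤ n, ∀ r ≤ i, ∀ ω, S r (F i ω) = S r ω)
    (h₂ : ∀ i ≤ n, ∀ ω, S n (F i ω) + S n ω = S i ω + S i ω) (x : ℝ) :
    boxLaw {ω | ∃ i ≤ n, x ≤ ‖S i ω‖} ≤ 2 * boxLaw {ω | x ≤ ‖S n ω‖} := by
  set E : ℕ → Set BoxCfg := fun i => {ω | x ≤ ‖S i ω‖ ∧ ∀ r < i, ‖S r ω‖ < x} with hE
  set B : Set BoxCfg := {ω | x ≤ ‖S n ω‖}
  have hEm : ∀ i ≤ n, MeasurableSet (E i) := by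
    intro i hi
    refine (measurableSet_le measurable_const (hS i hi).norm).inter ?_
    have : {ω | ∀ r < i, ‖S r ω‖ < x} = ⋂ r ∈ Finset.range i, {ω | ‖S r ω‖ < x} := by
      ext ω; simp
    change MeasurableSet {ω | ∀ r < i, ‖S r ω‖ < x}
    rw [this]
    refine Finset.measurableSet_biInter _ fun r hr => ?_
    exact measurableSet_lt (hS r ((Finset.mem_range.1 hr).le.trans hi)).norm measurable_const
  have hBm : MeasurableSet B := measurableSet_le measurable_const (hS n le_rfl).norm
  have hdisj : ∀ i j, i ≠ j → Disjoint (E i) (E j) := by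
    intro i j hij
    rw [Set.disjoint_left]
    rintro ω ⟨h1, h2⟩ ⟨h3, h4⟩
    rcases lt_or_gt_of_ne hij with h | h
    · exact absurd h1 (not_le.2 (h4 i h))
    · exact absurd h3 (not_le.2 (h2 j h))
  have hcov : {ω | ∃ i ≤ n, x ≤ ‖S i ω‖} ⊆ ⋃ i ∈ Finset.range (n + 1), E i := by
    rintro ω ⟨i, hi, hx⟩
    classical
    have hex : ∃ i, x ≤ ‖S i ω‖ := ⟨i, hx⟩
    simp only [Set.mem_iUnion, Finset.mem_range]
    refine ⟨Nat.find hex, Nat.lt_succ_of_le ((Nat.find_min' hex hx).trans hi), Nat.find_spec hex,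
      fun r hr => not_le.1 (Nat.find_min hex hr)⟩
  have hstep : ∀ i ≤ n, boxLaw (E i) ≤ 2 * boxLaw (E i ∩ B) := by
    intro i hi
    -- The flip leaves the first-passage event at `i` unchanged and turns `S n` into `2 * S i - S
    -- n`. If `S n` has norm below `x`, the flipped sum therefore has norm above `x`.
    have hpre : F i ⁻¹' (E i ∩ B) ∪ (E i ∩ B) ⊇ E i := by
      intro ω hω
      by_cases hb : ω ∈ B
      · exact Or.inr ⟨hω, hb⟩
      left
      refine ⟨⟨?_, fun r hr => ?_⟩, ?_⟩
      · rw [h₁ i hi i le_rfl]; exact hω.1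
      · rw [h₁ i hi r hr.le]; exact hω.2 r hr
      · change x ≤ ‖S n (F i ω)‖
        have h3 : ‖S i ω + S i ω‖ ≤ ‖S n (F i ω)‖ + ‖S n ω‖ := h₂ i hi ω ▸ norm_add_le _ _
        have h4 : ‖S n ω‖ < x := not_le.1 hb
        have h5 : ‖S i ω + S i ω‖ = 2 * ‖S i ω‖ := by
          rw [← two_smul ℝ (S i ω), norm_smul]; norm_num
        have := hω.1
        linarith
    refine (measure_mono hpre).trans ((measure_union_le _ _).trans ?_)
    rw [(hF i).measure_preimage ((hEm i hi).inter hBm).nullMeasurableSet, two_mul]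
  calc boxLaw {ω | ∃ i ≤ n, x ≤ ‖S i ω‖} ≤ ∑ i ∈ Finset.range (n + 1), boxLaw (E i) :=
        (measure_mono hcov).trans (measure_biUnion_finset_le _ _)
    _ ≤ ∑ i ∈ Finset.range (n + 1), 2 * boxLaw (E i ∩ B) :=
        Finset.sum_le_sum fun i hi => hstep i (Nat.lt_succ_iff.1 (Finset.mem_range.1 hi))
    _ = 2 * boxLaw (⋃ i ∈ Finset.range (n + 1), E i ∩ B) := by
        rw [← Finset.mul_sum, measure_biUnion_finset]
        · intro i _ j _ hij
          exact (hdisj i j hij).mono Set.inter_subset_left Set.inter_subset_left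
        · intro i hi
          exact (hEm i (Nat.lt_succ_iff.1 (Finset.mem_range.1 hi))).inter hBm
    _ ≤ 2 * boxLaw B := by
        gcongr
        exact Set.iUnion₂_subset fun i _ => Set.inter_subset_right

/-! ### The levels of the field -/

/-- The coefficients of the contribution of the boxes of side length `2 ^ (i * k)`. -/
noncomputable def levCoef (k i : ℕ) (z : ℤ × ℤ) : BoxIdx →₀ ℝ :=
  ∑ a ∈ boxesContaining (i * k) z, Finsupp.single (i * k, a) (Real.sqrt k)

/-- The contribution of the boxes of side length `2 ^ (i * k)` to the field. -/
noncomputable def lev (k i : ℕ) (z : ℤ × ℤ) (ω : BoxCfg) : ℝ := lin ω (levCoef k i z)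

theorem lev_eq (k i : ℕ) (z : ℤ × ℤ) (ω : BoxCfg) :
    lev k i z ω = ∑ a ∈ boxesContaining (i * k) z, Real.sqrt k * ω (i * k, a) := by
  simp [lev, levCoef, lin_single]

theorem measurable_lev (k i : ℕ) (z : ℤ × ℤ) : Measurable (lev k i z) := measurable_lin _

theorem measurable_coordAlg_lev {A : Set BoxIdx} {k i : ℕ} {z : ℤ × ℤ}
    (h : ∀ a ∈ boxesContaining (i * k) z, (i * k, a) ∈ A) :
    Measurable[coordAlg A] (lev k i z) := by
  have : lev k i z = fun ω => ∑ a ∈ boxesContaining (i * k) z, Real.sqrt k * ω (i * k, a) :=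
    funext fun ω => lev_eq k i z ω
  rw [this]
  exact Finset.measurable_sum _ fun a ha => (measurable_coord (h a ha)).const_mul _

theorem boxVar_mk (l : ℕ) (a : ℤ × ℤ) : (boxVar (l, a) : ℝ) = ((2 : ℝ) ^ l * 2 ^ l)⁻¹ := by
  simp [boxVar, two_mul, pow_add]

theorem linCov_sum_single (l l' : ℕ) (S S' : Finset (ℤ × ℤ)) (x y : ℝ) :
    linCov (∑ a ∈ S, Finsupp.single (l, a) x) (∑ a ∈ S', Finsupp.single (l', a) y) =
      if l = l' then (S ∩ S').card * (x * y * ((2 : ℝ) ^ l * 2 ^ l)⁻¹) else 0 := by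
  simp only [map_sum, LinearMap.sum_apply, linCov_single, boxVar_mk, Prod.mk.injEq]
  split_ifs with h
  · subst h
    simp only [true_and, Finset.sum_ite_eq']
    rw [← Finset.sum_filter, Finset.sum_const, nsmul_eq_mul, Finset.filter_mem_eq_inter,
      Finset.inter_comm]
  · simp [h]

/-- The proportion of the boxes containing `u` that contain `w` too. -/
noncomputable def overlap (k i : ℕ) (u w : ℤ × ℤ) : ℝ :=
  (boxesContaining (i * k) u ∩ boxesContaining (i * k) w).card *
    ((2 : ℝ) ^ (i * k) * 2 ^ (i * k))⁻¹

theorem linCov_levCoef {k : ℕ} (hk : 1 ≤ k) (i j : ℕ) (u w : ℤ × ℤ) :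
    linCov (levCoef k i u) (levCoef k j w) = if i = j then k * overlap k i u w else 0 := by
  rw [levCoef, levCoef, linCov_sum_single, Real.mul_self_sqrt (Nat.cast_nonneg k)]
  have : i * k = j * k ↔ i = j := Nat.mul_left_inj (by omega)
  simp only [this]
  split_ifs with h
  · subst h; rw [overlap]; ring
  · rfl

theorem card_boxesContaining (l : ℕ) (z : ℤ × ℤ) :
    (boxesContaining l z).card = 2 ^ l * 2 ^ l := by
  simp only [boxesContaining, Finset.card_product, Int.card_Ioc, sub_sub_cancel]
  simp [Int.toNat_pow_of_nonneg]

theorem overlap_self (k i : ℕ) (u : ℤ × ℤ) : overlap k i u u = 1 := by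
  rw [overlap, Finset.inter_self, card_boxesContaining]
  push_cast
  exact mul_inv_cancel₀ (by positivity)

theorem overlap_le_one (k i : ℕ) (u w : ℤ × ℤ) : overlap k i u w ≤ 1 := by
  rw [← overlap_self k i u, overlap, overlap, Finset.inter_self]
  gcongr
  exact Finset.inter_subset_left

theorem overlap_eq_zero {k i : ℕ} {u w : ℤ × ℤ}
    (h : 2 ^ (i * k) ≤ |u.1 - w.1| ∨ 2 ^ (i * k) ≤ |u.2 - w.2|) : overlap k i u w = 0 := by
  have : boxesContaining (i * k) u ∩ boxesContaining (i * k) w = ∅ := by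
    ext a
    simp only [boxesContaining, Finset.mem_inter, Finset.mem_product, Finset.mem_Ioc,
      Finset.notMem_empty, iff_false]
    rintro ⟨⟨⟨h1, h2⟩, h3, h4⟩, ⟨h5, h6⟩, h7, h8⟩
    rcases h with h | h <;> rcases le_abs.1 h with h | h <;> linarith
  simp [overlap, this]

/-! ### The supremum of a level over a cell -/

/-- Two reflections handle the two parameters. First whole rows are reflected, for the walk with
values in the functions of `q` under the supremum norm; then columns are reflected with all rows
present. Each reflection costs a factor two, as does the two-sided tail of the full sum, which has
variance one. -/
theorem boxLaw_exists_partialSum_ge_le (l : ℕ) (f g : ℕ → ℤ) (hf : Function.Injective f)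
    (hg : Function.Injective g) (y : ℝ) (hy : 0 < y) :
    boxLaw {ω | ∃ p ≤ 2 ^ l, ∃ q ≤ 2 ^ l,
        y ≤ |∑ r ∈ Finset.range p, ∑ t ∈ Finset.range q, ω (l, (f r, g t))|} ≤
      8 * ENNReal.ofReal (Real.exp (-(y ^ 2 / 2))) := by
  set s := 2 ^ l with hs
  set S : ℕ → BoxCfg → (Fin (s + 1) → ℝ) := fun p ω q =>
    ∑ r ∈ Finset.range p, ∑ t ∈ Finset.range q, ω (l, (f r, g t)) with hS
  set S' : ℕ → BoxCfg → ℝ := fun q ω =>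
    ∑ r ∈ Finset.range s, ∑ t ∈ Finset.range q, ω (l, (f r, g t)) with hS'
  have e1 : {ω : BoxCfg | ∃ p ≤ s, ∃ q ≤ s,
      y ≤ |∑ r ∈ Finset.range p, ∑ t ∈ Finset.range q, ω (l, (f r, g t))|} ⊆
      {ω | ∃ p ≤ s, y ≤ ‖S p ω‖} := by
    rintro ω ⟨p, hp, q, hq, h⟩
    exact ⟨p, hp, h.trans (norm_le_pi_norm (S p ω) ⟨q, Nat.lt_succ_of_le hq⟩)⟩
  have e2 : {ω | y ≤ ‖S s ω‖} ⊆ {ω | ∃ q ≤ s, y ≤ ‖S' q ω‖} := by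
    intro ω hω
    by_contra hcon
    simp only [Set.mem_ofPred_eq, not_exists, not_and, not_le] at hω hcon
    refine absurd hω (not_le.2 ((pi_norm_lt_iff hy).2 fun q => ?_))
    exact hcon q (Nat.lt_succ_iff.1 q.2)
  -- The flip at `i` reverses all rows from the `i`-th on. Injectivity of `f` guarantees that it
  -- leaves the earlier rows alone.
  have r1 := boxLaw_exists_norm_ge_le s S
    (fun i _ => by simp only [hS]; fun_prop)
    (fun i => flipSign {j | ∃ r, i ≤ r ∧ j.2.1 = f r})
    (fun i => measurePreserving_flipSign _)
    (fun i _ r hr ω => by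
      funext q
      refine Finset.sum_congr rfl fun r' hr' => Finset.sum_congr rfl fun t _ => ?_
      refine if_neg ?_
      rintro ⟨r'', h1, h2⟩
      have := hf h2
      have := Finset.mem_range.1 hr'
      omega)
    (fun i hi ω => by
      funext q
      simp only [hS, Pi.add_apply]
      rw [← Finset.sum_range_add_sum_Ico _ hi,
        ← Finset.sum_range_add_sum_Ico (fun r => ∑ t ∈ Finset.range q, ω (l, (f r, g t))) hi]
      have a1 : ∀ r ∈ Finset.range i, ∑ t ∈ Finset.range (q : ℕ),
          flipSign {j | ∃ r, i ≤ r ∧ j.2.1 = f r} ω (l, (f r, g t)) =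
          ∑ t ∈ Finset.range (q : ℕ), ω (l, (f r, g t)) := fun r hr =>
        Finset.sum_congr rfl fun t _ => if_neg (by
          rintro ⟨r'', h1, h2⟩
          have := hf h2
          have := Finset.mem_range.1 hr
          omega)
      have a2 : ∀ r ∈ Finset.Ico i s, ∑ t ∈ Finset.range (q : ℕ),
          flipSign {j | ∃ r, i ≤ r ∧ j.2.1 = f r} ω (l, (f r, g t)) =
          -∑ t ∈ Finset.range (q : ℕ), ω (l, (f r, g t)) := fun r hr => by
        rw [← Finset.sum_neg_distrib]
        exact Finset.sum_congr rfl fun t _ => if_pos ⟨r, (Finset.mem_Ico.1 hr).1, rfl⟩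
      rw [Finset.sum_congr rfl a1, Finset.sum_congr rfl a2, Finset.sum_neg_distrib]
      ring) y
  have r2 := boxLaw_exists_norm_ge_le s S'
    (fun i _ => by simp only [hS']; fun_prop)
    (fun i => flipSign {j | ∃ t, i ≤ t ∧ j.2.2 = g t})
    (fun i => measurePreserving_flipSign _)
    (fun i _ r hr ω => by
      refine Finset.sum_congr rfl fun r' _ => Finset.sum_congr rfl fun t ht => ?_
      refine if_neg ?_
      rintro ⟨r'', h1, h2⟩
      have := hg h2
      have := Finset.mem_range.1 ht
      omega)
    (fun i hi ω => by
      simp only [hS']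
      simp only [← Finset.sum_add_distrib]
      refine Finset.sum_congr rfl fun r _ => ?_
      rw [Finset.sum_add_distrib, Finset.sum_add_distrib,
        ← Finset.sum_range_add_sum_Ico (fun t => ω (l, (f r, g t))) hi,
        ← Finset.sum_range_add_sum_Ico
          (fun t => flipSign {j | ∃ t, i ≤ t ∧ j.2.2 = g t} ω (l, (f r, g t))) hi]
      have a1 : ∀ t ∈ Finset.range i,
          flipSign {j | ∃ t, i ≤ t ∧ j.2.2 = g t} ω (l, (f r, g t)) = ω (l, (f r, g t)) :=
        fun t ht => if_neg (by
          rintro ⟨r'', h1, h2⟩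
          have := hg h2
          have := Finset.mem_range.1 ht
          omega)
      have a2 : ∀ t ∈ Finset.Ico i s,
          flipSign {j | ∃ t, i ≤ t ∧ j.2.2 = g t} ω (l, (f r, g t)) = -ω (l, (f r, g t)) :=
        fun t ht => if_pos ⟨t, (Finset.mem_Ico.1 ht).1, rfl⟩
      rw [Finset.sum_congr rfl a1, Finset.sum_congr rfl a2, Finset.sum_neg_distrib]
      ring) y
  have r3 : boxLaw {ω | y ≤ ‖S' s ω‖} ≤ 2 * ENNReal.ofReal (Real.exp (-(y ^ 2 / 2))) := by
    set A : Finset (ℤ × ℤ) :=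
      ((Finset.range s) ×ˢ (Finset.range s)).image fun x => (f x.1, g x.2)
    have hinj : Set.InjOn (fun x : ℕ × ℕ => (f x.1, g x.2))
        ((Finset.range s) ×ˢ (Finset.range s) : Finset (ℕ × ℕ)) := by
      rintro ⟨a, b⟩ _ ⟨c, d⟩ _ h
      simp only [Prod.mk.injEq] at h
      rw [hf h.1, hg h.2]
    have hlin : ∀ ω, S' s ω = lin ω (∑ a ∈ A, Finsupp.single (l, a) 1) := by
      intro ω
      simp only [map_sum, lin_single, one_mul, hS', A]
      rw [Finset.sum_image hinj, Finset.sum_product]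
    have hcard : A.card = s * s := by
      rw [Finset.card_image_of_injOn hinj, Finset.card_product, Finset.card_range]
    have := boxLaw_abs_lin_ge (∑ a ∈ A, Finsupp.single (l, a) 1) y y hy.le
    rw [linCov_sum_single, if_pos rfl, Finset.inter_self, hcard] at this
    simp only [hlin, Real.norm_eq_abs]
    refine this.trans (le_of_eq ?_)
    congr 4
    rw [hs]
    push_cast
    have : ((2:ℝ) ^ l) ≠ 0 := by positivity
    field_simp
    ring
  calc _ ≤ boxLaw {ω | ∃ p ≤ s, y ≤ ‖S p ω‖} := measure_mono e1
    _ ≤ 2 * boxLaw {ω | y ≤ ‖S s ω‖} := r1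
    _ ≤ 2 * (2 * (2 * ENNReal.ofReal (Real.exp (-(y ^ 2 / 2))))) := by
        gcongr
        exact (measure_mono e2).trans (r2.trans (by gcongr))
    _ = 8 * ENNReal.ofReal (Real.exp (-(y ^ 2 / 2))) := by
        rw [← mul_assoc, ← mul_assoc]; norm_num

/-- Cutting the window of corners at `A` yields initial segments of two walks, one going down and
one going up from `A`. The walks do not depend on `x`, so a maximal inequality covers all positions
in a cell at once. -/
theorem sum_Ioc_eq_sum_range_add_sum_range (A : ℤ) (x s : ℕ) (hx : x ≤ s) (F : ℤ → ℝ) :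
    ∑ a ∈ Finset.Ioc (A + x - s) (A + x), F a =
      ∑ r ∈ Finset.range (s - x), F (A - r) + ∑ r ∈ Finset.range x, F (A + 1 + r) := by
  have h1 : Finset.Ioc (A + x - s) A = (Finset.range (s - x)).image fun r : ℕ => A - (r : ℤ) := by
    ext a
    simp only [Finset.mem_Ioc, Finset.mem_image, Finset.mem_range]
    constructor
    · rintro ⟨h1, h2⟩
      exact ⟨(A - a).toNat, by omega, by omega⟩
    · rintro ⟨r, h1, h2⟩
      omega
  have h2 : Finset.Ioc A (A + x) = (Finset.range x).image fun r : ℕ => A + 1 + (r : ℤ) := by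
    ext a
    simp only [Finset.mem_Ioc, Finset.mem_image, Finset.mem_range]
    constructor
    · rintro ⟨h1, h2⟩
      exact ⟨(a - A - 1).toNat, by omega, by omega⟩
    · rintro ⟨r, h1, h2⟩
      omega
  rw [← Finset.Ioc_union_Ioc_eq_Ioc (b := A) (by omega) (by omega), Finset.sum_union, h1, h2,
    Finset.sum_image, Finset.sum_image]
  · intro a _ b _ h; simpa using h
  · intro a _ b _ h; simpa using h
  · rw [Finset.disjoint_left]
    intro a ha hb
    simp only [Finset.mem_Ioc] at ha hb
    omega

/-- The cell of side length `s` that contains `z`. -/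
def cell (s : ℤ) (z : ℤ × ℤ) : ℤ × ℤ := (z.1 / s, z.2 / s)

/-- The level `i` is at least `x` in absolute value somewhere on the cell `c`. -/
def highOn (k i : ℕ) (x : ℝ) (c : ℤ × ℤ) : Set BoxCfg :=
  {ω | ∃ z, cell (2 ^ (i * k)) z = c ∧ x ≤ |lev k i z ω|}

/-- The corners of the boxes containing a point of the cell fall into four quadrants around the
corner of the cell, and the level is `√k` times the sum of four two-parameter partial sums. One of
them is at least `x / (4 * √k)` in absolute value. This gives the factor `4 * 8` and the exponent `x
^ 2 / (32 * k)`. -/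
theorem boxLaw_highOn_le {k : ℕ} (hk : 1 ≤ k) (i : ℕ) (x : ℝ) (hx : 0 < x) (c : ℤ × ℤ) :
    boxLaw (highOn k i x c) ≤ 32 * ENNReal.ofReal (Real.exp (-(x ^ 2 / (32 * k)))) := by
  set l := i * k with hl
  have hk0 : (0 : ℝ) < k := by exact_mod_cast hk
  have hsk : 0 < Real.sqrt k := Real.sqrt_pos.2 hk0
  set y := x / (4 * Real.sqrt k) with hy
  have hy0 : 0 < y := by positivity
  have hyx : Real.exp (-(y ^ 2 / 2)) = Real.exp (-(x ^ 2 / (32 * k))) := by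
    rw [hy, div_pow, mul_pow, Real.sq_sqrt hk0.le]
    congr 1
    field_simp
    norm_num
  set dn : ℤ → ℕ → ℤ := fun A r => A - r
  set up : ℤ → ℕ → ℤ := fun A r => A + 1 + r
  have hdn : ∀ A, Function.Injective (dn A) := fun A a b h => by simpa [dn] using h
  have hup : ∀ A, Function.Injective (up A) := fun A a b h => by simpa [up] using h
  set E : (ℕ → ℤ) → (ℕ → ℤ) → Set BoxCfg := fun f g => {ω | ∃ p ≤ 2 ^ l, ∃ q ≤ 2 ^ l,
        y ≤ |∑ r ∈ Finset.range p, ∑ t ∈ Finset.range q, ω (l, (f r, g t))|} with hE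
  set A := c.1 * 2 ^ l
  set B := c.2 * 2 ^ l
  have hsub : highOn k i x c ⊆ (E (dn A) (dn B) ∪ E (dn A) (up B)) ∪
      (E (up A) (dn B) ∪ E (up A) (up B)) := by
    rintro ω ⟨z, hz, hxz⟩
    have hpos : (0 : ℤ) < 2 ^ l := by positivity
    obtain ⟨x1, hx1⟩ : ∃ x1 : ℕ, z.1 = A + x1 ∧ x1 ≤ 2 ^ l := by
      have h1 : z.1 / 2 ^ l = c.1 := congrArg Prod.fst hz
      have h2 := Int.emod_add_mul_ediv z.1 (2 ^ l)
      have h3 := Int.emod_nonneg z.1 hpos.ne'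
      have h4 := Int.emod_lt_of_pos z.1 hpos
      refine ⟨(z.1 % 2 ^ l).toNat, ?_, ?_⟩
      · rw [h1] at h2; rw [Int.toNat_of_nonneg h3]; simp only [A]; linarith
      · zify; rw [Int.toNat_of_nonneg h3]; exact h4.le
    obtain ⟨x2, hx2⟩ : ∃ x2 : ℕ, z.2 = B + x2 ∧ x2 ≤ 2 ^ l := by
      have h1 : z.2 / 2 ^ l = c.2 := congrArg Prod.snd hz
      have h2 := Int.emod_add_mul_ediv z.2 (2 ^ l)
      have h3 := Int.emod_nonneg z.2 hpos.ne'
      have h4 := Int.emod_lt_of_pos z.2 hpos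
      refine ⟨(z.2 % 2 ^ l).toNat, ?_, ?_⟩
      · rw [h1] at h2; rw [Int.toNat_of_nonneg h3]; simp only [B]; linarith
      · zify; rw [Int.toNat_of_nonneg h3]; exact h4.le
    have hdec : lev k i z ω = Real.sqrt k *
        ((∑ r ∈ Finset.range (2 ^ l - x1), ∑ t ∈ Finset.range (2 ^ l - x2), ω (l, (dn A r, dn B t))
        + ∑ r ∈ Finset.range (2 ^ l - x1), ∑ t ∈ Finset.range x2, ω (l, (dn A r, up B t))) +
        (∑ r ∈ Finset.range x1, ∑ t ∈ Finset.range (2 ^ l - x2), ω (l, (up A r, dn B t))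
        + ∑ r ∈ Finset.range x1, ∑ t ∈ Finset.range x2, ω (l, (up A r, up B t)))) := by
      rw [lev_eq, ← Finset.mul_sum, boxesContaining, Finset.sum_product, hx1.1, hx2.1]
      have h1 := sum_Ioc_eq_sum_range_add_sum_range A x1 (2 ^ l) hx1.2
      have h2 := sum_Ioc_eq_sum_range_add_sum_range B x2 (2 ^ l) hx2.2
      push_cast at h1 h2
      simp only [← hl, h1, h2, Finset.sum_add_distrib, dn, up]
    by_contra hcon
    simp only [Set.mem_union, not_or, hE, Set.mem_ofPred_eq, not_exists, not_and, not_le] at hcon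
    have c1 := hcon.1.1 _ (Nat.sub_le _ x1) _ (Nat.sub_le _ x2)
    have c2 := hcon.1.2 _ (Nat.sub_le _ x1) _ hx2.2
    have c3 := hcon.2.1 _ hx1.2 _ (Nat.sub_le _ x2)
    have c4 := hcon.2.2 _ hx1.2 _ hx2.2
    rw [hdec, abs_mul, abs_of_pos hsk] at hxz
    have c5 := hxz.trans_lt (mul_lt_mul_of_pos_left ((abs_add_le _ _).trans_lt (add_lt_add
      ((abs_add_le _ _).trans_lt (add_lt_add c1 c2))
      ((abs_add_le _ _).trans_lt (add_lt_add c3 c4)))) hsk)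
    have c6 : Real.sqrt k * (y + y + (y + y)) = x := by
      rw [hy]; field_simp; ring
    linarith
  have hb := fun f g hf hg => boxLaw_exists_partialSum_ge_le l f g hf hg y hy0
  rw [hyx] at hb
  refine (measure_mono hsub).trans ((measure_union_le _ _).trans ((add_le_add
    ((measure_union_le _ _).trans (add_le_add (hb _ _ (hdn A) (hdn B)) (hb _ _ (hdn A) (hup B))))
    ((measure_union_le _ _).trans (add_le_add (hb _ _ (hup A) (hdn B))
      (hb _ _ (hup A) (hup B))))).trans (le_of_eq ?_)))
  rw [← add_mul, ← add_mul]
  norm_num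

/-! ### Chains of cells along a lattice path -/

/-- Nearest neighbours in `ℤ²`. -/
def IsNbr (u v : ℤ × ℤ) : Prop := |u.1 - v.1| + |u.2 - v.2| = 1

/-- Lattice points at supremum distance at most `r`. -/
def Near (r : ℤ) (u v : ℤ × ℤ) : Prop := |u.1 - v.1| ≤ r ∧ |u.2 - v.2| ≤ r

instance (r : ℤ) (u v : ℤ × ℤ) : Decidable (Near r u v) := by unfold Near; infer_instance

theorem Near.trans {r r' : ℤ} {u v w : ℤ × ℤ} (h : Near r u v) (h' : Near r' v w) :
    Near (r + r') u w := by
  simp only [Near, abs_le] at *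
  omega

theorem Near.symm {r : ℤ} {u v : ℤ × ℤ} (h : Near r u v) : Near r v u := by
  simp only [Near, abs_le] at *
  omega

theorem Near.mono {r r' : ℤ} {u v : ℤ × ℤ} (h : Near r u v) (hr : r ≤ r') : Near r' u v :=
  ⟨h.1.trans hr, h.2.trans hr⟩

theorem near_self (u : ℤ × ℤ) : Near 1 u u := by simp [Near]

theorem abs_ediv_sub_ediv_le {x y s : ℤ} (hs : 0 < s) (h : |x - y| ≤ 1) :
    |x / s - y / s| ≤ 1 := by
  rw [abs_le] at *
  have h1 : x / s ≤ (y + 1) / s := Int.ediv_le_ediv hs (by omega)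
  have h2 : y / s ≤ (x + 1) / s := Int.ediv_le_ediv hs (by omega)
  have h3 : ∀ t : ℤ, (t + 1) / s ≤ t / s + 1 := fun t => by
    have := Int.add_mul_ediv_right t 1 hs.ne'
    rw [one_mul] at this
    rw [← this]
    exact Int.ediv_le_ediv hs (by omega)
  have := h3 x
  have := h3 y
  omega

theorem IsNbr.near_cell {s : ℤ} (hs : 0 < s) {u v : ℤ × ℤ} (h : IsNbr u v) :
    Near 1 (cell s u) (cell s v) := by
  have h1 := abs_nonneg (u.1 - v.1)
  have h2 := abs_nonneg (u.2 - v.2)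
  unfold IsNbr at h
  exact ⟨abs_ediv_sub_ediv_le hs (by omega), abs_ediv_sub_ediv_le hs (by omega)⟩

open Classical in
/-- A path is cut into pieces that start in a cell and leave its neighbourhood. -/
theorem exists_chain_of_cells {s : ℤ} (hs : 0 < s) (f : ℤ × ℤ → ℝ) (hf : ∀ z, 0 ≤ f z) (q : ℝ)
    (G : ℤ × ℤ → Prop)
    (hG : ∀ c, G c → ∀ a p z, List.IsChain IsNbr (a :: (p ++ [z])) → cell s a = c →
      (∀ w ∈ a :: p, Near 1 (cell s w) c) → ¬ Near 1 (cell s z) c → q ≤ ((a :: p).map f).sum) :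
    ∀ (n : ℕ) (a : ℤ × ℤ) (l : List (ℤ × ℤ)), l.length ≤ n → List.IsChain IsNbr (a :: l) →
      ∃ τ : List (ℤ × ℤ), List.IsChain (Near 2) (cell s a :: τ) ∧
        Near 1 (cell s ((a :: l).getLast (List.cons_ne_nil _ _)))
          ((cell s a :: τ).getLast (List.cons_ne_nil _ _)) ∧
        q * ((cell s a :: τ).dropLast.filter (fun c => G c)).length ≤ ((a :: l).map f).sum := by
  intro n
  induction n with
  | zero =>
    intro a l hl _
    obtain rfl : l = [] := List.length_eq_zero_iff.1 (by omega)
    exact ⟨[], by simp, by simpa using near_self _, by simpa using hf a⟩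
  | succ n ih =>
    intro a l hl hc
    by_cases hall : ∀ w ∈ a :: l, Near 1 (cell s w) (cell s a)
    · refine ⟨[], by simp, ?_, ?_⟩
      · simpa using hall _ (List.getLast_mem (List.cons_ne_nil a l))
      · have : 0 ≤ ((a :: l).map f).sum := List.sum_nonneg (by
          intro x hx
          obtain ⟨w, _, rfl⟩ := List.mem_map.1 hx
          exact hf w)
        simpa using this
    · set P : ℤ × ℤ → Bool := fun w => decide (Near 1 (cell s w) (cell s a)) with hP
      have hex : ∃ w ∈ l, P w = false := by
        push Not at hall
        obtain ⟨w, hw, hw'⟩ := hall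
        rcases List.mem_cons.1 hw with rfl | hw
        · exact absurd (near_self _) hw'
        · exact ⟨w, hw, by simpa [hP] using hw'⟩
      -- `b` is the first vertex outside the neighbourhood of the starting cell, and the next piece
      -- of the path starts at `b`.
      obtain ⟨p, b, r, hl', hp, hb⟩ : ∃ p b r, l = p ++ b :: r ∧ (∀ w ∈ p, P w = true) ∧
          P b = false := by
        clear ih hl hc hall
        induction l with
        | nil => simp at hex
        | cons x l ihl =>
          by_cases hx : P x = true
          · obtain ⟨p, b, r, h1, h2, h3⟩ := ihl (by
              obtain ⟨w, hw, hw'⟩ := hex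
              rcases List.mem_cons.1 hw with rfl | hw
              · simp [hx] at hw'
              · exact ⟨w, hw, hw'⟩)
            refine ⟨x :: p, b, r, by simp [h1], ?_, h3⟩
            intro w hw
            rcases List.mem_cons.1 hw with rfl | hw
            · exact hx
            · exact h2 w hw
          · exact ⟨[], x, l, rfl, by simp, by simpa using hx⟩
      subst hl'
      have hc' := (List.isChain_split (l₁ := a :: p) (c := b) (l₂ := r)).1 (by simpa using hc)
      have hmem : ∀ w ∈ a :: p, Near 1 (cell s w) (cell s a) := by
        intro w hw
        rcases List.mem_cons.1 hw with rfl | hw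
        · exact near_self _
        · simpa [hP] using hp w hw
      have hb' : ¬ Near 1 (cell s b) (cell s a) := by simpa [hP] using hb
      obtain ⟨τ, h1, h2, h3⟩ := ih b r (by simp at hl; omega) hc'.2
      -- The vertex before `b` is still within one cell of the starting cell, and a lattice step
      -- changes the cell by at most one.
      have hab : Near 2 (cell s a) (cell s b) := by
        have hlast := hmem _ (List.getLast_mem (List.cons_ne_nil a p))
        have hn : IsNbr ((a :: p).getLast (List.cons_ne_nil a p)) b :=
          (List.isChain_append.1 hc'.1).2.2 _ (by simp [List.getLast?_eq_some_getLast]) b (by simp)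
        have := hlast.symm.trans (hn.near_cell hs)
        exact this
      refine ⟨cell s b :: τ, List.isChain_cons_cons.2 ⟨hab, h1⟩, ?_, ?_⟩
      · simpa using h2
      · have hsum : ((a :: (p ++ b :: r)).map f).sum =
            ((a :: p).map f).sum + ((b :: r).map f).sum := by simp [add_assoc]
        rw [hsum, List.dropLast_cons_of_ne_nil (List.cons_ne_nil _ _), List.filter_cons]
        have h0 : 0 ≤ ((a :: p).map f).sum := List.sum_nonneg (by
          intro x hx
          obtain ⟨w, _, rfl⟩ := List.mem_map.1 hx
          exact hf w)
        by_cases hGa : G (cell s a)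
        · have := hG _ hGa a p b (by simpa using hc'.1) rfl hmem hb'
          simp only [hGa, decide_true, if_true, List.length_cons]
          push_cast
          linarith
        · simp only [hGa, decide_false, Bool.false_eq_true, if_false]
          linarith

/-- Loop erasure. -/
theorem exists_nodup_chain {α : Type*} {R : α → α → Prop} :
    ∀ (l : List α) (a : α), List.IsChain R (a :: l) →
      ∃ l', List.IsChain R (a :: l') ∧ (a :: l').Nodup ∧ (∀ x ∈ a :: l', x ∈ a :: l) ∧
        (a :: l').getLast (List.cons_ne_nil _ _) = (a :: l).getLast (List.cons_ne_nil _ _) := by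
  intro l
  induction l with
  | nil => exact fun a h => ⟨[], h, by simp, by simp, rfl⟩
  | cons b t ih =>
    intro a h
    obtain ⟨t', h1, h2, h3, h4⟩ := ih b (List.isChain_cons_cons.1 h).2
    -- If `a` occurs again, the loop up to that occurrence is dropped.
    by_cases ha : a ∈ b :: t'
    · obtain ⟨x, r, hr⟩ := List.append_of_mem ha
      rw [hr] at h1 h2
      refine ⟨r, h1.right_of_append, h2.of_append_right, ?_, ?_⟩
      · intro y hy
        exact List.mem_cons_of_mem _ (h3 y (by rw [hr]; exact List.mem_append_right _ hy))
      · rw [List.getLast_cons (List.cons_ne_nil b t), ← h4]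
        simp only [hr]
        rw [List.getLast_append_of_ne_nil]
    · refine ⟨b :: t', List.isChain_cons_cons.2 ⟨(List.isChain_cons_cons.1 h).1, h1⟩,
        List.nodup_cons.2 ⟨ha, h2⟩, ?_, ?_⟩
      · intro y hy
        rcases List.mem_cons.1 hy with rfl | hy
        · exact List.mem_cons_self
        · exact List.mem_cons_of_mem _ (h3 y hy)
      · rw [List.getLast_cons (List.cons_ne_nil _ _), List.getLast_cons (List.cons_ne_nil _ _), h4]

theorem near_getLast_of_isChain {r : ℤ} :
    ∀ (l : List (ℤ × ℤ)) (a : ℤ × ℤ), List.IsChain (Near r) (a :: l) →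
      Near (r * l.length) a ((a :: l).getLast (List.cons_ne_nil _ _)) := by
  intro l
  induction l with
  | nil => intro a _; simp [Near]
  | cons b t ih =>
    intro a h
    obtain ⟨h1, h2⟩ := List.isChain_cons_cons.1 h
    have := h1.trans (ih b h2)
    rw [List.getLast_cons (List.cons_ne_nil _ _)]
    refine this.mono (le_of_eq ?_)
    push_cast [List.length_cons]
    ring

open Classical in
/-- There are `32 h` distinct cells, each at distance at most two from the previous one, the first
of them in `S`, of which at least half belong to `B`. -/
def HasBadChain (h : ℕ) (S : Finset (ℤ × ℤ)) (B : ℤ × ℤ → Prop) : Prop :=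
  ∃ σ : List (ℤ × ℤ), σ.length = 32 * h ∧ σ.Nodup ∧ List.IsChain (Near 2) σ ∧
    (∀ c ∈ σ.head?, c ∈ S) ∧ 16 * h ≤ (σ.filter fun c => B c).length

/-- The chain of cells of a path that goes far, after loop erasure, has more than `32 * h` distinct
cells. Fewer than half of the first `32 * h` are bad, and each of the others pays `q` for a separate
piece of the path. -/
theorem le_sum_of_not_hasBadChain {s : ℤ} (hs : 0 < s) (f : ℤ × ℤ → ℝ) (hf : ∀ z, 0 ≤ f z)
    {q : ℝ} (hq : 0 ≤ q) (B : ℤ × ℤ → Prop)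
    (hB : ∀ c, ¬ B c → ∀ a p z, List.IsChain IsNbr (a :: (p ++ [z])) → cell s a = c →
      (∀ w ∈ a :: p, Near 1 (cell s w) c) → ¬ Near 1 (cell s z) c → q ≤ ((a :: p).map f).sum)
    {h : ℕ} {S : Finset (ℤ × ℤ)} (hno : ¬ HasBadChain h S B) {a : ℤ × ℤ} {l : List (ℤ × ℤ)}
    (hl : List.IsChain IsNbr (a :: l)) (ha : cell s a ∈ S)
    (hfar : ¬ Near (64 * h) (cell s a) (cell s ((a :: l).getLast (List.cons_ne_nil _ _)))) :
    16 * h * q ≤ ((a :: l).map f).sum := by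
  classical
  obtain ⟨τ, h1, h2, h3⟩ := exists_chain_of_cells hs f hf q (fun c => ¬ B c) hB l.length a l le_rfl hl
  obtain ⟨τ', h4, h5, h6, h7⟩ := exists_nodup_chain τ _ h1
  -- At most `32 * h - 1` steps of length two, plus one for the end of the path, reach no further
  -- than `64 * h - 1`.
  have hlen : 32 * h ≤ τ'.length := by
    by_contra hcon
    have h8 := near_getLast_of_isChain τ' _ h4
    rw [h7] at h8
    exact hfar ((h8.trans h2.symm).mono (by omega))
  set σ := (cell s a :: τ').take (32 * h) with hσ
  have hσlen : σ.length = 32 * h := by simp [hσ]; omega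
  have hσnd : σ.Nodup := h5.sublist (List.take_sublist _ _)
  have hbad : (σ.filter fun c => B c).length < 16 * h := by
    by_contra hcon
    refine hno ⟨σ, hσlen, hσnd, h4.take _, ?_, not_lt.1 hcon⟩
    intro c hc
    rcases Nat.eq_zero_or_pos h with rfl | hpos
    · simp [hσ] at hc
    · rw [hσ, List.head?_take, if_neg (by omega)] at hc
      simp only [List.head?_cons, Option.mem_def, Option.some.injEq] at hc
      exact hc ▸ ha
  have hgood : 16 * h ≤ (σ.filter fun c => ¬ B c).length := by
    have := List.length_eq_length_filter_add (l := σ) (fun c => decide (B c))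
    simp only [decide_not] 
    omega
  -- The last cell of `τ` pays nothing, since the final piece of the path need not leave its
  -- neighbourhood. It does not occur in `σ`, because `σ` is a proper prefix of a duplicate-free
  -- chain with the same last cell.
  have hsub : σ.filter (fun c => ¬ B c) ⊆ (cell s a :: τ).dropLast.filter fun c => ¬ B c := by
    intro c hc
    rw [List.mem_filter] at hc ⊢
    refine ⟨?_, hc.2⟩
    have hpre : σ <+: (cell s a :: τ').dropLast := by
      rw [hσ, List.dropLast_eq_take]
      exact List.take_prefix_take_left (by simpa using hlen)
    have hc1 := hpre.subset hc.1
    have hne : c ≠ (cell s a :: τ').getLast (List.cons_ne_nil _ _) := by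
      have := h5
      rw [← List.dropLast_append_getLast (List.cons_ne_nil (cell s a) τ')] at this
      rintro rfl
      exact (List.disjoint_of_nodup_append this) hc1 (by simp)
    have hc2 := h6 c (List.dropLast_subset _ hc1)
    rw [h7] at hne
    rw [← List.dropLast_append_getLast (List.cons_ne_nil (cell s a) τ)] at hc2
    rcases List.mem_append.1 hc2 with hc2 | hc2
    · exact hc2
    · exact absurd (List.mem_singleton.1 hc2) hne
  have hcount := ((hσnd.filter (fun c => decide (¬ B c))).subperm hsub).length_le
  refine le_trans ?_ h3
  rw [mul_comm]
  refine mul_le_mul_of_nonneg_left ?_ hq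
  calc (16 * h : ℝ) = ((16 * h : ℕ) : ℝ) := by push_cast; ring
    _ ≤ _ := Nat.cast_le.2 ((hgood.trans hcount).trans (le_of_eq (by congr; funext c; exact decide_eq_decide.2 Iff.rfl)))

/-! ### The probability of a bad chain -/

/-- The lattice points at distance at most two. -/
noncomputable def nearTwo (c : ℤ × ℤ) : Finset (ℤ × ℤ) :=
  Finset.Icc (c.1 - 2) (c.1 + 2) ×ˢ Finset.Icc (c.2 - 2) (c.2 + 2)

/-- The chains of cells with `m` steps of length at most two from a given cell. -/
noncomputable def chainsFrom : ℕ → ℤ × ℤ → Finset (List (ℤ × ℤ))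
  | 0, c => {[c]}
  | m + 1, c => (nearTwo c).biUnion fun c' => (chainsFrom m c').image fun l => c :: l

theorem card_chainsFrom_le (m : ℕ) : ∀ c, (chainsFrom m c).card ≤ 25 ^ m := by
  induction m with
  | zero => simp [chainsFrom]
  | succ m ih =>
    intro c
    refine (Finset.card_biUnion_le_card_mul _ _ (25 ^ m)
      fun c' _ => Finset.card_image_le.trans (ih c')).trans (le_of_eq ?_)
    have : (nearTwo c).card = 25 := by
      simp only [nearTwo, Finset.card_product, Int.card_Icc]
      ring_nf
      simp
    rw [this, pow_succ']

theorem mem_chainsFrom : ∀ (l : List (ℤ × ℤ)) (c : ℤ × ℤ), List.IsChain (Near 2) (c :: l) →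
    (c :: l) ∈ chainsFrom l.length c := by
  intro l
  induction l with
  | nil => intro c _; simp [chainsFrom]
  | cons b t ih =>
    intro c h
    obtain ⟨h1, h2⟩ := List.isChain_cons_cons.1 h
    simp only [chainsFrom, List.length_cons, Finset.mem_biUnion, Finset.mem_image]
    refine ⟨b, ?_, b :: t, ih b h2, rfl⟩
    simp only [Near, abs_le] at h1
    simp only [nearTwo, Finset.mem_product, Finset.mem_Icc]
    omega

/-- A set of cells any two of which are at distance at least four. -/
def IsSpread (T : Finset (ℤ × ℤ)) : Prop := ∀ x ∈ T, ∀ y ∈ T, x ≠ y → ¬ Near 3 x y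

/-- A Peierls argument: there are at most `25 ^ (32 * h)` chains from a given cell and at most `2 ^
(32 * h)` subsets of the cells of a chain, and `h` mutually distant bad cells are independent. -/
theorem boxLaw_hasBadChain_le {h : ℕ} (hh : 1 ≤ h) (S : Finset (ℤ × ℤ)) (E : ℤ × ℤ → Set BoxCfg)
    (A : ℤ × ℤ → Set BoxIdx) (hE : ∀ c, MeasurableSet[coordAlg (A c)] (E c))
    (hA : ∀ c c', ¬ Near 3 c c' → Disjoint (A c) (A c')) (p : ENNReal)
    (hp : ∀ c, boxLaw (E c) ≤ p) :
    boxLaw {ω | HasBadChain h S fun c => ω ∈ E c} ≤ S.card * (50 ^ 32 * p) ^ h := by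
  classical
  have hsub : {ω | HasBadChain h S fun c => ω ∈ E c} ⊆
      ⋃ c ∈ S, ⋃ σ ∈ chainsFrom (32 * h - 1) c,
        ⋃ T ∈ σ.toFinset.powerset.filter (fun T => T.card = h ∧ IsSpread T), ⋂ x ∈ T, E x := by
    rintro ω ⟨σ, h1, h2, h3, h4, h5⟩
    obtain ⟨c, l, rfl⟩ : ∃ c l, σ = c :: l := by
      cases σ with
      | nil => simp at h1; omega
      | cons c l => exact ⟨c, l, rfl⟩
    simp only [Set.mem_iUnion]
    refine ⟨c, h4 c (by simp), c :: l, ?_, ?_⟩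
    · have := mem_chainsFrom l c h3
      have hl : l.length = 32 * h - 1 := by simp at h1; omega
      rwa [hl] at this
    set D : Finset (ℤ × ℤ) := ((c :: l).filter fun c => ω ∈ E c).toFinset with hD
    have hDcard : 16 * h ≤ D.card := by
      rw [hD, List.toFinset_card_of_nodup (h2.filter _)]
      exact h5
    -- Of the `16 * h` bad cells at least `h` agree modulo four in both coordinates. Distinct cells
    -- of one class are at distance at least four.
    obtain ⟨y, _, hy⟩ := Finset.exists_le_card_fiber_of_mul_le_card_of_maps_to
      (s := D) (t := Finset.Ico (0 : ℤ) 4 ×ˢ Finset.Ico (0 : ℤ) 4) (n := h)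
      (f := fun x => (x.1 % 4, x.2 % 4))
      (fun x _ => by
        simp only [Finset.mem_product, Finset.mem_Ico]
        omega) ⟨(0, 0), by simp⟩ (by simpa using hDcard)
    obtain ⟨T, hT1, hT2⟩ := Finset.exists_subset_card_eq hy
    refine ⟨T, ?_, ?_⟩
    · simp only [Finset.mem_filter, Finset.mem_powerset]
      refine ⟨fun x hx => ?_, hT2, fun x hx z hz hxz hn => ?_⟩
      · have := (Finset.mem_filter.1 (hT1 hx)).1
        rw [hD, List.mem_toFinset, List.mem_filter] at this
        exact List.mem_toFinset.2 this.1
      · have e1 := (Finset.mem_filter.1 (hT1 hx)).2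
        have e2 := (Finset.mem_filter.1 (hT1 hz)).2
        simp only [Prod.ext_iff, Near, abs_le, ne_eq] at e1 e2 hn hxz
        omega
    · simp only [Set.mem_iInter]
      intro x hx
      have := (Finset.mem_filter.1 (hT1 hx)).1
      rw [hD, List.mem_toFinset, List.mem_filter] at this
      simpa using this.2
  refine (measure_mono hsub).trans ((measure_biUnion_finset_le _ _).trans ?_)
  refine (Finset.sum_le_card_nsmul _ _ ((50 ^ 32 * p) ^ h) fun c _ => ?_).trans
    (le_of_eq (by rw [nsmul_eq_mul]))
  refine (measure_biUnion_finset_le _ _).trans ?_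
  have hσ : ∀ σ ∈ chainsFrom (32 * h - 1) c, boxLaw (⋃ T ∈ σ.toFinset.powerset.filter
      (fun T => T.card = h ∧ IsSpread T), ⋂ x ∈ T, E x) ≤
      2 ^ σ.length * p ^ h := by
    intro σ _
    refine (measure_biUnion_finset_le _ _).trans ?_
    refine (Finset.sum_le_card_nsmul _ _ (p ^ h) fun T hT => ?_).trans ?_
    · obtain ⟨-, hc, hd⟩ := Finset.mem_filter.1 hT
      rw [boxLaw_biInter_of_disjoint T A E (fun c _ => hE c)
        (fun c hc c' hc' hne => hA c c' (hd c hc c' hc' hne)), ← hc]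
      exact Finset.prod_le_pow_card _ _ _ fun c _ => hp c
    · rw [nsmul_eq_mul]
      gcongr
      have : (σ.toFinset.powerset.filter (fun T => T.card = h ∧ IsSpread T)).card ≤ 2 ^ σ.length :=
        (Finset.card_filter_le _ _).trans (by
          rw [Finset.card_powerset]
          exact Nat.pow_le_pow_right (by norm_num) σ.toFinset_card_le)
      exact_mod_cast this
  have hlen : ∀ m c, ∀ σ ∈ chainsFrom m c, σ.length = m + 1 := by
    intro m
    induction m with
    | zero => simp [chainsFrom]
    | succ m ih =>
      intro c σ hσ
      simp only [chainsFrom, Finset.mem_biUnion, Finset.mem_image] at hσ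
      obtain ⟨c', _, l, hl, rfl⟩ := hσ
      simp [ih c' l hl]
  refine (Finset.sum_le_card_nsmul _ _ (2 ^ (32 * h) * p ^ h) fun σ hσ' => ?_).trans ?_
  · have := hσ σ hσ'
    rwa [hlen _ _ σ hσ', Nat.sub_add_cancel (by omega)] at this
  · rw [nsmul_eq_mul]
    have hc : ((chainsFrom (32 * h - 1) c).card : ENNReal) ≤ 25 ^ (32 * h) := by
      have := (card_chainsFrom_le (32 * h - 1) c).trans
        (Nat.pow_le_pow_right (by norm_num : 0 < 25) (Nat.sub_le _ 1))
      exact_mod_cast this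
    calc _ ≤ (25 : ENNReal) ^ (32 * h) * (2 ^ (32 * h) * p ^ h) := by gcongr
      _ = (50 ^ 32 * p) ^ h := by
        rw [← mul_assoc, ← mul_pow, pow_mul, ← mul_pow]
        norm_num

/-! ### The cost of leaving the neighbourhood of a cell -/

/-- The contribution of the levels below `j` to the field. -/
noncomputable def fieldBelow (k j : ℕ) (z : ℤ × ℤ) (ω : BoxCfg) : ℝ :=
  ∑ i ∈ Finset.range j, lev k i z ω

/-- Some path from the cell `c` of side length `2 ^ (j * k)` out of the neighbourhood of `c` has
cost less than `q` for the field of the levels below `j`. -/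
def Thin (k : ℕ) (γ : ℝ) (j : ℕ) (q : ℝ) (c : ℤ × ℤ) : Set BoxCfg :=
  {ω | ∃ (a : ℤ × ℤ) (p : List (ℤ × ℤ)) (z : ℤ × ℤ), (List.IsChain IsNbr (a :: (p ++ [z])) ∧
    cell (2 ^ (j * k)) a = c ∧ (∀ w ∈ a :: p, Near 1 (cell (2 ^ (j * k)) w) c) ∧
    ¬ Near 1 (cell (2 ^ (j * k)) z) c) ∧
    ((a :: p).map fun w => Real.exp (γ * fieldBelow k j w ω)).sum < q}

/-- The boxes with corners close to a cell of side length `s`. -/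
def cellRegion (s : ℤ) (c : ℤ × ℤ) : Set BoxIdx :=
  {i | ((c.1 - 2) * s < i.2.1 ∧ i.2.1 < (c.1 + 2) * s) ∧
    ((c.2 - 2) * s < i.2.2 ∧ i.2.2 < (c.2 + 2) * s)}

theorem disjoint_cellRegion {s : ℤ} (hs : 0 < s) {c c' : ℤ × ℤ} (h : ¬ Near 3 c c') :
    Disjoint (cellRegion s c) (cellRegion s c') := by
  rw [Set.disjoint_left]
  rintro i ⟨⟨h1, h2⟩, h3, h4⟩ ⟨⟨h5, h6⟩, h7, h8⟩
  have e1 := lt_of_mul_lt_mul_right (h1.trans h6) hs.le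
  have e2 := lt_of_mul_lt_mul_right (h5.trans h2) hs.le
  have e3 := lt_of_mul_lt_mul_right (h3.trans h8) hs.le
  have e4 := lt_of_mul_lt_mul_right (h7.trans h4) hs.le
  refine h ?_
  simp only [Near, abs_le]
  omega

/-- With `s = 2 ^ (j * k)`, the point `w` has coordinates from `(c - 1) * s` to below `(c + 2) * s`.
The corner of a box of side at most `s` that contains `w` lies less than `s` to the left of or below
it, hence the width two on either side in `cellRegion`. -/
theorem measurable_lev_cellRegion {k i j : ℕ} (hij : i ≤ j) {w c : ℤ × ℤ}
    (h : Near 1 (cell (2 ^ (j * k)) w) c) :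
    Measurable[coordAlg (cellRegion (2 ^ (j * k)) c)] (lev k i w) := by
  refine measurable_coordAlg_lev fun a ha => ?_
  have hs : (0 : ℤ) < 2 ^ (j * k) := by positivity
  have hle : (2 : ℤ) ^ (i * k) ≤ 2 ^ (j * k) :=
    pow_le_pow_right₀ (by norm_num) (Nat.mul_le_mul_right k hij)
  simp only [boxesContaining, Finset.mem_product, Finset.mem_Ioc] at ha
  simp only [Near, cell, abs_le] at h
  obtain ⟨⟨h1, h2⟩, h3, h4⟩ := h
  have e1 : (c.1 - 1) * 2 ^ (j * k) ≤ w.1 := (Int.le_ediv_iff_mul_le hs).1 (by omega)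
  have e2 : w.1 < (c.1 + 2) * 2 ^ (j * k) := (Int.ediv_lt_iff_lt_mul hs).1 (by omega)
  have e3 : (c.2 - 1) * 2 ^ (j * k) ≤ w.2 := (Int.le_ediv_iff_mul_le hs).1 (by omega)
  have e4 : w.2 < (c.2 + 2) * 2 ^ (j * k) := (Int.ediv_lt_iff_lt_mul hs).1 (by omega)
  refine ⟨⟨?_, ?_⟩, ?_, ?_⟩ <;> simp only <;> linarith [ha.1.1, ha.1.2, ha.2.1, ha.2.2]

theorem measurable_sum_map {Ω α : Type*} {m : MeasurableSpace Ω} (F : α → Ω → ℝ) (l : List α)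
    (h : ∀ w ∈ l, Measurable (F w)) : Measurable fun ω => (l.map fun w => F w ω).sum := by
  induction l with
  | nil => simp
  | cons a l ih =>
    simp only [List.map_cons, List.sum_cons]
    exact (h a List.mem_cons_self).add (ih fun w hw => h w (List.mem_cons_of_mem _ hw))

theorem measurableSet_const_and {Ω : Type*} {m : MeasurableSpace Ω} {c : Prop} {p : Ω → Prop}
    (h : c → MeasurableSet {ω | p ω}) : MeasurableSet {ω | c ∧ p ω} := by
  by_cases hc : c
  · simpa only [hc, true_and] using h hc
  · simp [hc]

theorem measurableSet_lt_const {Ω : Type*} {m : MeasurableSpace Ω} {f : Ω → ℝ}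
    (hf : Measurable f) (q : ℝ) : MeasurableSet {ω | f ω < q} :=
  measurableSet_lt hf measurable_const

theorem measurableSet_thin (k : ℕ) (γ : ℝ) (j : ℕ) (q : ℝ) (c : ℤ × ℤ) :
    MeasurableSet[coordAlg (cellRegion (2 ^ (j * k)) c)] (Thin k γ j q c) := by
  rw [Thin]
  simp only [Set.ofPred_exists]
  refine MeasurableSet.iUnion fun a => MeasurableSet.iUnion fun p => MeasurableSet.iUnion fun z => ?_
  refine measurableSet_const_and fun h => ?_
  refine measurableSet_lt_const
    (measurable_sum_map (fun w ω => Real.exp (γ * fieldBelow k j w ω)) (a :: p) fun w hw => ?_) q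
  refine Measurable.exp (Measurable.const_mul ?_ γ)
  exact Finset.measurable_sum _ fun i hi =>
    measurable_lev_cellRegion (Finset.mem_range.1 hi).le (h.2.2.1 w hw)

/-- The level `j` is below `-x` somewhere near the cell `c`. -/
def LowNear (k j : ℕ) (x : ℝ) (c : ℤ × ℤ) : Set BoxCfg :=
  {ω | ∃ z, Near 1 (cell (2 ^ (j * k)) z) c ∧ lev k j z ω < -x}

theorem measurableSet_lowNear (k j : ℕ) (x : ℝ) (c : ℤ × ℤ) :
    MeasurableSet[coordAlg (cellRegion (2 ^ (j * k)) c)] (LowNear k j x c) := by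
  rw [LowNear]
  simp only [Set.ofPred_exists]
  refine MeasurableSet.iUnion fun z => ?_
  exact measurableSet_const_and fun h =>
    measurableSet_lt_const (measurable_lev_cellRegion le_rfl h) (-x)

theorem boxLaw_lowNear_le {k : ℕ} (hk : 1 ≤ k) (j : ℕ) (x : ℝ) (hx : 0 < x) (c : ℤ × ℤ) :
    boxLaw (LowNear k j x c) ≤ 9 * (32 * ENNReal.ofReal (Real.exp (-(x ^ 2 / (32 * k))))) := by
  have hsub : LowNear k j x c ⊆ ⋃ c' ∈ Finset.Icc (c.1 - 1) (c.1 + 1) ×ˢ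
      Finset.Icc (c.2 - 1) (c.2 + 1), highOn k j x c' := by
    rintro ω ⟨z, hz, hl⟩
    simp only [Set.mem_iUnion]
    refine ⟨cell (2 ^ (j * k)) z, ?_, z, rfl, ?_⟩
    · simp only [Near, abs_le] at hz
      simp only [Finset.mem_product, Finset.mem_Icc]
      omega
    · rw [le_abs]; right; linarith
  refine (measure_mono hsub).trans ((measure_biUnion_finset_le _ _).trans ?_)
  refine (Finset.sum_le_card_nsmul _ _ _ fun c' _ => boxLaw_highOn_le hk j x hx c').trans ?_
  have h3 : ∀ y : ℤ, (y + 1 + 1 - (y - 1)).toNat = 3 := fun y => by omega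
  rw [nsmul_eq_mul, Finset.card_product, Int.card_Icc, Int.card_Icc, h3, h3]
  norm_num

theorem cell_cell {s t : ℤ} (hs : 0 ≤ s) (z : ℤ × ℤ) : cell t (cell s z) = cell (s * t) z := by
  simp only [cell, Int.ediv_ediv_of_nonneg hs]

/-- The cells of which a cell of the next scale consists. -/
noncomputable def subcells (K : ℤ) (c : ℤ × ℤ) : Finset (ℤ × ℤ) :=
  Finset.Ico (c.1 * K) ((c.1 + 1) * K) ×ˢ Finset.Ico (c.2 * K) ((c.2 + 1) * K)

theorem mem_subcells {K : ℤ} (hK : 0 < K) {c c' : ℤ × ℤ} :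
    c' ∈ subcells K c ↔ cell K c' = c := by
  simp only [subcells, cell, Finset.mem_product, Finset.mem_Ico, Prod.ext_iff]
  rw [← Int.le_ediv_iff_mul_le hK, ← Int.le_ediv_iff_mul_le hK, ← Int.ediv_lt_iff_lt_mul hK,
    ← Int.ediv_lt_iff_lt_mul hK]
  omega

theorem card_subcells (K : ℕ) (c : ℤ × ℤ) : (subcells K c).card = K * K := by
  simp only [subcells, Finset.card_product, Int.card_Ico, add_mul, one_mul, add_sub_cancel_left]
  simp

/-- A displacement of at most `K` changes the quotient by `K` by at most one. So a path leaving the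
neighbourhood of a coarse cell has moved by more than `r` fine cells already at the vertex before
the exit. -/
theorem not_near_of_leave {K : ℤ} {r : ℤ} (hr : r < K) {c u v z : ℤ × ℤ}
    (hu : cell K u = c) (hz : ¬ Near 1 (cell K z) c) (hvz : Near 1 v z) : ¬ Near r u v := by
  have hr0 : ∀ h : Near r u v, 0 ≤ r := fun h => (abs_nonneg _).trans h.1
  intro h
  have hK : 0 < K := (hr0 h).trans_lt hr
  refine hz ?_
  have key : ∀ x y : ℤ, |x - y| ≤ K → |y / K - x / K| ≤ 1 := by
    intro x y hxy
    rw [abs_le] at hxy ⊢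
    have h1 : (y + 1 * K) / K = y / K + 1 := Int.add_mul_ediv_right y 1 hK.ne'
    have h2 : (x + 1 * K) / K = x / K + 1 := Int.add_mul_ediv_right x 1 hK.ne'
    have h3 : x / K ≤ (y + 1 * K) / K := Int.ediv_le_ediv hK (by omega)
    have h4 : y / K ≤ (x + 1 * K) / K := Int.ediv_le_ediv hK (by omega)
    omega
  have h2 := h.trans hvz
  subst hu
  exact ⟨key _ _ (h2.1.trans (by omega)), key _ _ (h2.2.trans (by omega))⟩

/-- Renormalisation with a bound that reproduces itself. A cell of scale `j` is bad if it is thin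
(probability at most `P / 2` by induction) or if level `j` is low near it (at most `P / 2` by
`hP₁`). With bad probability `P`, the Peierls bound over the `K ^ 2` starting subcells is again at
most `P / 2`. Without a bad chain, `16 * h` good cells each pay the previous cost times `exp (-(γ *
x))`. -/
theorem boxLaw_thin_le {k h : ℕ} (hk : 1 ≤ k) {γ x : ℝ} (hγ : 0 ≤ γ) (hx : 0 < x) (hh : 1 ≤ h)
    (hhk : 64 * h < 2 ^ k) {P : ENNReal}
    (hP₁ : 9 * (32 * ENNReal.ofReal (Real.exp (-(x ^ 2 / (32 * k))))) ≤ P / 2)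
    (hP₂ : 50 ^ 32 * P ≤ 1 / 2) (hP₃ : 2 ^ k * 2 ^ k * (1 / 2) ^ h ≤ P / 2) (j : ℕ) :
    ∀ c, boxLaw (Thin k γ j ((16 * h * Real.exp (-(γ * x))) ^ j) c) ≤ P / 2 := by
  induction j with
  | zero =>
    intro c
    -- The field without levels vanishes, so a single vertex already costs one.
    have : Thin k γ 0 ((16 * h * Real.exp (-(γ * x))) ^ 0) c = ∅ := by
      ext ω
      simp only [Thin, Set.mem_ofPred_eq, Set.mem_empty_iff_false, iff_false, not_exists, not_and,
        not_lt, fieldBelow, Finset.range_zero, Finset.sum_empty, mul_zero, Real.exp_zero, pow_zero]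
      intro a p z _
      simp
    rw [this]
    simp
  | succ j ih =>
    intro c
    set q := (16 * h * Real.exp (-(γ * x))) ^ j with hq
    have hq0 : 0 ≤ q := by positivity
    set E : ℤ × ℤ → Set BoxCfg := fun c' => Thin k γ j q c' ∪ LowNear k j x c' with hE
    have hs : (0 : ℤ) < 2 ^ (j * k) := by positivity
    have hmul : (2 : ℤ) ^ ((j + 1) * k) = 2 ^ (j * k) * 2 ^ k := by rw [← pow_add]; ring_nf
    have hsub : Thin k γ (j + 1) ((16 * h * Real.exp (-(γ * x))) ^ (j + 1)) c ⊆
        {ω | HasBadChain h (subcells ((2 ^ k : ℕ) : ℤ) c) fun c' => ω ∈ E c'} := by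
      rintro ω ⟨a, p, z, ⟨h1, h2, h3, h4⟩, h5⟩
      by_contra hno
      refine absurd h5 (not_lt.2 ?_)
      have h6 := (List.isChain_append (l₁ := a :: p) (l₂ := [z])).1 (by simpa using h1)
      have hlast : IsNbr ((a :: p).getLast (List.cons_ne_nil a p)) z :=
        h6.2.2 _ (by simp [List.getLast?_eq_some_getLast]) z (by simp)
      rw [hmul, ← cell_cell hs.le] at h2 h4
      have := le_sum_of_not_hasBadChain hs (fun w => Real.exp (γ * fieldBelow k (j + 1) w ω))
        (fun w => (Real.exp_pos _).le) (q := Real.exp (-(γ * x)) * q) (by positivity) _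
        (fun c' hc' a p z i1 i2 i3 i4 => ?_) hno h6.1 ?_ ?_
      · refine le_trans (le_of_eq ?_) this
        rw [pow_succ, ← hq]; ring
      · simp only [hE, Set.mem_union, not_or] at hc'
        obtain ⟨hc1, hc2⟩ := hc'
        have e1 : q ≤ ((a :: p).map fun w => Real.exp (γ * fieldBelow k j w ω)).sum := by
          by_contra hcon
          exact hc1 ⟨a, p, z, ⟨i1, i2, i3, i4⟩, not_le.1 hcon⟩
        refine (mul_le_mul_of_nonneg_left e1 (Real.exp_pos _).le).trans ?_
        rw [← List.sum_map_mul_left]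
        refine List.sum_le_sum fun w hw => ?_
        rw [← Real.exp_add, Real.exp_le_exp, fieldBelow, fieldBelow, Finset.sum_range_succ]
        have e2 : -x ≤ lev k j w ω := by
          by_contra hcon
          exact hc2 ⟨w, i3 w hw, not_le.1 hcon⟩
        nlinarith
      · rw [mem_subcells (by positivity)]
        exact_mod_cast h2
      · exact not_near_of_leave (by exact_mod_cast hhk) h2 h4 (hlast.near_cell hs)
    refine (measure_mono hsub).trans ?_
    have hEp : ∀ c', boxLaw (E c') ≤ P := fun c' => by
      refine (measure_union_le _ _).trans ?_
      rw [← ENNReal.add_halves P]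
      exact add_le_add (ih c') ((boxLaw_lowNear_le hk j x hx c').trans hP₁)
    refine (boxLaw_hasBadChain_le hh _ E (cellRegion (2 ^ (j * k)))
      (fun c' => (measurableSet_thin k γ j q c').union (measurableSet_lowNear k j x c'))
      (fun c c' hn => disjoint_cellRegion hs hn) P hEp).trans (le_trans ?_ hP₃)
    rw [card_subcells]
    push_cast
    gcongr

/-! ### Connected sets of lattice points -/

/-- Two points are joined by a path in `A`. -/
def Linked (A : Set (ℤ × ℤ)) : ℤ × ℤ → ℤ × ℤ → Prop :=
  Relation.ReflTransGen fun u v => u ∈ A ∧ v ∈ A ∧ IsNbr u v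

theorem IsNbr.symm {u v : ℤ × ℤ} (h : IsNbr u v) : IsNbr v u := by
  rw [IsNbr, abs_sub_comm v.1, abs_sub_comm v.2]; exact h

theorem Linked.symm {A : Set (ℤ × ℤ)} {u v : ℤ × ℤ} (h : Linked A u v) : Linked A v u :=
  haveI : Std.Symm fun u v => u ∈ A ∧ v ∈ A ∧ IsNbr u v := ⟨fun _ _ h => ⟨h.2.1, h.1, h.2.2.symm⟩⟩
  (Relation.ReflTransGen.stdSymm (r := fun u v => u ∈ A ∧ v ∈ A ∧ IsNbr u v)).symm _ _ h

theorem Linked.trans {A : Set (ℤ × ℤ)} {u v w : ℤ × ℤ} (h : Linked A u v) (h' : Linked A v w) :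
    Linked A u w := Relation.ReflTransGen.trans h h'

theorem Linked.swap {A : Set (ℤ × ℤ)} {u v : ℤ × ℤ} (h : Linked (Prod.swap ⁻¹' A) u v) :
    Linked A u.swap v.swap := by
  induction h with
  | refl => exact Relation.ReflTransGen.refl
  | tail _ hab ih =>
    refine ih.tail ⟨hab.1, hab.2.1, ?_⟩
    have := hab.2.2
    simp only [IsNbr, Prod.fst_swap, Prod.snd_swap] at this ⊢
    omega

theorem linked_row {A : Set (ℤ × ℤ)} {a b y : ℤ} (h : ∀ x, a ≤ x → x < b → (x, y) ∈ A) {x₁ x₂ : ℤ}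
    (h₁ : a ≤ x₁) (h₁' : x₁ < b) (h₂ : a ≤ x₂) (h₂' : x₂ < b) : Linked A (x₁, y) (x₂, y) := by
  have key : ∀ x₁, a ≤ x₁ → ∀ x₂, x₁ ≤ x₂ → x₂ < b → Linked A (x₁, y) (x₂, y) := by
    intro x₁ h₁ x₂ h12
    induction x₂, h12 using Int.leInduction with
    | base => exact fun _ => Relation.ReflTransGen.refl
    | succ x hx ih =>
      intro hb
      refine (ih (by omega)).tail ⟨h x (by omega) (by omega), h _ (by omega) hb, ?_⟩
      simp [IsNbr]
  rcases le_total x₁ x₂ with h12 | h12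
  · exact key x₁ h₁ x₂ h12 h₂'
  · exact (key x₂ h₂ x₁ h12 h₁').symm

theorem linked_col {A : Set (ℤ × ℤ)} {a b x : ℤ} (h : ∀ y, a ≤ y → y < b → (x, y) ∈ A) {y₁ y₂ : ℤ}
    (h₁ : a ≤ y₁) (h₁' : y₁ < b) (h₂ : a ≤ y₂) (h₂' : y₂ < b) : Linked A (x, y₁) (x, y₂) :=
  (linked_row (A := Prod.swap ⁻¹' A) h h₁ h₁' h₂ h₂').swap

/-- Any two points of the set are joined by a path in the set. -/
def IsPreconn (A : Set (ℤ × ℤ)) : Prop := ∀ u ∈ A, ∀ v ∈ A, Linked A u v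

/-! ### Roads -/

open Classical in
/-- The smallest number below `m` with the property `p`, or zero if there is none. -/
noncomputable def sel (p : ℕ → Prop) (m : ℕ) : ℕ :=
  if h : ∃ y, y < m ∧ p y then @Nat.find _ (Classical.decPred _) h else 0

theorem sel_lt {p : ℕ → Prop} {m : ℕ} (hm : 0 < m) : sel p m < m := by
  unfold sel
  split_ifs with h
  · exact (@Nat.find_spec _ (Classical.decPred _) h).1
  · exact hm

theorem sel_spec {p : ℕ → Prop} {m : ℕ} (h : ∃ y, y < m ∧ p y) : p (sel p m) := by
  rw [sel, dif_pos h]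
  exact (@Nat.find_spec _ (Classical.decPred _) h).2

theorem sel_eq_iff {p : ℕ → Prop} {m y : ℕ} :
    sel p m = y ↔ (y < m ∧ p y ∧ ∀ y' < y, ¬ p y') ∨ (y = 0 ∧ ∀ y' < m, ¬ p y') := by
  by_cases h : ∃ y, y < m ∧ p y
  · rw [sel, dif_pos h, @Nat.find_eq_iff _ _ (Classical.decPred _)]
    constructor
    · rintro ⟨⟨h1, h2⟩, h3⟩
      exact Or.inl ⟨h1, h2, fun y' hy' hp => h3 y' hy' ⟨hy'.trans h1, hp⟩⟩
    · rintro (⟨h1, h2, h3⟩ | ⟨_, h2⟩)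
      · exact ⟨⟨h1, h2⟩, fun y' hy' hp => h3 y' hy' hp.2⟩
      · obtain ⟨y', h3, h4⟩ := h
        exact absurd h4 (h2 y' h3)
  · rw [sel, dif_neg h]
    push Not at h
    constructor
    · rintro rfl
      exact Or.inr ⟨rfl, h⟩
    · rintro (⟨h1, h2, h3⟩ | ⟨h1, _⟩)
      · exact absurd h2 (h y h1)
      · exact h1.symm

/-- All cells of a row of two neighbouring blocks of side `m` at the bottom of a strip are good. -/
def RowGood (K m : ℕ) (good : ℤ × ℤ → Prop) (t r : ℤ) (y : ℕ) : Prop :=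
  ∀ x, t * m ≤ x → x < (t + 2) * m → good (x, r * K + y)

/-- All cells of a column of a block of side `m` at the bottom of a strip are good. -/
def ColGood (K m : ℕ) (good : ℤ × ℤ → Prop) (t r : ℤ) (x : ℕ) : Prop :=
  ∀ y, r * K ≤ y → y < r * K + m → good (t * m + x, y)

/-- The chosen row of two neighbouring blocks. -/
noncomputable def rowSel (K m : ℕ) (good : ℤ × ℤ → Prop) (t r : ℤ) : ℕ :=
  sel (RowGood K m good t r) m

/-- The chosen column of a block. -/
noncomputable def colSel (K m : ℕ) (good : ℤ × ℤ → Prop) (t r : ℤ) : ℕ :=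
  sel (ColGood K m good t r) m

/-- The cells of the horizontal roads. -/
def HRoad (K m : ℕ) (good : ℤ × ℤ → Prop) (c : ℤ × ℤ) : Prop :=
  (∃ t r : ℤ, t * m ≤ c.1 ∧ c.1 < (t + 2) * m ∧ c.2 = r * K + rowSel K m good t r) ∨
    ∃ t r : ℤ, c.1 = t * m + colSel K m good t r ∧ r * K ≤ c.2 ∧ c.2 < r * K + m

/-- The cells of the horizontal and vertical roads. -/
def Road (K m : ℕ) (good : ℤ × ℤ → Prop) (c : ℤ × ℤ) : Prop :=
  HRoad K m good c ∨ HRoad K m (fun c => good c.swap) c.swap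

/-- A point of the horizontal roads in a given block. -/
noncomputable def hNode (K m : ℕ) (good : ℤ × ℤ → Prop) (t r : ℤ) : ℤ × ℤ :=
  (t * m + colSel K m good t r, r * K + rowSel K m good t r)

/-- The row chosen for the blocks `t` and `t + 1` crosses the chosen columns of both blocks, so
consecutive nodes are joined. Only the positions below `m` of the selected lines matter, not whether
they are good: `sel` always returns some line, and connectivity is deterministic. -/
theorem linked_hNode {K m : ℕ} (hm : 0 < m) {good : ℤ × ℤ → Prop} {A : Set (ℤ × ℤ)} {a b r : ℤ}
    (hA : ∀ c, HRoad K m good c → a * m ≤ c.1 → c.1 < b * m → r * K ≤ c.2 → c.2 < r * K + m →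
      c ∈ A) :
    (∀ t x, a ≤ t → t < b → t * m ≤ x → x < (t + 1) * m →
      Linked A (x, r * K + rowSel K m good t r) (hNode K m good t r)) ∧
    (∀ t x, a ≤ t → t < b → t * m ≤ x → x < (t + 1) * m →
      Linked A (x, r * K + rowSel K m good (t - 1) r) (hNode K m good t r)) ∧
    (∀ t y, a ≤ t → t < b → r * K ≤ y → y < r * K + m →
      Linked A (t * m + colSel K m good t r, y) (hNode K m good t r)) ∧
    ∀ t t', a ≤ t → t < b → a ≤ t' → t' < b →
      Linked A (hNode K m good t r) (hNode K m good t' r) := by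
  have hm' : (0 : ℤ) < m := by exact_mod_cast hm
  have hrow : ∀ t, (rowSel K m good t r : ℤ) < m := fun t => by exact_mod_cast sel_lt hm
  have hcol : ∀ t, (colSel K m good t r : ℤ) < m := fun t => by exact_mod_cast sel_lt hm
  have e1 : ∀ t : ℤ, (t + 1) * m = t * m + m := fun t => by ring
  have e2 : ∀ t : ℤ, (t + 2) * m = t * m + m + m := fun t => by ring
  have e3 : ∀ t : ℤ, (t - 1 + 2) * m = t * m + m := fun t => by ring
  have e4 : ∀ t : ℤ, (t - 1) * m = t * m - m := fun t => by ring
  have hblk : ∀ t, a ≤ t → t < b → a * m ≤ t * m ∧ t * m + m ≤ b * m := by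
    intro t h1 h2
    refine ⟨mul_le_mul_of_nonneg_right h1 hm'.le, ?_⟩
    rw [← e1]
    exact mul_le_mul_of_nonneg_right h2 hm'.le
  have rowmem : ∀ t x : ℤ, t * m ≤ x → x < t * m + m + m → a * m ≤ x → x < b * m →
      (x, r * K + (rowSel K m good t r : ℤ)) ∈ A := by
    intro t x h1 h2 h3 h4
    have := hrow t
    refine hA _ (Or.inl ⟨t, r, h1, by rw [e2]; exact h2, rfl⟩) h3 h4 ?_ ?_ <;> simp only <;> omega
  have colmem : ∀ t y : ℤ, a ≤ t → t < b → r * K ≤ y → y < r * K + m →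
      (t * m + (colSel K m good t r : ℤ), y) ∈ A := by
    intro t y h1 h2 h3 h4
    have := hcol t
    have := hblk t h1 h2
    refine hA _ (Or.inr ⟨t, r, rfl, h3, h4⟩) ?_ ?_ h3 h4 <;> simp only <;> omega
  have i3 : ∀ t y, a ≤ t → t < b → r * K ≤ y → y < r * K + m →
      Linked A (t * m + colSel K m good t r, y) (hNode K m good t r) := by
    intro t y h1 h2 h3 h4
    have := hrow t
    exact linked_col (fun y => colmem t y h1 h2) h3 h4 (by omega) (by omega)
  have i1 : ∀ t x, a ≤ t → t < b → t * m ≤ x → x < (t + 1) * m →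
      Linked A (x, r * K + rowSel K m good t r) (hNode K m good t r) := by
    intro t x h1 h2 h3 h4
    have := hcol t
    have := hblk t h1 h2
    rw [e1] at h4
    exact linked_row (a := t * m) (b := t * m + m)
      (fun x h5 h6 => rowmem t x h5 (by omega) (by omega) (by omega)) h3 h4 (by omega) (by omega)
  have i2 : ∀ t x, a ≤ t → t < b → t * m ≤ x → x < (t + 1) * m →
      Linked A (x, r * K + rowSel K m good (t - 1) r) (hNode K m good t r) := by
    intro t x h1 h2 h3 h4
    have := hcol t
    have := hrow (t - 1)
    have := hblk t h1 h2
    rw [e1] at h4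
    have h5 := linked_row (A := A) (a := t * m) (b := t * m + m)
      (y := r * K + rowSel K m good (t - 1) r)
      (fun x h5 h6 => rowmem (t - 1) x (by rw [e4]; omega) (by rw [e4]; omega) (by omega)
        (by omega)) h3 h4 (x₂ := t * m + colSel K m good t r) (by omega) (by omega)
    exact h5.trans (i3 t _ h1 h2 (by omega) (by omega))
  refine ⟨i1, i2, i3, ?_⟩
  have hstep : ∀ t, a ≤ t → t + 1 < b →
      Linked A (hNode K m good t r) (hNode K m good (t + 1) r) := by
    intro t h1 h2
    have c1 := hcol t
    have c2 := hcol (t + 1)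
    have b1 := hblk t h1 (by omega)
    have b2 := hblk (t + 1) (by omega) h2
    have h5 := linked_row (A := A) (a := t * m) (b := t * m + m + m)
      (y := r * K + rowSel K m good t r)
      (fun x h5 h6 => rowmem t x h5 h6 (by omega) (by rw [e1] at b2; omega))
      (x₁ := t * m + colSel K m good t r) (x₂ := (t + 1) * m + colSel K m good (t + 1) r)
      (by omega) (by omega) (by rw [e1]; omega) (by rw [e1]; omega)
    have h6 := i2 (t + 1) ((t + 1) * m + colSel K m good (t + 1) r) (by omega) h2 (by omega)
      (by rw [e1 (t + 1)]; omega)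
    rw [add_sub_cancel_right] at h6
    exact h5.trans h6
  have hchain : ∀ t, a ≤ t → ∀ t', t ≤ t' → t' < b →
      Linked A (hNode K m good t r) (hNode K m good t' r) := by
    intro t h1 t' h2
    induction t', h2 using Int.leInduction with
    | base => exact fun _ => Relation.ReflTransGen.refl
    | succ t' h ih => exact fun hb => (ih (by omega)).trans (hstep t' (by omega) hb)
  intro t t' h1 h2 h3 h4
  rcases le_total t t' with h | h
  · exact hchain t h1 t' h h4
  · exact (hchain t' h3 t h h2).symm

theorem HRoad.linked_hNode {K m : ℕ} (hm : 0 < m) (hmK : m ≤ K) {good : ℤ × ℤ → Prop}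
    {A : Set (ℤ × ℤ)} {a b r : ℤ}
    (hA : ∀ c, HRoad K m good c → a * m ≤ c.1 → c.1 < b * m → r * K ≤ c.2 → c.2 < r * K + m →
      c ∈ A) {c : ℤ × ℤ} (hc : HRoad K m good c) (h₁ : a * m ≤ c.1) (h₂ : c.1 < b * m)
    (h₃ : r * K ≤ c.2) (h₄ : c.2 < (r + 1) * K) {t : ℤ} (ht : a ≤ t) (ht' : t < b) :
    Linked A c (hNode K m good t r) := by
  obtain ⟨i1, i2, i3, i4⟩ := _root_.linked_hNode hm hA
  have hm' : (0 : ℤ) < m := by exact_mod_cast hm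
  have hmK' : (m : ℤ) ≤ K := by exact_mod_cast hmK
  have hstrip : ∀ r' : ℤ, r' * K ≤ c.2 → c.2 < r' * K + m → r' = r := by
    intro r' h5 h6
    have h7 : r' * K < (r + 1) * K := by omega
    have h8 : r * K < (r' + 1) * K := by
      have : (r' + 1) * (K : ℤ) = r' * K + K := by ring
      omega
    have := lt_of_mul_lt_mul_right h7 (by omega)
    have := lt_of_mul_lt_mul_right h8 (by omega)
    omega
  rcases hc with ⟨t', r', h5, h6, h7⟩ | ⟨t', r', h5, h6, h7⟩
  · have hlt : (rowSel K m good t' r' : ℤ) < m := by exact_mod_cast sel_lt hm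
    obtain rfl := hstrip r' (by omega) (by omega)
    have hc : c = (c.1, r' * K + (rowSel K m good t' r' : ℤ)) := by rw [← h7]
    rw [hc]
    by_cases h8 : c.1 < (t' + 1) * m
    · have ha : a ≤ t' := by
        have := lt_of_mul_lt_mul_right (h₁.trans_lt h8) hm'.le
        omega
      have hb : t' < b := lt_of_mul_lt_mul_right (h5.trans_lt h₂) hm'.le
      exact (i1 t' c.1 ha hb h5 h8).trans (i4 _ _ ha hb ht ht')
    · have ha : a ≤ t' + 1 := by
        have := lt_of_mul_lt_mul_right (h₁.trans_lt h6) hm'.le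
        omega
      have hb : t' + 1 < b := lt_of_mul_lt_mul_right ((not_lt.1 h8).trans_lt h₂) hm'.le
      have := i2 (t' + 1) c.1 ha hb (not_lt.1 h8) (by
        have : (t' + 1 + 1) * (m : ℤ) = (t' + 2) * m := by ring
        omega)
      rw [add_sub_cancel_right] at this
      exact this.trans (i4 _ _ ha hb ht ht')
  · obtain rfl := hstrip r' h6 h7
    have hlt : (colSel K m good t' r' : ℤ) < m := by exact_mod_cast sel_lt hm
    have hc : c = (t' * m + (colSel K m good t' r' : ℤ), c.2) := by rw [← h5]
    rw [hc]
    have ha : a ≤ t' := by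
      have := lt_of_mul_lt_mul_right (b := a) (c := t' + 1) (a := (m : ℤ)) (by
        have : (t' + 1) * (m : ℤ) = t' * m + m := by ring
        omega) hm'.le
      omega
    have hb : t' < b := lt_of_mul_lt_mul_right (a := (m : ℤ)) (by omega) hm'.le
    exact (i3 t' c.2 ha hb h6 h7).trans (i4 _ _ ha hb ht ht')

/-- One refinement step of the network: `D` is a connected set of coarse cells, and `A` consists of
road cells in them and of complete coarse cells. Within a coarse cell the horizontal and vertical
roads cross in the block at the bottom left corner. The horizontal strip continues into the right
neighbour and the vertical one into the upper neighbour. A complete cell contains the node of its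
own roads. -/
theorem isPreconn_of_road {K m M : ℕ} (hm : 0 < m) (hM : 0 < M) (hK : K = M * m)
    {good : ℤ × ℤ → Prop} {A D : Set (ℤ × ℤ)} (hD : IsPreconn D) (hA₁ : ∀ c ∈ A, cell K c ∈ D)
    (hA₂ : ∀ c, cell K c ∈ D → Road K m good c → c ∈ A)
    (hA₃ : ∀ c ∈ A, Road K m good c ∨ ∀ c', cell K c' = cell K c → c' ∈ A) : IsPreconn A := by
  have hmK : m ≤ K := by rw [hK]; exact Nat.le_mul_of_pos_left m hM
  have hK0 : (0 : ℤ) < K := by exact_mod_cast hm.trans_le hmK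
  have hm' : (0 : ℤ) < m := by exact_mod_cast hm
  have hmK' : (m : ℤ) ≤ K := by exact_mod_cast hmK
  have hM' : (0 : ℤ) < M := by exact_mod_cast hM
  have hKm : ∀ t : ℤ, t * M * m = t * K := fun t => by rw [hK]; push_cast; ring
  have hcell : ∀ c p : ℤ × ℤ, cell K c = p ↔
      (p.1 * K ≤ c.1 ∧ c.1 < (p.1 + 1) * K) ∧ p.2 * K ≤ c.2 ∧ c.2 < (p.2 + 1) * K := by
    intro c p
    rw [← mem_subcells hK0]
    simp [subcells]
  have es : ∀ t : ℤ, (t + 1) * (K : ℤ) = t * K + K := fun t => by ring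
  set gs : ℤ × ℤ → Prop := fun c => good c.swap with hgs
  -- horizontal and vertical roads of the cells of `D`
  have hH : ∀ p ∈ D, ∀ p' ∈ D, p.2 = p'.2 → (p'.1 = p.1 ∨ p'.1 = p.1 + 1) → ∀ c,
      HRoad K m good c → p.1 * M * m ≤ c.1 → c.1 < (p'.1 + 1) * M * m → p.2 * K ≤ c.2 →
      c.2 < p.2 * K + m → c ∈ A := by
    intro p hp p' hp' h2 h1 c hc h3 h4 h5 h6
    rw [hKm] at h3 h4
    have := es p.2
    have := es p.1
    by_cases h7 : c.1 < (p.1 + 1) * K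
    · refine hA₂ c ?_ (Or.inl hc)
      rw [(hcell c p).2 ⟨⟨h3, h7⟩, h5, by omega⟩]
      exact hp
    · refine hA₂ c ?_ (Or.inl hc)
      rcases h1 with h1 | h1
      · rw [h1] at h4; exact absurd h4 h7
      · rw [(hcell c p').2 ⟨⟨by rw [h1]; exact not_lt.1 h7, h4⟩, by rw [← h2]; exact h5,
          by rw [← h2]; omega⟩]
        exact hp'
  have hV : ∀ p ∈ D, ∀ p' ∈ D, p.1 = p'.1 → (p'.2 = p.2 ∨ p'.2 = p.2 + 1) → ∀ c,
      HRoad K m gs c → p.2 * M * m ≤ c.1 → c.1 < (p'.2 + 1) * M * m → p.1 * K ≤ c.2 →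
      c.2 < p.1 * K + m → c ∈ Prod.swap ⁻¹' A := by
    intro p hp p' hp' h2 h1 c hc h3 h4 h5 h6
    rw [hKm] at h3 h4
    have := es p.2
    have := es p.1
    have hr : Road K m good c.swap := Or.inr (by rw [Prod.swap_swap]; exact hc)
    by_cases h7 : c.1 < (p.2 + 1) * K
    · refine hA₂ c.swap ?_ hr
      rw [(hcell c.swap p).2 ⟨⟨h5, by simp only [Prod.fst_swap]; omega⟩, h3, h7⟩]
      exact hp
    · refine hA₂ c.swap ?_ hr
      rcases h1 with h1 | h1
      · rw [h1] at h4; exact absurd h4 h7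
      · rw [(hcell c.swap p').2 ⟨⟨by rw [← h2]; exact h5, by
          rw [← h2]; simp only [Prod.fst_swap]; omega⟩, by rw [h1]; exact not_lt.1 h7, h4⟩]
        exact hp'
  have hlt : ∀ t : ℤ, t * M < (t + 1) * M := fun t => by nlinarith
  have hlt2 : ∀ t : ℤ, t * M < (t + 1 + 1) * M := fun t => by nlinarith
  -- the two anchors of a cell are joined
  have hPQ : ∀ p ∈ D, Linked A (hNode K m good (p.1 * M) p.2)
      (hNode K m gs (p.2 * M) p.1).swap := by
    intro p hp
    have i1 := (linked_hNode hm (hH p hp p hp rfl (Or.inl rfl))).1 (p.1 * M)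
      (p.1 * K + rowSel K m gs (p.2 * M) p.1) le_rfl (hlt _)
    have i2 := (linked_hNode hm (hV p hp p hp rfl (Or.inl rfl))).1 (p.2 * M)
      (p.2 * K + rowSel K m good (p.1 * M) p.2) le_rfl (hlt _)
    have l1 : (rowSel K m gs (p.2 * M) p.1 : ℤ) < m := by exact_mod_cast sel_lt hm
    have l2 : (rowSel K m good (p.1 * M) p.2 : ℤ) < m := by exact_mod_cast sel_lt hm
    have e1 : ∀ t : ℤ, (t * M + 1) * m = t * K + m := fun t => by rw [← hKm]; ring
    rw [hKm, e1] at i1 i2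
    exact (i1 (by omega) (by omega)).symm.trans (i2 (by omega) (by omega)).swap
  have hroad : ∀ p ∈ D, ∀ c, cell K c = p → Road K m good c →
      Linked A c (hNode K m good (p.1 * M) p.2) := by
    intro p hp c hc hr
    obtain ⟨⟨h1, h2⟩, h3, h4⟩ := (hcell c p).1 hc
    rcases hr with hr | hr
    · exact hr.linked_hNode hm hmK (hH p hp p hp rfl (Or.inl rfl)) (by rw [hKm]; exact h1)
        (by rw [hKm]; exact h2) h3 h4 le_rfl (hlt _)
    · have := (hr.linked_hNode hm hmK (hV p hp p hp rfl (Or.inl rfl)) (by rw [hKm]; exact h3)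
        (by rw [hKm]; exact h4) h1 h2 le_rfl (hlt _)).swap
      rw [Prod.swap_swap] at this
      exact this.trans (hPQ p hp).symm
  have hanchor : ∀ c ∈ A, Linked A c (hNode K m good ((cell K c).1 * M) (cell K c).2) := by
    intro c hc
    rcases hA₃ c hc with hr | hall
    · exact hroad _ (hA₁ c hc) c rfl hr
    · set p := cell K c with hp
      obtain ⟨⟨h1, h2⟩, h3, h4⟩ := (hcell c p).1 rfl
      have l1 : (rowSel K m good (p.1 * M) p.2 : ℤ) < m := by exact_mod_cast sel_lt hm
      have l2 : (colSel K m good (p.1 * M) p.2 : ℤ) < m := by exact_mod_cast sel_lt hm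
      have e1 := es p.1
      have e2 := es p.2
      have j1 := linked_row (A := A) (a := p.1 * K) (b := (p.1 + 1) * K) (y := c.2)
        (fun x h5 h6 => hall _ ((hcell _ p).2 ⟨⟨h5, h6⟩, h3, h4⟩)) h1 h2
        (x₂ := p.1 * K + colSel K m good (p.1 * M) p.2) (by omega) (by omega)
      have j2 := linked_col (A := A) (a := p.2 * K) (b := (p.2 + 1) * K)
        (x := p.1 * K + colSel K m good (p.1 * M) p.2)
        (fun y h5 h6 => hall _ ((hcell _ p).2 ⟨⟨by simp only; omega, by simp only; omega⟩, h5, h6⟩))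
        h3 h4 (y₂ := p.2 * K + rowSel K m good (p.1 * M) p.2) (by omega) (by omega)
      rw [hNode, hKm]
      exact j1.trans j2
  have hnbr : ∀ p ∈ D, ∀ p' ∈ D, IsNbr p p' →
      Linked A (hNode K m good (p.1 * M) p.2) (hNode K m good (p'.1 * M) p'.2) := by
    have hh : ∀ p ∈ D, ∀ p' ∈ D, p.2 = p'.2 → p'.1 = p.1 + 1 →
        Linked A (hNode K m good (p.1 * M) p.2) (hNode K m good (p'.1 * M) p'.2) := by
      intro p hp p' hp' h1 h2
      have := (linked_hNode hm (hH p hp p' hp' h1 (Or.inr h2))).2.2.2 (p.1 * M) (p'.1 * M) le_rfl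
        (by rw [h2]; exact hlt2 _) (by rw [h2]; exact (hlt _).le) (hlt _)
      rwa [← h1]
    have hv : ∀ p ∈ D, ∀ p' ∈ D, p.1 = p'.1 → p'.2 = p.2 + 1 →
        Linked A (hNode K m good (p.1 * M) p.2) (hNode K m good (p'.1 * M) p'.2) := by
      intro p hp p' hp' h1 h2
      have := ((linked_hNode hm (hV p hp p' hp' h1 (Or.inr h2))).2.2.2 (p.2 * M) (p'.2 * M) le_rfl
        (by rw [h2]; exact hlt2 _) (by rw [h2]; exact (hlt _).le) (hlt _)).swap
      refine (hPQ p hp).trans (this.trans ?_)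
      rw [h1]
      exact (hPQ p' hp').symm
    intro p hp p' hp' h
    have : (p.2 = p'.2 ∧ p'.1 = p.1 + 1) ∨ (p'.2 = p.2 ∧ p.1 = p'.1 + 1) ∨
        (p.1 = p'.1 ∧ p'.2 = p.2 + 1) ∨ (p'.1 = p.1 ∧ p.2 = p'.2 + 1) := by
      unfold IsNbr at h
      rcases abs_cases (p.1 - p'.1) with h1 | h1 <;> rcases abs_cases (p.2 - p'.2) with h2 | h2 <;>
        omega
    rcases this with h | h | h | h
    · exact hh p hp p' hp' h.1 h.2
    · exact (hh p' hp' p hp h.1 h.2).symm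
    · exact hv p hp p' hp' h.1 h.2
    · exact (hv p' hp' p hp h.1 h.2).symm
  have hchain : ∀ p p', Linked D p p' →
      Linked A (hNode K m good (p.1 * M) p.2) (hNode K m good (p'.1 * M) p'.2) := by
    intro p p' h
    induction h with
    | refl => exact Relation.ReflTransGen.refl
    | tail _ h2 ih => exact ih.trans (hnbr _ h2.1 _ h2.2.1 h2.2.2)
  intro u hu v hv
  exact (hanchor u hu).trans ((hchain _ _ (hD _ (hA₁ u hu) _ (hA₁ v hv))).trans (hanchor v hv).symm)

/-! ### The number of road cells -/

theorem strip_eq {K m : ℕ} (hmK : m ≤ K) {y r r' : ℤ} (h₁ : r * K ≤ y) (h₂ : y < (r + 1) * K)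
    (h₃ : r' * K ≤ y) (h₄ : y < r' * K + m) : r' = r := by
  have hmK' : (m : ℤ) ≤ K := by exact_mod_cast hmK
  have h7 : r' * K < (r + 1) * K := by omega
  have h8 : r * K < (r' + 1) * K := by
    have : (r' + 1) * (K : ℤ) = r' * K + K := by ring
    omega
  have := lt_of_mul_lt_mul_right h7 (by omega)
  have := lt_of_mul_lt_mul_right h8 (by omega)
  omega

-- Every column of the coarse cell meets at most two chosen rows, since a block is the first block
-- of one pair and the second of another (`f₁` and `f₂`). A chosen column has as many cells as its
-- block is wide, so all of them together are indexed by the horizontal position, the offset in the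
-- block serving as the height (`f₃`).
open Classical in
theorem card_hRoad_le {K m M : ℕ} (hm : 0 < m) (hM : 0 < M) (hK : K = M * m)
    (good : ℤ × ℤ → Prop) (p : ℤ × ℤ) :
    ((subcells K p).filter (HRoad K m good)).card ≤ 3 * K := by
  have hm' : (0 : ℤ) < m := by exact_mod_cast hm
  have hmK : m ≤ K := by rw [hK]; exact Nat.le_mul_of_pos_left m hM
  set f₁ : ℕ → ℤ × ℤ := fun j => (p.1 * K + j, p.2 * K + rowSel K m good ((p.1 * K + j) / m) p.2)
  set f₂ : ℕ → ℤ × ℤ := fun j =>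
    (p.1 * K + j, p.2 * K + rowSel K m good ((p.1 * K + j) / m - 1) p.2)
  set f₃ : ℕ → ℤ × ℤ := fun j =>
    ((p.1 * K + j) / m * m + colSel K m good ((p.1 * K + j) / m) p.2,
      p.2 * K + ((p.1 * K + j) - (p.1 * K + j) / m * m))
  have hsub : (subcells K p).filter (HRoad K m good) ⊆
      ((Finset.range K).image f₁ ∪ (Finset.range K).image f₂) ∪ (Finset.range K).image f₃ := by
    rintro ⟨c₁, c₂⟩ hc
    simp only [Finset.mem_filter, subcells, Finset.mem_product, Finset.mem_Ico] at hc
    obtain ⟨⟨⟨h1, h2⟩, h3, h4⟩, hr⟩ := hc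
    simp only [Finset.mem_union, Finset.mem_image, Finset.mem_range]
    have e1 : (p.1 + 1) * (K : ℤ) = p.1 * K + K := by ring
    rcases hr with ⟨t, r, h5, h6, h7⟩ | ⟨t, r, h5, h6, h7⟩ <;> simp only at h5 h6 h7
    · left
      have hlt : (rowSel K m good t r : ℤ) < m := by exact_mod_cast sel_lt hm
      obtain rfl := strip_eq hmK h3 h4 (by omega : r * (K : ℤ) ≤ c₂) (by omega)
      have hj : p.1 * K + ((c₁ - p.1 * K).toNat : ℤ) = c₁ := by omega
      by_cases h8 : c₁ < (t + 1) * m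
      · left
        have ht : c₁ / m = t :=
          (Int.ediv_eq_iff_of_pos hm').2 ⟨h5, by linarith⟩
        refine ⟨(c₁ - p.1 * K).toNat, by omega, ?_⟩
        simp only [f₁, hj, ht, h7]
      · right
        have ht : c₁ / m - 1 = t := by
          have : c₁ / m = t + 1 := (Int.ediv_eq_iff_of_pos hm').2 ⟨not_lt.1 h8, by
            have : (t + 2) * (m : ℤ) = (t + 1) * m + m := by ring
            omega⟩
          omega
        refine ⟨(c₁ - p.1 * K).toNat, by omega, ?_⟩
        simp only [f₂, hj, ht, h7]
    · right
      obtain rfl := strip_eq hmK h3 h4 h6 h7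
      have hlt : (colSel K m good t p.2 : ℤ) < m := by exact_mod_cast sel_lt hm
      have hKm : ∀ a : ℤ, a * K = a * M * m := fun a => by rw [hK]; push_cast; ring
      have e2 : (t + 1) * (m : ℤ) = t * m + m := by ring
      have t1 : p.1 * M ≤ t := by
        have : p.1 * M * (m : ℤ) < (t + 1) * m := by rw [← hKm]; omega
        have := lt_of_mul_lt_mul_right this hm'.le
        omega
      have t2 : t + 1 ≤ (p.1 + 1) * M := by
        have : t * (m : ℤ) < (p.1 + 1) * M * m := by rw [← hKm]; omega
        have := lt_of_mul_lt_mul_right this hm'.le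
        omega
      have t3 := mul_le_mul_of_nonneg_right t1 hm'.le
      have t4 := mul_le_mul_of_nonneg_right t2 hm'.le
      rw [← hKm] at t3 t4
      have hj : p.1 * K + ((t * m + (c₂ - p.2 * K) - p.1 * K).toNat : ℤ) = t * m + (c₂ - p.2 * K) := by
        omega
      have ht : (t * m + (c₂ - p.2 * K)) / m = t :=
        (Int.ediv_eq_iff_of_pos hm').2 ⟨by omega, by omega⟩
      refine ⟨(t * m + (c₂ - p.2 * K) - p.1 * K).toNat, by omega, ?_⟩
      simp only [f₃, hj, ht, Prod.mk.injEq]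
      omega
  refine (Finset.card_le_card hsub).trans ((Finset.card_union_le _ _).trans ?_)
  have h1 := (Finset.card_image_le (s := Finset.range K) (f := f₁)).trans_eq (Finset.card_range K)
  have h2 := (Finset.card_image_le (s := Finset.range K) (f := f₂)).trans_eq (Finset.card_range K)
  have h3 := (Finset.card_image_le (s := Finset.range K) (f := f₃)).trans_eq (Finset.card_range K)
  have h4 := Finset.card_union_le ((Finset.range K).image f₁) ((Finset.range K).image f₂)
  omega

open Classical in
theorem card_road_le {K m M : ℕ} (hm : 0 < m) (hM : 0 < M) (hK : K = M * m)
    (good : ℤ × ℤ → Prop) (p : ℤ × ℤ) :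
    ((subcells K p).filter (Road K m good)).card ≤ 6 * K := by
  have h1 := card_hRoad_le hm hM hK good p
  have h2 := card_hRoad_le hm hM hK (fun c => good c.swap) p.swap
  have h3 : (subcells K p).filter (Road K m good) ⊆ (subcells K p).filter (HRoad K m good) ∪
      ((subcells K p.swap).filter (HRoad K m fun c => good c.swap)).image Prod.swap := by
    intro c hc
    obtain ⟨hc, hr⟩ := Finset.mem_filter.1 hc
    rw [Finset.mem_union, Finset.mem_filter, Finset.mem_image]
    rcases hr with hr | hr
    · exact Or.inl ⟨hc, hr⟩
    · refine Or.inr ⟨c.swap, Finset.mem_filter.2 ⟨?_, hr⟩, Prod.swap_swap c⟩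
      simp only [subcells, Finset.mem_product] at hc ⊢
      exact hc.symm
  have h4 := (Finset.card_le_card h3).trans (Finset.card_union_le _ _)
  have h5 := (Finset.card_image_le (s := (subcells K p.swap).filter
    (HRoad K m fun c => good c.swap)) (f := Prod.swap))
  omega

/-! ### Roads consist of good cells with high probability -/

/-- A bad cell on a road can only come from the default value of a selection, so all `m` candidate
lines have failed. The pair of blocks of a row starts at the block of `c` or at the one before. -/
theorem HRoad.cases_of_not_good {K m : ℕ} (hm : 0 < m) (hmK : m ≤ K) {good : ℤ × ℤ → Prop}
    {c : ℤ × ℤ} (hc : HRoad K m good c) (hg : ¬ good c) :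
    (∀ y < m, ¬ RowGood K m good (c.1 / m) (c.2 / K) y) ∨
      (∀ y < m, ¬ RowGood K m good (c.1 / m - 1) (c.2 / K) y) ∨
      ∀ x < m, ¬ ColGood K m good (c.1 / m) (c.2 / K) x := by
  have hm' : (0 : ℤ) < m := by exact_mod_cast hm
  have hmK' : (m : ℤ) ≤ K := by exact_mod_cast hmK
  have hstrip : ∀ r : ℤ, r * K ≤ c.2 → c.2 < r * K + m → c.2 / K = r := fun r h1 h2 =>
    (Int.ediv_eq_iff_of_pos (by omega)).2 ⟨h1, by omega⟩
  rcases hc with ⟨t, r, h5, h6, h7⟩ | ⟨t, r, h5, h6, h7⟩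
  · have hlt : (rowSel K m good t r : ℤ) < m := by exact_mod_cast sel_lt hm
    rw [hstrip r (by omega) (by omega)]
    have hfail : ∀ y < m, ¬ RowGood K m good t r y := by
      by_contra hcon
      push Not at hcon
      have := sel_spec hcon c.1 h5 h6
      rw [show sel (RowGood K m good t r) m = rowSel K m good t r from rfl, ← h7] at this
      exact hg this
    by_cases h8 : c.1 < (t + 1) * m
    · left
      rwa [(Int.ediv_eq_iff_of_pos hm').2 ⟨h5, by linarith⟩]
    · right; left
      rwa [(Int.ediv_eq_iff_of_pos hm' (y := t + 1)).2 ⟨not_lt.1 h8, by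
            have : (t + 2) * (m : ℤ) = (t + 1) * m + m := by ring
            omega⟩, add_sub_cancel_right]
  · have hlt : (colSel K m good t r : ℤ) < m := by exact_mod_cast sel_lt hm
    rw [hstrip r h6 h7]
    right; right
    rw [(Int.ediv_eq_iff_of_pos hm' (y := t)).2 ⟨by omega, by omega⟩]
    by_contra hcon
    push Not at hcon
    have := sel_spec hcon c.2 h6 h7
    rw [show sel (ColGood K m good t r) m = colSel K m good t r from rfl, ← h5] at this
    exact hg this

theorem measurableSet_const_le_abs {Ω : Type*} {m : MeasurableSpace Ω} {f : Ω → ℝ}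
    (hf : Measurable f) (q : ℝ) : MeasurableSet {ω | q ≤ |f ω|} :=
  measurableSet_le measurable_const hf.abs

theorem measurableSet_highOn {A : Set BoxIdx} {k i : ℕ} {x : ℝ} {c : ℤ × ℤ}
    (h : ∀ z, cell (2 ^ (i * k)) z = c → ∀ a ∈ boxesContaining (i * k) z, (i * k, a) ∈ A) :
    MeasurableSet[coordAlg A] (highOn k i x c) := by
  rw [highOn]
  simp only [Set.ofPred_exists]
  refine MeasurableSet.iUnion fun z => measurableSet_const_and fun hz => ?_
  exact measurableSet_const_le_abs (measurable_coordAlg_lev (h z hz)) x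

/-- The boxes meeting a line of cells have corners on that line or the preceding one, so only every
second line is used. These lines are independent, and on each a union bound over its cells applies.
-/
theorem boxLaw_iInter_lines_le {k : ℕ} (hk : 1 ≤ k) (i : ℕ) {x : ℝ} (hx : 0 < x)
    {pr : ℤ × ℤ → ℤ} (hpr : pr = Prod.fst ∨ pr = Prod.snd) (v : ℤ)
    (L : ℕ → Finset (ℤ × ℤ)) (hL : ∀ y, ∀ c ∈ L y, pr c = v + 2 * y) (N : ℕ)
    (hN : ∀ y, (L y).card ≤ N) (h : ℕ) :
    boxLaw (⋂ y ∈ Finset.range h, ⋃ c ∈ L y, highOn k i x c) ≤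
      (N * (32 * ENNReal.ofReal (Real.exp (-(x ^ 2 / (32 * k)))))) ^ h := by
  set s : ℤ := 2 ^ (i * k) with hs
  have hs0 : 0 < s := by positivity
  set A : ℕ → Set BoxIdx := fun y => {j | (v + 2 * y - 1) * s < pr j.2 ∧ pr j.2 < (v + 2 * y + 1) * s}
    with hA
  rw [boxLaw_biInter_of_disjoint (Finset.range h) A]
  · refine (Finset.prod_le_pow_card _ _ _ fun y _ => ?_).trans (by rw [Finset.card_range])
    refine (measure_biUnion_finset_le _ _).trans ?_
    refine (Finset.sum_le_card_nsmul _ _ _ fun c _ => boxLaw_highOn_le hk i x hx c).trans ?_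
    rw [nsmul_eq_mul]
    gcongr
    exact hN y
  · intro y _
    refine Finset.measurableSet_biUnion _ fun c hc => measurableSet_highOn fun z hz a ha => ?_
    have hcy := hL y c hc
    simp only [boxesContaining, Finset.mem_product, Finset.mem_Ioc] at ha
    have key : ∀ w b e : ℤ, w / s = e → w - s < b → b ≤ w → e = v + 2 * y →
        (v + 2 * y - 1) * s < b ∧ b < (v + 2 * y + 1) * s := by
      intro w b e h1 h2 h3 h4
      have h5 := (Int.ediv_eq_iff_of_pos hs0).1 h1
      rw [← h4]
      constructor <;> nlinarith
    have hz1 : z.1 / s = c.1 := congrArg Prod.fst hz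
    have hz2 : z.2 / s = c.2 := congrArg Prod.snd hz
    rcases hpr with rfl | rfl
    · exact key z.1 a.1 c.1 hz1 ha.1.1 ha.1.2 hcy
    · exact key z.2 a.2 c.2 hz2 ha.2.1 ha.2.2 hcy
  · intro y _ y' _ hne
    rw [Set.disjoint_left]
    rintro j ⟨h1, h2⟩ ⟨h3, h4⟩
    have e1 := lt_of_mul_lt_mul_right (h1.trans h4) hs0.le
    have e2 := lt_of_mul_lt_mul_right (h3.trans h2) hs0.le
    omega

/-- The good cells of the level `i`. -/
def GoodCell (k i : ℕ) (x : ℝ) (ω : BoxCfg) (c : ℤ × ℤ) : Prop := ω ∉ highOn k i x c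

theorem boxLaw_no_good_row_le {k : ℕ} (hk : 1 ≤ k) (i : ℕ) {x : ℝ} (hx : 0 < x) {K m h : ℕ}
    (hh : 2 * h ≤ m) {σ : ℤ × ℤ → ℤ × ℤ} (hσ : σ = id ∨ σ = Prod.swap) (t r : ℤ) :
    boxLaw {ω | ∀ y < m, ¬ RowGood K m (fun c => GoodCell k i x ω (σ c)) t r y} ≤
      ((2 * m : ℕ) * (32 * ENNReal.ofReal (Real.exp (-(x ^ 2 / (32 * k)))))) ^ h := by
  refine le_trans (measure_mono ?_) (boxLaw_iInter_lines_le hk i hx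
    (pr := fun c => (σ c).2) ?_ (r * K)
    (fun y => (Finset.Ico (t * m) ((t + 2) * m)).image fun z => σ (z, r * K + 2 * y)) ?_ (2 * m) ?_ h)
  · intro ω hω
    simp only [Set.mem_iInter, Finset.mem_range, Set.mem_iUnion]
    intro y hy
    have := hω (2 * y) (by omega)
    simp only [RowGood, GoodCell, not_forall, not_not] at this
    obtain ⟨z, h1, h2, h3⟩ := this
    refine ⟨_, Finset.mem_image_of_mem _ (Finset.mem_Ico.2 ⟨h1, h2⟩), ?_⟩
    push_cast at h3
    exact h3
  · rcases hσ with rfl | rfl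
    · right; rfl
    · left; rfl
  · intro y c hc
    obtain ⟨z, _, rfl⟩ := Finset.mem_image.1 hc
    rcases hσ with rfl | rfl <;> rfl
  · intro y
    refine Finset.card_image_le.trans (le_of_eq ?_)
    rw [Int.card_Ico]
    have : (t + 2) * (m : ℤ) - t * m = (2 * m : ℕ) := by push_cast; ring
    rw [this, Int.toNat_natCast]

theorem boxLaw_no_good_col_le {k : ℕ} (hk : 1 ≤ k) (i : ℕ) {x : ℝ} (hx : 0 < x) {K m h : ℕ}
    (hh : 2 * h ≤ m) {σ : ℤ × ℤ → ℤ × ℤ} (hσ : σ = id ∨ σ = Prod.swap) (t r : ℤ) :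
    boxLaw {ω | ∀ y < m, ¬ ColGood K m (fun c => GoodCell k i x ω (σ c)) t r y} ≤
      ((2 * m : ℕ) * (32 * ENNReal.ofReal (Real.exp (-(x ^ 2 / (32 * k)))))) ^ h := by
  refine le_trans (measure_mono ?_) (boxLaw_iInter_lines_le hk i hx
    (pr := fun c => (σ c).1) ?_ (t * m)
    (fun y => (Finset.Ico (r * K) (r * K + m)).image fun z => σ (t * m + 2 * y, z)) ?_ (2 * m) ?_ h)
  · intro ω hω
    simp only [Set.mem_iInter, Finset.mem_range, Set.mem_iUnion]
    intro y hy
    have := hω (2 * y) (by omega)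
    simp only [ColGood, GoodCell, not_forall, not_not] at this
    obtain ⟨z, h1, h2, h3⟩ := this
    refine ⟨_, Finset.mem_image_of_mem _ (Finset.mem_Ico.2 ⟨h1, h2⟩), ?_⟩
    push_cast at h3
    exact h3
  · rcases hσ with rfl | rfl
    · left; rfl
    · right; rfl
  · intro y c hc
    obtain ⟨z, _, rfl⟩ := Finset.mem_image.1 hc
    rcases hσ with rfl | rfl <;> rfl
  · intro y
    refine Finset.card_image_le.trans ?_
    rw [Int.card_Ico, add_sub_cancel_left, Int.toNat_natCast]
    omega

/-- Six selections can be to blame: two rows and one column in each of the two orientations. -/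
theorem boxLaw_road_highOn_le {k : ℕ} (hk : 1 ≤ k) (i : ℕ) {x : ℝ} (hx : 0 < x) {K m h : ℕ}
    (hm : 0 < m) (hmK : m ≤ K) (hh : 2 * h ≤ m) (c : ℤ × ℤ) :
    boxLaw {ω | Road K m (GoodCell k i x ω) c ∧ ω ∈ highOn k i x c} ≤
      6 * ((2 * m : ℕ) * (32 * ENNReal.ofReal (Real.exp (-(x ^ 2 / (32 * k)))))) ^ h := by
  set Q := ((2 * m : ℕ) * (32 * ENNReal.ofReal (Real.exp (-(x ^ 2 / (32 * k)))))) ^ h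
  have hH : ∀ σ : ℤ × ℤ → ℤ × ℤ, (σ = id ∨ σ = Prod.swap) → ∀ d : ℤ × ℤ,
      boxLaw {ω | HRoad K m (fun c => GoodCell k i x ω (σ c)) d ∧ ω ∈ highOn k i x (σ d)} ≤
        Q + (Q + Q) := by
    intro σ hσ d
    refine le_trans (measure_mono (t :=
      {ω | ∀ y < m, ¬ RowGood K m (fun c => GoodCell k i x ω (σ c)) (d.1 / m) (d.2 / K) y} ∪
      ({ω | ∀ y < m, ¬ RowGood K m (fun c => GoodCell k i x ω (σ c)) (d.1 / m - 1) (d.2 / K) y} ∪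
      {ω | ∀ y < m, ¬ ColGood K m (fun c => GoodCell k i x ω (σ c)) (d.1 / m) (d.2 / K) y})) ?_) ?_
    · rintro ω ⟨h1, h2⟩
      exact h1.cases_of_not_good hm hmK (not_not.2 h2)
    · exact (measure_union_le _ _).trans (add_le_add (boxLaw_no_good_row_le hk i hx hh hσ _ _)
        ((measure_union_le _ _).trans (add_le_add (boxLaw_no_good_row_le hk i hx hh hσ _ _)
          (boxLaw_no_good_col_le hk i hx hh hσ _ _))))
  have hsub : {ω | Road K m (GoodCell k i x ω) c ∧ ω ∈ highOn k i x c} ⊆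
      {ω | HRoad K m (fun c => GoodCell k i x ω (id c)) c ∧ ω ∈ highOn k i x (id c)} ∪
      {ω | HRoad K m (fun c => GoodCell k i x ω (Prod.swap c)) c.swap ∧
        ω ∈ highOn k i x (Prod.swap c.swap)} := by
    rintro ω ⟨h1 | h1, h2⟩
    · exact Or.inl ⟨h1, h2⟩
    · exact Or.inr ⟨h1, by rw [Prod.swap_swap]; exact h2⟩
  refine (measure_mono hsub).trans ((measure_union_le _ _).trans
    ((add_le_add (hH _ (Or.inl rfl) c) (hH _ (Or.inr rfl) c.swap)).trans (le_of_eq ?_)))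
  ring

/-! ### Measurability of the roads -/

theorem measurable_sel {Ω : Type*} {mΩ : MeasurableSpace Ω} {p : Ω → ℕ → Prop}
    (hp : ∀ y, MeasurableSet {ω | p ω y}) (m : ℕ) : Measurable fun ω => sel (p ω) m := by
  refine measurable_to_countable' fun y => ?_
  have : (fun ω => sel (p ω) m) ⁻¹' {y} =
      {ω | y < m ∧ p ω y ∧ ∀ y' < y, ¬ p ω y'} ∪ {ω | y = 0 ∧ ∀ y' < m, ¬ p ω y'} := by
    ext ω
    exact sel_eq_iff
  rw [this]
  have hn : ∀ n, MeasurableSet {ω | ∀ y' < n, ¬ p ω y'} := fun n => by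
    have : {ω | ∀ y' < n, ¬ p ω y'} = ⋂ y' ∈ Finset.range n, {ω | p ω y'}ᶜ := by
      ext ω; simp
    rw [this]
    exact Finset.measurableSet_biInter _ fun y' _ => (hp y').compl
  exact (measurableSet_const_and fun _ => (hp y).inter (hn y)).union
    (measurableSet_const_and fun _ => hn m)

theorem measurableSet_hRoad {Ω : Type*} {mΩ : MeasurableSpace Ω} {good : Ω → ℤ × ℤ → Prop}
    (hg : ∀ c, MeasurableSet {ω | good ω c}) (K m : ℕ) (c : ℤ × ℤ) :
    MeasurableSet {ω | HRoad K m (good ω) c} := by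
  have hrow : ∀ t r y, MeasurableSet {ω | RowGood K m (good ω) t r y} := fun t r y => by
    simp only [RowGood, Set.ofPred_forall]
    exact MeasurableSet.iInter fun x => MeasurableSet.iInter fun _ => MeasurableSet.iInter fun _ =>
      hg _
  have hcol : ∀ t r y, MeasurableSet {ω | ColGood K m (good ω) t r y} := fun t r y => by
    simp only [ColGood, Set.ofPred_forall]
    exact MeasurableSet.iInter fun x => MeasurableSet.iInter fun _ => MeasurableSet.iInter fun _ =>
      hg _
  simp only [HRoad, Set.ofPred_or, Set.ofPred_exists]
  refine MeasurableSet.union ?_ ?_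
  · refine MeasurableSet.iUnion fun t => MeasurableSet.iUnion fun r =>
      measurableSet_const_and fun _ => measurableSet_const_and fun _ => ?_
    exact measurable_sel (hrow t r) m (MeasurableSet.of_discrete (s := {y : ℕ | c.2 = r * K + y}))
  · refine MeasurableSet.iUnion fun t => MeasurableSet.iUnion fun r => ?_
    have : {ω | c.1 = t * m + colSel K m (good ω) t r ∧ r * K ≤ c.2 ∧ c.2 < r * K + m} =
        {ω | (r * K ≤ c.2 ∧ c.2 < r * K + m) ∧ c.1 = t * m + colSel K m (good ω) t r} := by
      ext ω; exact and_comm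
    rw [this]
    refine measurableSet_const_and fun _ => ?_
    exact measurable_sel (hcol t r) m (MeasurableSet.of_discrete (s := {y : ℕ | c.1 = t * m + y}))

/-- The boxes of a given side length. -/
def levelIdx (l : ℕ) : Set BoxIdx := {j | j.1 = l}

theorem measurableSet_highOn_levelIdx (k i : ℕ) (x : ℝ) (c : ℤ × ℤ) :
    MeasurableSet[coordAlg (levelIdx (i * k))] (highOn k i x c) :=
  measurableSet_highOn fun _ _ _ _ => rfl

/-- The roads of a level are built from that level alone. This makes the expected weight of the
network factorise. -/
theorem measurableSet_road (k i : ℕ) (x : ℝ) (K m : ℕ) (c : ℤ × ℤ) :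
    MeasurableSet[coordAlg (levelIdx (i * k))] {ω | Road K m (GoodCell k i x ω) c} := by
  simp only [Road, Set.ofPred_or]
  exact MeasurableSet.union
    (measurableSet_hRoad (fun c => (measurableSet_highOn_levelIdx k i x c).compl) K m c)
    (measurableSet_hRoad (fun c => (measurableSet_highOn_levelIdx k i x c.swap).compl) K m c.swap)

/-! ### The network of roads of all levels -/

/-- The points of the box `{0, …, 2 ^ n - 1}²` that at each level lie in a cell of the roads, or
in a cell of which the parent is one of the cells in `F`. -/
def netSet (k n m : ℕ) (x : ℝ) (F : ℕ → Set (ℤ × ℤ)) (ω : BoxCfg) : Set (ℤ × ℤ) :=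
  {w | w ∈ subcells (2 ^ n) (0, 0) ∧ ∀ i < n / k, cell (2 ^ ((i + 1) * k)) w ∈ F (i + 1) ∨
    Road (2 ^ k) m (GoodCell k i x ω) (cell (2 ^ (i * k)) w)}

theorem mem_box_iff (k n : ℕ) (w : ℤ × ℤ) :
    w ∈ subcells (2 ^ n) (0, 0) ↔
      cell (2 ^ (n / k * k)) w ∈ subcells (2 ^ (n - n / k * k)) (0, 0) := by
  rw [mem_subcells (by positivity), mem_subcells (by positivity), cell_cell (by positivity),
    ← pow_add, Nat.add_sub_cancel' (Nat.div_mul_le_self n k)]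

theorem cell_pow_cell_pow {k i j : ℕ} (h : i ≤ j) (w : ℤ × ℤ) :
    cell (2 ^ (j * k)) w = cell (2 ^ ((j - i) * k)) (cell (2 ^ (i * k)) w) := by
  rw [cell_cell (by positivity), ← pow_add, ← add_mul, Nat.add_sub_cancel' h]

theorem cell_eq_of_le {k i j : ℕ} (h : i ≤ j) {w w' : ℤ × ℤ}
    (he : cell (2 ^ (i * k)) w = cell (2 ^ (i * k)) w') :
    cell (2 ^ (j * k)) w = cell (2 ^ (j * k)) w' := by
  rw [cell_pow_cell_pow h, he, ← cell_pow_cell_pow h]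

/-- The cells of the level `j` that have points that meet the conditions of the network at the
levels from `j` on. -/
def netLevel (k n m : ℕ) (x : ℝ) (F : ℕ → Set (ℤ × ℤ)) (ω : BoxCfg) (j : ℕ) : Set (ℤ × ℤ) :=
  {c | ∃ w, cell (2 ^ (j * k)) w = c ∧ w ∈ subcells (2 ^ n) (0, 0) ∧
    ∀ i, j ≤ i → i < n / k → cell (2 ^ ((i + 1) * k)) w ∈ F (i + 1) ∨
      Road (2 ^ k) m (GoodCell k i x ω) (cell (2 ^ (i * k)) w)}

theorem isPreconn_subcells (R : ℤ) : IsPreconn (subcells R (0, 0) : Set (ℤ × ℤ)) := by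
  rintro ⟨u1, u2⟩ hu ⟨v1, v2⟩ hv
  simp only [subcells, Finset.coe_product, Set.mem_prod, Finset.mem_coe, Finset.mem_Ico, zero_mul,
    zero_add, one_mul] at hu hv
  have h1 := linked_row (A := (subcells R (0, 0) : Set (ℤ × ℤ))) (a := 0) (b := R) (y := u2)
    (fun z h1 h2 => by simp [subcells]; omega) hu.1.1 hu.1.2 hv.1.1 hv.1.2
  have h2 := linked_col (A := (subcells R (0, 0) : Set (ℤ × ℤ))) (a := 0) (b := R) (x := v1)
    (fun z h1 h2 => by simp [subcells]; omega) hu.2.1 hu.2.2 hv.2.1 hv.2.2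
  exact h1.trans h2

theorem cell_two_pow_mul (l : ℕ) (c : ℤ × ℤ) : cell (2 ^ l) (c.1 * 2 ^ l, c.2 * 2 ^ l) = c := by
  have : (2 : ℤ) ^ l ≠ 0 := by positivity
  simp [cell, Int.mul_ediv_cancel _ this]

/-- Induction from the coarsest scale down. At the top all cells of the box are present and form a
square; each finer scale is one application of `isPreconn_of_road`. -/
theorem isPreconn_netSet {k n m M : ℕ} (hm : 0 < m) (hM : 0 < M) (hK : 2 ^ k = M * m) (x : ℝ)
    (F : ℕ → Set (ℤ × ℤ)) (ω : BoxCfg) : IsPreconn (netSet k n m x F ω) := by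
  have hstep : ∀ j < n / k, ∀ c, cell (2 ^ k) c ∈ netLevel k n m x F ω (j + 1) →
      (cell (2 ^ k) c ∈ F (j + 1) ∨ Road (2 ^ k) m (GoodCell k j x ω) c) →
      c ∈ netLevel k n m x F ω j := by
    rintro j hj c ⟨w, hw, hw1, hw2⟩ hc
    -- The corner of the cell `c` serves as witness. The conditions at levels above `j` depend only
    -- on the parent of `c`, so they carry over from `w`.
    set w' : ℤ × ℤ := (c.1 * 2 ^ (j * k), c.2 * 2 ^ (j * k)) with hw'
    have h1 : cell (2 ^ (j * k)) w' = c := cell_two_pow_mul _ c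
    have h2 : cell (2 ^ ((j + 1) * k)) w' = cell (2 ^ k) c := by
      rw [cell_pow_cell_pow (Nat.le_succ j), h1]
      simp
    refine ⟨w', h1, ?_, fun i hi hiJ => ?_⟩
    · rw [mem_box_iff k, cell_eq_of_le (Nat.succ_le_of_lt hj) (h2.trans hw.symm), ← mem_box_iff]
      exact hw1
    · rcases hi.eq_or_lt with rfl | hi
      · rwa [h1, h2]
      · have := hw2 i hi hiJ
        rwa [cell_eq_of_le (Nat.succ_le_of_lt hi) (h2.trans hw.symm),
          cell_eq_of_le (hi.trans (Nat.lt_succ_self i)) (h2.trans hw.symm)]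
  have hlev : ∀ t ≤ n / k, IsPreconn (netLevel k n m x F ω (n / k - t)) := by
    intro t
    induction t with
    | zero =>
      intro _
      have : netLevel k n m x F ω (n / k - 0) =
          (subcells (2 ^ (n - n / k * k)) (0, 0) : Set (ℤ × ℤ)) := by
        ext c
        rw [Nat.sub_zero]
        constructor
        · rintro ⟨w, rfl, hw, -⟩
          exact (mem_box_iff k n w).1 hw
        · intro hc
          refine ⟨(c.1 * 2 ^ (n / k * k), c.2 * 2 ^ (n / k * k)), cell_two_pow_mul _ c, ?_,
            fun i h1 h2 => absurd h1 (not_le.2 h2)⟩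
          rw [mem_box_iff k, cell_two_pow_mul]
          exact hc
      rw [this]
      exact isPreconn_subcells _
    | succ t ih =>
      intro ht
      have hj : n / k - t = n / k - (t + 1) + 1 := by omega
      have ih := ih (by omega)
      rw [hj] at ih
      set j := n / k - (t + 1) with hjdef
      have hjJ : j < n / k := by omega
      have hcell : ∀ w, cell (2 ^ k) (cell (2 ^ (j * k)) w) = cell (2 ^ ((j + 1) * k)) w := by
        intro w
        rw [cell_pow_cell_pow (Nat.le_succ j)]
        simp
      have hpar : ∀ c ∈ netLevel k n m x F ω j, cell (2 ^ k) c ∈ netLevel k n m x F ω (j + 1) := by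
        rintro c ⟨w, rfl, hw1, hw2⟩
        exact ⟨w, (hcell w).symm, hw1, fun i hi => hw2 i (by omega)⟩
      refine isPreconn_of_road (K := 2 ^ k) (good := GoodCell k j x ω) hm hM hK ih ?_ ?_ ?_
      · intro c hc
        push_cast
        exact hpar c hc
      · intro c hc hr
        push_cast at hc
        exact hstep j hjJ c hc (Or.inr hr)
      · intro c hc
        obtain ⟨w, rfl, hw1, hw2⟩ := id hc
        rcases hw2 j le_rfl hjJ with h | h
        · right
          intro c' hc'
          push_cast at hc'
          have := hpar _ hc
          rw [← hc'] at this
          exact hstep j hjJ c' this (Or.inl (by rw [hc', hcell]; exact h))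
        · exact Or.inl h
  have h0 : netLevel k n m x F ω (n / k - n / k) = netSet k n m x F ω := by
    rw [Nat.sub_self]
    have hc : ∀ w, cell (2 ^ (0 * k)) w = w := fun w => by simp [cell]
    ext c
    constructor
    · rintro ⟨w, hw, hw1, hw2⟩
      rw [hc] at hw
      subst hw
      exact ⟨hw1, fun i hi => hw2 i (Nat.zero_le _) hi⟩
    · rintro ⟨h1, h2⟩
      exact ⟨c, hc c, h1, fun i _ hi => h2 i hi⟩
  rw [← h0]
  exact hlev _ le_rfl

/-- The network of a point: the cells of which the parent contains the point belong to it. -/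
def pointNet (k n m : ℕ) (x : ℝ) (u : ℤ × ℤ) (ω : BoxCfg) : Set (ℤ × ℤ) :=
  netSet k n m x (fun i => {cell (2 ^ (i * k)) u}) ω

/-- Cells are nested. If `w` used a cell of `v` at one scale and a cell of `u` at another, the
coarser of the two scales would also serve the other point. This reduces the weight for a pair to
weights of single points. -/
theorem netSet_pair_subset (k n m : ℕ) (x : ℝ) (u v : ℤ × ℤ) (ω : BoxCfg) :
    netSet k n m x (fun i => {cell (2 ^ (i * k)) u, cell (2 ^ (i * k)) v}) ω ⊆
      pointNet k n m x u ω ∪ pointNet k n m x v ω := by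
  rintro w ⟨h1, h2⟩
  by_contra hcon
  simp only [Set.mem_union, not_or, pointNet, netSet, Set.mem_ofPred_eq, h1, true_and, not_forall,
    Set.mem_singleton_iff] at hcon
  obtain ⟨⟨i, hi, h3, h4⟩, i', hi', h5, h6⟩ := hcon
  have e1 : cell (2 ^ ((i + 1) * k)) w = cell (2 ^ ((i + 1) * k)) v := by
    rcases h2 i hi with (h | h) | h
    · exact absurd h h3
    · exact h
    · exact absurd h h4
  have e2 : cell (2 ^ ((i' + 1) * k)) w = cell (2 ^ ((i' + 1) * k)) u := by
    rcases h2 i' hi' with (h | h) | h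
    · exact h
    · exact absurd h h5
    · exact absurd h h6
  rcases le_total i i' with h | h
  · exact h5 (cell_eq_of_le (by omega) e1)
  · exact h3 (cell_eq_of_le (by omega) e2)

/-! ### The distance is at most the weight of the networks -/

/-- A vertex of the box as a point of `ℤ²`. -/
def toPt {N : ℕ} (z : LatticeBox N) : ℤ × ℤ := (((z.1 : ℕ) : ℤ), ((z.2 : ℕ) : ℤ))

theorem toPt_injective {N : ℕ} : Function.Injective (toPt (N := N)) := by
  intro u v h
  simp only [toPt, Prod.mk.injEq, Nat.cast_inj] at h
  exact Prod.ext (Fin.ext h.1) (Fin.ext h.2)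

theorem toPt_mem {n : ℕ} (z : LatticeBox (2 ^ n)) : toPt z ∈ subcells (2 ^ n) (0, 0) := by
  have h1 := z.1.2
  have h2 := z.2.2
  zify at h1 h2
  simp only [subcells, toPt, Finset.mem_product, Finset.mem_Ico, zero_mul, zero_add, one_mul]
  omega

theorem exists_toPt_eq {n : ℕ} {w : ℤ × ℤ} (hw : w ∈ subcells (2 ^ n) (0, 0)) :
    ∃ z : LatticeBox (2 ^ n), toPt z = w := by
  simp only [subcells, Finset.mem_product, Finset.mem_Ico, zero_mul, zero_add, one_mul] at hw
  refine ⟨(⟨w.1.toNat, by zify; omega⟩, ⟨w.2.toNat, by zify; omega⟩), ?_⟩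
  simp only [toPt, Prod.ext_iff]
  omega

theorem coarseMBRW_eq (k n : ℕ) (ω : BoxCfg) (z : LatticeBox (2 ^ n)) :
    coarseMBRW k n ω z = fieldBelow k (n / k) (toPt z) ω := by
  simp only [coarseMBRW, fieldBelow, lev_eq, toPt]

theorem exists_walk_of_linked {N : ℕ} {A : Set (ℤ × ℤ)} (hA : ∀ w ∈ A, ∃ z : LatticeBox N, toPt z = w)
    {u : LatticeBox N} (hu : toPt u ∈ A) {y : ℤ × ℤ} (h : Linked A (toPt u) y) :
    ∀ v : LatticeBox N, toPt v = y →
      ∃ p : (latticeGraph N).Walk u v, ∀ w ∈ p.support, toPt w ∈ A := by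
  induction h with
  | refl =>
    intro v hv
    obtain rfl := toPt_injective hv
    exact ⟨SimpleGraph.Walk.nil, by simpa using hu⟩
  | tail _ hbc ih =>
    intro v hv
    obtain ⟨b', hb'⟩ := hA _ hbc.1
    obtain ⟨p, hp⟩ := ih b' hb'
    have hadj : (latticeGraph N).Adj b' v := by
      have := hbc.2.2
      rw [← hb', ← hv] at this
      exact this
    refine ⟨p.concat hadj, fun w hw => ?_⟩
    rw [SimpleGraph.Walk.support_concat, List.mem_append] at hw
    rcases hw with hw | hw
    · exact hp w hw
    · rw [List.mem_singleton.1 hw, hv]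
      exact hbc.2.1

open Classical in
/-- The weight of the network of a point. -/
noncomputable def netWeight (γ : ℝ) (k n m : ℕ) (x : ℝ) (u : ℤ × ℤ) (ω : BoxCfg) : ℝ :=
  ∑ w ∈ subcells (2 ^ n) (0, 0), if w ∈ pointNet k n m x u ω then
    Real.exp (γ * fieldBelow k (n / k) w ω) else 0

/-- A self-avoiding path inside the network counts each vertex once, so it costs at most the weight
of the network. Existence of a path is recorded too: the infimum over an empty family would be zero
and would ruin the lower bound. -/
theorem nonempty_path_and_fppDist_le {k n m M : ℕ} (hm : 0 < m) (hM : 0 < M) (hK : 2 ^ k = M * m)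
    (γ x : ℝ) (ω : BoxCfg) (u v : LatticeBox (2 ^ n)) :
    Nonempty ((latticeGraph (2 ^ n)).Path u v) ∧ fppDist γ (coarseMBRW k n ω) u v ≤
      netWeight γ k n m x (toPt u) ω + netWeight γ k n m x (toPt v) ω := by
  classical
  set F : ℕ → Set (ℤ × ℤ) := fun i => {cell (2 ^ (i * k)) (toPt u), cell (2 ^ (i * k)) (toPt v)}
  set A := netSet k n m x F ω
  have hu : toPt u ∈ A := ⟨toPt_mem u, fun i _ => Or.inl (Or.inl rfl)⟩
  have hv : toPt v ∈ A := ⟨toPt_mem v, fun i _ => Or.inl (Or.inr rfl)⟩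
  obtain ⟨p, hp⟩ := exists_walk_of_linked (fun w hw => exists_toPt_eq hw.1) hu
    (isPreconn_netSet hm hM hK x F ω _ hu _ hv) v rfl
  refine ⟨⟨p.toPath⟩, (ciInf_le ⟨0, ?_⟩ p.toPath).trans ?_⟩
  · rintro _ ⟨q, rfl⟩
    refine List.sum_nonneg fun y hy => ?_
    obtain ⟨w, _, rfl⟩ := List.mem_map.1 hy
    exact (Real.exp_pos _).le
  set φ : ℤ × ℤ → ℝ := fun w => Real.exp (γ * fieldBelow k (n / k) w ω)
  have hφ : ∀ w, 0 ≤ φ w := fun w => (Real.exp_pos _).le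
  set l := ((p.toPath : (latticeGraph (2 ^ n)).Walk u v).support) with hl
  have hnd : l.Nodup := p.toPath.2.support_nodup
  have hlA : ∀ w ∈ l, toPt w ∈ A := fun w hw =>
    hp w (SimpleGraph.Walk.support_toPath_subset_support p hw)
  calc (l.map fun w => Real.exp (γ * coarseMBRW k n ω w)).sum
      = ∑ w ∈ l.toFinset, φ (toPt w) := by
        rw [← List.sum_toFinset _ hnd]
        simp only [coarseMBRW_eq, φ]
    _ = ∑ w ∈ l.toFinset.image toPt, φ w := by
        rw [Finset.sum_image fun a _ b _ h => toPt_injective h]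
    _ ≤ ∑ w ∈ subcells (2 ^ n) (0, 0), if w ∈ A then φ w else 0 := by
        rw [← Finset.sum_filter]
        refine Finset.sum_le_sum_of_subset_of_nonneg (fun w hw => ?_) fun w _ _ => hφ w
        obtain ⟨z, hz, rfl⟩ := Finset.mem_image.1 hw
        exact Finset.mem_filter.2 ⟨toPt_mem z, hlA z (List.mem_toFinset.1 hz)⟩
    _ ≤ _ := by
        rw [netWeight, netWeight, ← Finset.sum_add_distrib]
        refine Finset.sum_le_sum fun w _ => ?_
        have := hφ w
        by_cases hw : w ∈ A
        · rcases netSet_pair_subset k n m x _ _ ω hw with h | h <;> simp only [hw, h, if_true] <;>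
            split_ifs <;> simp only [φ] at * <;> linarith
        · simp only [hw, if_false]
          split_ifs <;> simp only [φ] at * <;> linarith

/-! ### The expected weight of the network of a point -/

theorem sum_subcells_mul {s K : ℤ} (hs : 0 < s) (hK : 0 < K) (c : ℤ × ℤ) (F : ℤ × ℤ → ENNReal) :
    ∑ w ∈ subcells (s * K) c, F w = ∑ c' ∈ subcells K c, ∑ w ∈ subcells s c', F w := by
  have hmaps : ∀ w ∈ subcells (s * K) c, cell s w ∈ subcells K c := fun w hw => by
    rw [mem_subcells (mul_pos hs hK)] at hw
    rw [mem_subcells hK, cell_cell hs.le, hw]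
  rw [← Finset.sum_fiberwise_of_maps_to hmaps]
  refine Finset.sum_congr rfl fun c' hc' => Finset.sum_congr ?_ fun _ _ => rfl
  ext w
  rw [Finset.mem_filter, mem_subcells (mul_pos hs hK), mem_subcells hs]
  rw [mem_subcells hK] at hc'
  refine ⟨fun h => h.2, fun h => ⟨?_, h⟩⟩
  rw [← cell_cell hs.le, h, hc']

theorem subcells_one (c : ℤ × ℤ) : subcells 1 c = {c} := by
  ext w
  rw [mem_subcells one_pos]
  simp [cell]

/-! ### Deterministic recursion for sums of products over the tree of cells. -/

section Recursion

variable {k : ℕ} {u : ℤ × ℤ} {g h : ℕ → ℤ × ℤ → ENNReal} {L : ENNReal}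

/-- Away from the cells containing `u` the factor of each level is controlled by a function of the
cell of that level alone. Summation over one generation of subcells then costs one factor `L`. -/
theorem sum_prod_le_of_ne
    (hgh : ∀ i w, cell (2 ^ ((i + 1) * k)) w ≠ cell (2 ^ ((i + 1) * k)) u →
      g i w ≤ h i (cell (2 ^ (i * k)) w))
    (hh : ∀ i p, ∑ c ∈ subcells (2 ^ k) p, h i c ≤ L) (j : ℕ) :
    ∀ c, c ≠ cell (2 ^ (j * k)) u →
      ∑ w ∈ subcells (2 ^ (j * k)) c, ∏ i ∈ Finset.range j, g i w ≤ L ^ j := by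
  induction j with
  | zero => intro c _; simp [subcells_one]
  | succ j ih =>
    intro c hc
    have hpar : ∀ w, cell (2 ^ k) (cell (2 ^ (j * k)) w) = cell (2 ^ ((j + 1) * k)) w := fun w => by
      rw [cell_pow_cell_pow (Nat.le_succ j)]
      simp
    rw [Nat.succ_mul, pow_add, sum_subcells_mul (by positivity) (by positivity)]
    calc ∑ c' ∈ subcells (2 ^ k) c, ∑ w ∈ subcells (2 ^ (j * k)) c', ∏ i ∈ Finset.range (j + 1), g i w
        ≤ ∑ c' ∈ subcells (2 ^ k) c, L ^ j * h j c' := by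
          refine Finset.sum_le_sum fun c' hc' => ?_
          rw [mem_subcells (by positivity)] at hc'
          have hne : c' ≠ cell (2 ^ (j * k)) u := by
            rintro rfl
            exact hc (by rw [← hc', hpar])
          refine le_trans ?_ (mul_le_mul_left (ih c' hne) _)
          rw [Finset.sum_mul]
          refine Finset.sum_le_sum fun w hw => ?_
          rw [mem_subcells (by positivity)] at hw
          rw [Finset.prod_range_succ]
          refine mul_le_mul_right ?_ _
          rw [← hw]
          exact hgh j w (by rw [← hpar, hw, hc']; exact hc)
      _ = L ^ j * ∑ c' ∈ subcells (2 ^ k) c, h j c' := by rw [Finset.mul_sum]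
      _ ≤ L ^ (j + 1) := by
          rw [pow_succ]
          exact mul_le_mul_right (hh j c) _

/-- Only one of the `K ^ 2` subcells contains `u`. The others fall under the previous bound, so each
scale adds `K ^ 2` to the prefactor, which stays linear in the number of scales. -/
theorem sum_prod_le_of_eq (hg : ∀ i w, g i w ≤ L)
    (hgh : ∀ i w, cell (2 ^ ((i + 1) * k)) w ≠ cell (2 ^ ((i + 1) * k)) u →
      g i w ≤ h i (cell (2 ^ (i * k)) w))
    (hh : ∀ i p, ∑ c ∈ subcells (2 ^ k) p, h i c ≤ L) (j : ℕ) :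
    ∑ w ∈ subcells (2 ^ (j * k)) (cell (2 ^ (j * k)) u), ∏ i ∈ Finset.range j, g i w ≤
      (1 + j * (2 ^ k * 2 ^ k)) * L ^ j := by
  induction j with
  | zero => simp [subcells_one]
  | succ j ih =>
    set N := subcells (2 ^ k) (cell (2 ^ ((j + 1) * k)) u)
    have hN : (N.card : ENNReal) = 2 ^ k * 2 ^ k := by
      have := card_subcells (2 ^ k) (cell (2 ^ ((j + 1) * k)) u)
      push_cast at this
      rw [this]
      push_cast
      rfl
    have hL : (2 : ℤ) ^ ((j + 1) * k) = 2 ^ (j * k) * 2 ^ k := by rw [Nat.succ_mul, pow_add]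
    conv_lhs => rw [hL]
    rw [sum_subcells_mul (by positivity) (by positivity), ← hL]
    calc ∑ c' ∈ N, ∑ w ∈ subcells (2 ^ (j * k)) c', ∏ i ∈ Finset.range (j + 1), g i w
        ≤ ∑ c' ∈ N, (L ^ (j + 1) +
            if c' = cell (2 ^ (j * k)) u then (1 + j * (2 ^ k * 2 ^ k)) * L ^ (j + 1) else 0) := by
          refine Finset.sum_le_sum fun c' hc' => ?_
          have h1 : ∑ w ∈ subcells (2 ^ (j * k)) c', ∏ i ∈ Finset.range (j + 1), g i w ≤
              (∑ w ∈ subcells (2 ^ (j * k)) c', ∏ i ∈ Finset.range j, g i w) * L := by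
            rw [Finset.sum_mul]
            refine Finset.sum_le_sum fun w _ => ?_
            rw [Finset.prod_range_succ]
            exact mul_le_mul_right (hg j w) _
          refine h1.trans ?_
          split_ifs with h2
          · rw [h2, pow_succ, ← mul_assoc]
            exact (mul_le_mul_left ih L).trans le_add_self
          · rw [add_zero, pow_succ]
            exact mul_le_mul_left (sum_prod_le_of_ne hgh hh j c' h2) L
      _ ≤ N.card * L ^ (j + 1) + (1 + j * (2 ^ k * 2 ^ k)) * L ^ (j + 1) := by
          rw [Finset.sum_add_distrib, Finset.sum_const, nsmul_eq_mul, Finset.sum_ite_eq']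
          gcongr
          split_ifs
          · exact le_rfl
          · exact zero_le
      _ = _ := by
          rw [hN]
          push_cast
          ring

theorem sum_box_prod_le (hk : 1 ≤ k) (hg : ∀ i w, g i w ≤ L)
    (hgh : ∀ i w, cell (2 ^ ((i + 1) * k)) w ≠ cell (2 ^ ((i + 1) * k)) u →
      g i w ≤ h i (cell (2 ^ (i * k)) w))
    (hh : ∀ i p, ∑ c ∈ subcells (2 ^ k) p, h i c ≤ L) (n : ℕ) :
    ∑ w ∈ subcells (2 ^ n) (0, 0), ∏ i ∈ Finset.range (n / k), g i w ≤
      2 ^ k * 2 ^ k * ((1 + (n / k : ℕ) * (2 ^ k * 2 ^ k)) * L ^ (n / k)) := by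
  set J := n / k
  have hn : (2 : ℤ) ^ n = 2 ^ (J * k) * 2 ^ (n - J * k) := by
    rw [← pow_add, Nat.add_sub_cancel' (Nat.div_mul_le_self n k)]
  rw [hn, sum_subcells_mul (by positivity) (by positivity)]
  refine (Finset.sum_le_card_nsmul _ _ ((1 + J * (2 ^ k * 2 ^ k)) * L ^ J) fun c _ => ?_).trans ?_
  · by_cases hc : c = cell (2 ^ (J * k)) u
    · rw [hc]
      exact sum_prod_le_of_eq hg hgh hh J
    · refine (sum_prod_le_of_ne hgh hh J c hc).trans ?_
      rw [add_mul, one_mul]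
      exact le_self_add
  · rw [nsmul_eq_mul]
    refine mul_le_mul_left ?_ _
    have h1 := card_subcells (2 ^ (n - J * k)) (0, 0)
    push_cast at h1
    rw [h1]
    push_cast
    have h2 : n - J * k ≤ k := by
      have h3 := Nat.mod_lt n (show 0 < k by omega)
      rw [mul_comm J k, ← Nat.mod_eq_sub]
      exact h3.le
    gcongr <;> norm_num

end Recursion

/-- The condition at the level `i` for the network of `u` to contain `w`. -/
def NetCond (k m : ℕ) (x : ℝ) (u : ℤ × ℤ) (i : ℕ) (w : ℤ × ℤ) (ω : BoxCfg) : Prop :=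
  cell (2 ^ ((i + 1) * k)) w = cell (2 ^ ((i + 1) * k)) u ∨
    Road (2 ^ k) m (GoodCell k i x ω) (cell (2 ^ (i * k)) w)

open Classical in
/-- The contribution of the level `i` to `exp (γ * φ u)` times the term of `w` in the weight of the
network of `u`. -/
noncomputable def netFactor (γ : ℝ) (k m : ℕ) (x : ℝ) (u : ℤ × ℤ) (i : ℕ) (w : ℤ × ℤ) (ω : BoxCfg) :
    ENNReal :=
  if NetCond k m x u i w ω then
    ENNReal.ofReal (Real.exp (γ * (lev k i u ω + lev k i w ω))) else 0

theorem ofReal_exp_mul_netWeight (γ : ℝ) (k n m : ℕ) (x : ℝ) (u : ℤ × ℤ) (ω : BoxCfg) :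
    ENNReal.ofReal (Real.exp (γ * fieldBelow k (n / k) u ω) * netWeight γ k n m x u ω) =
      ∑ w ∈ subcells (2 ^ n) (0, 0), ∏ i ∈ Finset.range (n / k), netFactor γ k m x u i w ω := by
  classical
  rw [netWeight, Finset.mul_sum, ENNReal.ofReal_sum_of_nonneg fun w _ => by split_ifs <;> positivity]
  refine Finset.sum_congr rfl fun w hw => ?_
  have hmem : w ∈ pointNet k n m x u ω ↔ ∀ i ∈ Finset.range (n / k), NetCond k m x u i w ω := by
    simp [pointNet, netSet, hw, NetCond]
  by_cases h : w ∈ pointNet k n m x u ω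
  · rw [if_pos h, ← Real.exp_add, ← mul_add, fieldBelow, fieldBelow, ← Finset.sum_add_distrib,
      Finset.mul_sum, Real.exp_sum, ENNReal.ofReal_prod_of_nonneg fun _ _ => (Real.exp_pos _).le]
    exact Finset.prod_congr rfl fun i hi => (if_pos (hmem.1 h i hi)).symm
  · rw [if_neg h, mul_zero, ENNReal.ofReal_zero]
    rw [hmem] at h
    push Not at h
    obtain ⟨i, hi, h⟩ := h
    exact (Finset.prod_eq_zero hi (if_neg h)).symm

theorem measurable_exp_ofReal {Ω : Type*} {m : MeasurableSpace Ω} {f : Ω → ℝ} (hf : Measurable f)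
    (γ : ℝ) : Measurable fun ω => ENNReal.ofReal (Real.exp (γ * f ω)) :=
  (hf.const_mul γ).exp.ennreal_ofReal

open Classical in
theorem measurable_ite_zero {Ω : Type*} {m : MeasurableSpace Ω} {p : Ω → Prop} {f : Ω → ENNReal}
    (hp : MeasurableSet {ω | p ω}) (hf : Measurable f) : Measurable fun ω => if p ω then f ω else 0 :=
  Measurable.ite hp hf measurable_const

theorem measurable_add_fun {Ω : Type*} {m : MeasurableSpace Ω} {f g : Ω → ℝ} (hf : Measurable f)
    (hg : Measurable g) : Measurable fun ω => f ω + g ω := hf.add hg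

theorem measurable_lev_levelIdx (k i : ℕ) (u : ℤ × ℤ) :
    Measurable[coordAlg (levelIdx (i * k))] (lev k i u) :=
  measurable_coordAlg_lev fun _ _ => rfl

theorem measurable_netFactor (γ : ℝ) (k m : ℕ) (x : ℝ) (u : ℤ × ℤ) (i : ℕ) (w : ℤ × ℤ) :
    Measurable[coordAlg (levelIdx (i * k))] (netFactor γ k m x u i w) := by
  refine measurable_ite_zero ?_ (measurable_exp_ofReal
    (measurable_add_fun (measurable_lev_levelIdx k i u) (measurable_lev_levelIdx k i w)) γ)
  simp only [NetCond, Set.ofPred_or]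
  exact MeasurableSet.union (MeasurableSet.const _) (measurableSet_road k i x (2 ^ k) m _)

theorem disjoint_levelIdx {k i j : ℕ} (hk : 1 ≤ k) (h : i ≠ j) :
    Disjoint (levelIdx (i * k)) (levelIdx (j * k)) := by
  rw [Set.disjoint_left]
  rintro ⟨l, a⟩ (h1 : l = i * k) (h2 : l = j * k)
  exact h (Nat.eq_of_mul_eq_mul_right hk (h1.symm.trans h2))

theorem lintegral_exp_mul_netWeight {k : ℕ} (hk : 1 ≤ k) (γ : ℝ) (n m : ℕ) (x : ℝ) (u : ℤ × ℤ) :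
    ∫⁻ ω, ENNReal.ofReal (Real.exp (γ * fieldBelow k (n / k) u ω) * netWeight γ k n m x u ω) ∂boxLaw =
      ∑ w ∈ subcells (2 ^ n) (0, 0), ∏ i ∈ Finset.range (n / k),
        ∫⁻ ω, netFactor γ k m x u i w ω ∂boxLaw := by
  simp only [ofReal_exp_mul_netWeight]
  rw [lintegral_finsetSum' _ fun w _ => Finset.aemeasurable_fun_prod _ fun i _ =>
    ((measurable_netFactor γ k m x u i w).mono (coordAlg_le _) le_rfl).aemeasurable]
  refine Finset.sum_congr rfl fun w _ => ?_
  exact lintegral_prod_of_disjoint _ (fun i => levelIdx (i * k)) _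
    (fun i _ => measurable_netFactor γ k m x u i w) fun i _ j _ hij => disjoint_levelIdx hk hij

theorem lintegral_exp_lev {k : ℕ} (hk : 1 ≤ k) (γ : ℝ) (i : ℕ) (u : ℤ × ℤ) :
    ∫⁻ ω, ENNReal.ofReal (Real.exp (γ * lev k i u ω)) ∂boxLaw =
      ENNReal.ofReal (Real.exp (γ ^ 2 * k / 2)) := by
  have := lintegral_exp_lin (γ • levCoef k i u)
  simp only [map_smul, LinearMap.smul_apply, smul_eq_mul, linCov_levCoef hk, if_true,
    overlap_self] at this
  simp only [lev]
  rw [this]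
  ring_nf

theorem lintegral_exp_lev_add_le {k : ℕ} (hk : 1 ≤ k) (γ : ℝ) (i : ℕ) (u w : ℤ × ℤ) :
    ∫⁻ ω, ENNReal.ofReal (Real.exp (γ * (lev k i u ω + lev k i w ω))) ∂boxLaw ≤
      ENNReal.ofReal (Real.exp (2 * γ ^ 2 * k)) := by
  have := lintegral_exp_lin (γ • (levCoef k i u + levCoef k i w))
  simp only [map_smul, map_add, LinearMap.add_apply, LinearMap.smul_apply, smul_eq_mul,
    linCov_levCoef hk, if_true, overlap_self] at this
  simp only [lev]
  rw [this]
  refine ENNReal.ofReal_le_ofReal (Real.exp_le_exp.2 ?_)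
  have h1 := overlap_le_one k i u w
  have h2 := overlap_le_one k i w u
  have h3 : 0 ≤ γ ^ 2 * k := by positivity
  nlinarith

-- Away from `u`, a point of the network has its level `i` cell on a road. If this cell is not high,
-- the level at `w` is at most `x`, which gives the first term. A high road cell has probability of
-- order `exp (-(8 * k))`, which absorbs the exponential moments.
open Classical in
theorem lintegral_netFactor_le {k : ℕ} (hk : 1 ≤ k) {γ : ℝ} (hγ₀ : 0 ≤ γ) (hγ : γ ≤ 1 / 2) {x : ℝ}
    (hx : 0 < x) {m h : ℕ} (hm : 0 < m) (hmK : m ≤ 2 ^ k) (hh : 2 * h ≤ m)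
    (hQ : ((2 * m : ℕ) * (32 * ENNReal.ofReal (Real.exp (-(x ^ 2 / (32 * k)))))) ^ h ≤
      ENNReal.ofReal (Real.exp (-(8 * k))))
    (u : ℤ × ℤ) (i : ℕ) (w : ℤ × ℤ)
    (hw : cell (2 ^ ((i + 1) * k)) w ≠ cell (2 ^ ((i + 1) * k)) u) :
    ∫⁻ ω, netFactor γ k m x u i w ω ∂boxLaw ≤
      ENNReal.ofReal (Real.exp (γ * x)) * ∫⁻ ω, (if Road (2 ^ k) m (GoodCell k i x ω)
        (cell (2 ^ (i * k)) w) then ENNReal.ofReal (Real.exp (γ * lev k i u ω)) else 0) ∂boxLaw +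
      ENNReal.ofReal (4 * Real.exp (-(3 * k))) := by
  set c := cell (2 ^ (i * k)) w with hc
  set F : Set BoxCfg := {ω | Road (2 ^ k) m (GoodCell k i x ω) c ∧ ω ∈ highOn k i x c}
  have hR : MeasurableSet {ω | Road (2 ^ k) m (GoodCell k i x ω) c} :=
    coordAlg_le _ _ (measurableSet_road k i x (2 ^ k) m c)
  have hF : MeasurableSet F := hR.inter (coordAlg_le _ _ (measurableSet_highOn_levelIdx k i x c))
  set A : BoxCfg → ENNReal := fun ω =>
    if Road (2 ^ k) m (GoodCell k i x ω) c then ENNReal.ofReal (Real.exp (γ * lev k i u ω)) else 0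
  have hA : Measurable A := measurable_ite_zero hR (measurable_exp_ofReal (measurable_lev k i u) γ)
  set B : BoxCfg → ENNReal := fun ω =>
    ENNReal.ofReal (Real.exp (2 * γ * (lev k i u ω + lev k i w ω)))
  have hB : Measurable B := measurable_exp_ofReal
    (measurable_add_fun (measurable_lev k i u) (measurable_lev k i w)) (2 * γ)
  -- Weights in `exp y ≤ t₁ * exp (2 * y) + t₂`. With second moment at most `exp (2 * k)` and
  -- probability at most `6 * exp (-(8 * k))`, both terms are of order `exp (-(3 * k))`.
  set t₁ := ENNReal.ofReal (Real.exp (-(5 * k)) / 2) with ht₁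
  set t₂ := ENNReal.ofReal (Real.exp (5 * k) / 2) with ht₂
  have hpt : ∀ ω, netFactor γ k m x u i w ω ≤
      ENNReal.ofReal (Real.exp (γ * x)) * A ω + (t₁ * B ω + t₂ * F.indicator 1 ω) := by
    intro ω
    by_cases hr : Road (2 ^ k) m (GoodCell k i x ω) c
    · have hn : NetCond k m x u i w ω := Or.inr hr
      rw [netFactor, if_pos hn]
      by_cases hhi : ω ∈ highOn k i x c
      · refine le_trans ?_ le_add_self
        have : ω ∈ F := ⟨hr, hhi⟩
        rw [Set.indicator_of_mem this, Pi.one_apply, mul_one, ht₁, ht₂,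
          ← ENNReal.ofReal_mul (by positivity), ← ENNReal.ofReal_add (by positivity) (by positivity)]
        refine ENNReal.ofReal_le_ofReal ?_
        set y := γ * (lev k i u ω + lev k i w ω) with hy
        have e1 : Real.exp (2 * γ * (lev k i u ω + lev k i w ω)) = Real.exp y * Real.exp y := by
          rw [← Real.exp_add, hy]; ring_nf
        rw [e1]
        have e2 : Real.exp (-(5 * k) / 2) * Real.exp (5 * k / 2) = 1 := by
          rw [← Real.exp_add, ← Real.exp_zero]; ring_nf
        have e3 : Real.exp (-(5 * k)) = Real.exp (-(5 * k) / 2) * Real.exp (-(5 * k) / 2) := by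
          rw [← Real.exp_add]; ring_nf
        have e4 : Real.exp (5 * k) = Real.exp (5 * k / 2) * Real.exp (5 * k / 2) := by
          rw [← Real.exp_add]; ring_nf
        rw [e3, e4]
        have e5 := sq_nonneg (Real.exp (-(5 * k) / 2) * Real.exp y - Real.exp (5 * k / 2))
        have e6 : Real.exp (-(5 * k) / 2) * Real.exp y * Real.exp (5 * k / 2) = Real.exp y := by
          rw [mul_right_comm, e2, one_mul]
        nlinarith
      · refine le_trans ?_ le_self_add
        simp only [A, if_pos hr]
        rw [← ENNReal.ofReal_mul (by positivity), ← Real.exp_add]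
        refine ENNReal.ofReal_le_ofReal (Real.exp_le_exp.2 ?_)
        have : lev k i w ω ≤ x := by
          by_contra hcon
          exact hhi ⟨w, rfl, (not_le.1 hcon).le.trans (le_abs_self _)⟩
        nlinarith
    · have hn : ¬ NetCond k m x u i w ω := not_or.2 ⟨hw, hr⟩
      rw [netFactor, if_neg hn]
      exact zero_le
  refine (lintegral_mono hpt).trans ?_
  rw [lintegral_add_left (hA.const_mul _), lintegral_const_mul _ hA,
    lintegral_add_left (hB.const_mul _), lintegral_const_mul _ hB,
    lintegral_const_mul _ (measurable_one.indicator hF), lintegral_indicator_one hF]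
  refine add_le_add_right ?_ _
  have h1 : ∫⁻ ω, B ω ∂boxLaw ≤ ENNReal.ofReal (Real.exp (2 * k)) := by
    refine (lintegral_exp_lev_add_le hk (2 * γ) i u w).trans
      (ENNReal.ofReal_le_ofReal (Real.exp_le_exp.2 ?_))
    have : γ ^ 2 ≤ 1 / 4 := by nlinarith
    have hk0 : (0 : ℝ) ≤ k := Nat.cast_nonneg k
    nlinarith
  have h2 : boxLaw F ≤ ENNReal.ofReal (6 * Real.exp (-(8 * k))) := by
    refine (boxLaw_road_highOn_le hk i hx hm hmK hh c).trans ?_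
    rw [ENNReal.ofReal_mul (by norm_num)]
    refine mul_le_mul' (by norm_num) hQ
  calc t₁ * ∫⁻ ω, B ω ∂boxLaw + t₂ * boxLaw F
      ≤ t₁ * ENNReal.ofReal (Real.exp (2 * k)) + t₂ * ENNReal.ofReal (6 * Real.exp (-(8 * k))) := by
        gcongr
    _ ≤ _ := by
        rw [ht₁, ht₂, ← ENNReal.ofReal_mul (by positivity), ← ENNReal.ofReal_mul (by positivity),
          ← ENNReal.ofReal_add (by positivity) (by positivity)]
        refine ENNReal.ofReal_le_ofReal ?_
        have e1 : Real.exp (-(5 * k)) * Real.exp (2 * k) = Real.exp (-(3 * k)) := by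
          rw [← Real.exp_add]; ring_nf
        have e2 : Real.exp (5 * k) * Real.exp (-(8 * k)) = Real.exp (-(3 * k)) := by
          rw [← Real.exp_add]; ring_nf
        nlinarith [Real.exp_pos (-(3 * (k : ℝ)))]

/-- Summing road indicators before integrating gives at most `6 * 2 ^ k` per coarse cell for every
configuration. Hence no independence between the roads and the level at `u` is needed. The remaining
part of the constant `10` pays for the high road cells. -/
theorem lintegral_exp_mul_netWeight_le {k : ℕ} (hk : 1 ≤ k) {γ : ℝ} (hγ₀ : 0 ≤ γ) (hγ : γ ≤ 1 / 2)
    {x : ℝ} (hx : 0 < x) {m M h : ℕ} (hm : 0 < m) (hM : 0 < M) (hK : 2 ^ k = M * m) (hh : 2 * h ≤ m)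
    (hQ : ((2 * m : ℕ) * (32 * ENNReal.ofReal (Real.exp (-(x ^ 2 / (32 * k)))))) ^ h ≤
      ENNReal.ofReal (Real.exp (-(8 * k)))) (n : ℕ) (u : ℤ × ℤ) :
    ∫⁻ ω, ENNReal.ofReal (Real.exp (γ * fieldBelow k (n / k) u ω) * netWeight γ k n m x u ω) ∂boxLaw ≤
      2 ^ k * 2 ^ k * ((1 + (n / k : ℕ) * (2 ^ k * 2 ^ k)) *
        ENNReal.ofReal (10 * 2 ^ k * Real.exp (γ * x + γ ^ 2 * k / 2)) ^ (n / k)) := by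
  classical
  rw [lintegral_exp_mul_netWeight hk]
  have hmK : m ≤ 2 ^ k := by rw [hK]; exact Nat.le_mul_of_pos_left m hM
  have hk0 : (0 : ℝ) ≤ k := Nat.cast_nonneg k
  have hg2 : γ ^ 2 ≤ 1 / 4 := by nlinarith
  -- At scales shared with `u` the factor `exp (2 * γ ^ 2 * k)` has to be below the rate per scale.
  -- The excess over `exp (γ ^ 2 * k / 2)` has exponent `3 / 2 * γ ^ 2 * k`, at most `3 / 8 * k`.
  have h2k : Real.exp (3 / 8 * k) ≤ 2 ^ k := by
    have h1 : Real.exp (3 / 8) ≤ 2 := by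
      have := Real.exp_bound' (x := 3 / 8) (by norm_num) (by norm_num) (n := 3) (by norm_num)
      refine this.trans ?_
      norm_num [Finset.sum_range_succ, Nat.factorial]
    calc Real.exp (3 / 8 * k) = Real.exp (3 / 8) ^ k := by rw [← Real.exp_nat_mul]; ring_nf
      _ ≤ 2 ^ k := pow_le_pow_left₀ (Real.exp_pos _).le h1 k
  refine sum_box_prod_le (u := u) (h := fun i c => ENNReal.ofReal (Real.exp (γ * x)) *
    ∫⁻ ω, (if Road (2 ^ k) m (GoodCell k i x ω) c then
      ENNReal.ofReal (Real.exp (γ * lev k i u ω)) else 0) ∂boxLaw +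
      ENNReal.ofReal (4 * Real.exp (-(3 * k)))) hk (fun i w => ?_)
    (fun i w hw => lintegral_netFactor_le hk hγ₀ hγ hx hm hmK hh hQ u i w hw) (fun i p => ?_) n
  · calc ∫⁻ ω, netFactor γ k m x u i w ω ∂boxLaw
        ≤ ∫⁻ ω, ENNReal.ofReal (Real.exp (γ * (lev k i u ω + lev k i w ω))) ∂boxLaw := by
          refine lintegral_mono fun ω => ?_
          rw [netFactor]
          split_ifs
          · exact le_rfl
          · exact zero_le
      _ ≤ ENNReal.ofReal (Real.exp (2 * γ ^ 2 * k)) := lintegral_exp_lev_add_le hk γ i u w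
      _ ≤ _ := by
          refine ENNReal.ofReal_le_ofReal ?_
          have e1 : Real.exp (2 * γ ^ 2 * k) ≤
              Real.exp (3 / 8 * k) * Real.exp (γ * x + γ ^ 2 * k / 2) := by
            rw [← Real.exp_add, Real.exp_le_exp]
            nlinarith [mul_nonneg hγ₀ hx.le]
          have e2 := Real.exp_pos (γ * x + γ ^ 2 * k / 2)
          have e3 := mul_le_mul_of_nonneg_right h2k e2.le
          have e4 : 0 < 2 ^ k * Real.exp (γ * x + γ ^ 2 * k / 2) := by positivity
          linarith
  · have hroad : ∀ c, Measurable fun ω => if Road (2 ^ k) m (GoodCell k i x ω) c then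
        ENNReal.ofReal (Real.exp (γ * lev k i u ω)) else 0 := fun c =>
      measurable_ite_zero (coordAlg_le _ _ (measurableSet_road k i x (2 ^ k) m c))
        (measurable_exp_ofReal (measurable_lev k i u) γ)
    have hcard : (((subcells (2 ^ k) p).card : ℕ) : ENNReal) = ENNReal.ofReal (2 ^ k * 2 ^ k) := by
      have h1 := card_subcells (2 ^ k) p
      push_cast at h1
      rw [h1, ← ENNReal.ofReal_natCast]
      push_cast
      rfl
    rw [Finset.sum_add_distrib, ← Finset.mul_sum, Finset.sum_const, nsmul_eq_mul, hcard,
      ← lintegral_finsetSum _ fun c _ => hroad c]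
    have hpt : ∀ ω, (∑ c ∈ subcells (2 ^ k) p, if Road (2 ^ k) m (GoodCell k i x ω) c then
        ENNReal.ofReal (Real.exp (γ * lev k i u ω)) else 0) ≤
          ENNReal.ofReal (6 * 2 ^ k) * ENNReal.ofReal (Real.exp (γ * lev k i u ω)) := by
      intro ω
      rw [← Finset.sum_filter, Finset.sum_const, nsmul_eq_mul]
      refine mul_le_mul_left ?_ _
      have h1 := card_road_le hm hM hK (GoodCell k i x ω) p
      push_cast at h1
      rw [← ENNReal.ofReal_natCast]
      refine ENNReal.ofReal_le_ofReal ?_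
      exact_mod_cast h1
    have hint := (lintegral_mono (μ := boxLaw) hpt)
    rw [lintegral_const_mul _ (measurable_exp_ofReal (measurable_lev k i u) γ),
      lintegral_exp_lev hk] at hint
    refine (add_le_add_left (mul_le_mul_right hint _) _).trans ?_
    rw [← ENNReal.ofReal_mul (by positivity), ← ENNReal.ofReal_mul (by positivity),
      ← ENNReal.ofReal_mul (by positivity), ← ENNReal.ofReal_add (by positivity) (by positivity)]
    refine ENNReal.ofReal_le_ofReal ?_
    have e1 : (2 : ℝ) ^ k * 2 ^ k * Real.exp (-(3 * k)) ≤ 1 := by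
      have h1 : (2 : ℝ) ^ k ≤ Real.exp k := by
        have : (2 : ℝ) ≤ Real.exp 1 := by linarith [Real.exp_one_gt_d9]
        calc (2 : ℝ) ^ k ≤ Real.exp 1 ^ k := pow_le_pow_left₀ (by norm_num) this k
          _ = Real.exp k := by rw [← Real.exp_nat_mul, mul_one]
      calc (2 : ℝ) ^ k * 2 ^ k * Real.exp (-(3 * k)) ≤ Real.exp k * Real.exp k * Real.exp (-(3 * k)) := by
            gcongr
        _ = Real.exp (-k) := by rw [← Real.exp_add, ← Real.exp_add]; ring_nf
        _ ≤ 1 := Real.exp_le_one_iff.2 (by linarith)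
    have e2 : 1 ≤ Real.exp (γ * x + γ ^ 2 * k / 2) := Real.one_le_exp (by positivity)
    have e3 : (1 : ℝ) ≤ 2 ^ k := one_le_pow₀ (by norm_num)
    rw [Real.exp_add] at e2 ⊢
    nlinarith [mul_le_mul e3 e2 zero_le_one (by positivity)]

/-! ### Second moments -/

/-- The coefficients of the field of the levels below `j` at the point `z`. -/
noncomputable def fieldCoef (k j : ℕ) (z : ℤ × ℤ) : BoxIdx →₀ ℝ :=
  ∑ i ∈ Finset.range j, levCoef k i z

theorem fieldBelow_eq_lin (k j : ℕ) (z : ℤ × ℤ) (ω : BoxCfg) :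
    fieldBelow k j z ω = lin ω (fieldCoef k j z) := by
  simp only [fieldBelow, fieldCoef, map_sum, lev]

theorem linCov_sum_levCoef {k : ℕ} (hk : 1 ≤ k) (T : Finset ℕ) (u v : ℤ × ℤ) :
    linCov (∑ i ∈ T, levCoef k i u) (∑ i ∈ T, levCoef k i v) = k * ∑ i ∈ T, overlap k i u v := by
  simp only [map_sum, LinearMap.sum_apply, linCov_levCoef hk]
  rw [Finset.mul_sum]
  refine Finset.sum_congr rfl fun i hi => ?_
  simp [hi]

/-- The sum of the overlaps of two points at the levels below `j`. -/
noncomputable def overlapSum (k j : ℕ) (u v : ℤ × ℤ) : ℝ := ∑ i ∈ Finset.range j, overlap k i u v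

theorem overlapSum_self (k j : ℕ) (u : ℤ × ℤ) : overlapSum k j u u = j := by
  simp [overlapSum, overlap_self]

theorem overlap_comm (k i : ℕ) (u v : ℤ × ℤ) : overlap k i u v = overlap k i v u := by
  rw [overlap, overlap, Finset.inter_comm]

theorem exp_fieldBelow_eq (γ : ℝ) (k j : ℕ) (u : ℤ × ℤ) (ω : BoxCfg) :
    Real.exp (γ * fieldBelow k j u ω) = Real.exp (lin ω (γ • fieldCoef k j u)) := by
  rw [map_smul, smul_eq_mul, fieldBelow_eq_lin]

theorem exp_fieldBelow_mul_eq (γ : ℝ) (k j : ℕ) (u v : ℤ × ℤ) (ω : BoxCfg) :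
    Real.exp (γ * fieldBelow k j u ω) * Real.exp (γ * fieldBelow k j v ω) =
      Real.exp (lin ω (γ • fieldCoef k j u + γ • fieldCoef k j v)) := by
  rw [map_add, Real.exp_add, exp_fieldBelow_eq, exp_fieldBelow_eq]

theorem integrable_exp_fieldBelow (γ : ℝ) (k j : ℕ) (u : ℤ × ℤ) :
    Integrable (fun ω => Real.exp (γ * fieldBelow k j u ω)) boxLaw := by
  simp only [exp_fieldBelow_eq]
  exact integrable_exp_lin _

theorem integrable_exp_fieldBelow_mul (γ : ℝ) (k j : ℕ) (u v : ℤ × ℤ) :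
    Integrable (fun ω => Real.exp (γ * fieldBelow k j u ω) * Real.exp (γ * fieldBelow k j v ω))
      boxLaw := by
  simp only [exp_fieldBelow_mul_eq]
  exact integrable_exp_lin _

theorem integral_exp_fieldBelow {k : ℕ} (hk : 1 ≤ k) (γ : ℝ) (j : ℕ) (u : ℤ × ℤ) :
    ∫ ω, Real.exp (γ * fieldBelow k j u ω) ∂boxLaw = Real.exp (γ ^ 2 * k * j / 2) := by
  have h := linCov_sum_levCoef hk (Finset.range j) u u
  rw [← overlapSum, overlapSum_self] at h
  simp only [exp_fieldBelow_eq]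
  rw [integral_exp_lin, fieldCoef]
  simp only [map_smul, LinearMap.smul_apply, smul_eq_mul, h]
  ring_nf

theorem integral_exp_fieldBelow_mul {k : ℕ} (hk : 1 ≤ k) (γ : ℝ) (j : ℕ) (u v : ℤ × ℤ) :
    ∫ ω, Real.exp (γ * fieldBelow k j u ω) * Real.exp (γ * fieldBelow k j v ω) ∂boxLaw =
      Real.exp (γ ^ 2 * k * j) * Real.exp (γ ^ 2 * k * overlapSum k j u v) := by
  have h1 := linCov_sum_levCoef hk (Finset.range j) u u
  have h2 := linCov_sum_levCoef hk (Finset.range j) v v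
  have h3 := linCov_sum_levCoef hk (Finset.range j) u v
  have h4 := linCov_sum_levCoef hk (Finset.range j) v u
  rw [← overlapSum] at h1 h2 h3 h4
  rw [overlapSum_self] at h1 h2
  have h5 : overlapSum k j v u = overlapSum k j u v :=
    Finset.sum_congr rfl fun i _ => overlap_comm k i v u
  rw [h5] at h4
  simp only [exp_fieldBelow_mul_eq]
  rw [integral_exp_lin, fieldCoef, fieldCoef, ← Real.exp_add]
  simp only [map_smul, map_add, LinearMap.add_apply, LinearMap.smul_apply, smul_eq_mul, h1, h2, h3,
    h4]
  ring_nf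

/-- Points at supremum distance less than `r`. -/
def Close (r : ℤ) (u v : ℤ × ℤ) : Prop := |u.1 - v.1| < r ∧ |u.2 - v.2| < r

open Classical in
theorem card_filter_close_le (T : Finset (ℤ × ℤ)) (r : ℕ) (u : ℤ × ℤ) :
    (T.filter (Close r u)).card ≤ 4 * (r * r) := by
  have hsub : T.filter (Close r u) ⊆
      Finset.Ioo (u.1 - r) (u.1 + r) ×ˢ Finset.Ioo (u.2 - r) (u.2 + r) := by
    intro v hv
    obtain ⟨h1, h2⟩ := (Finset.mem_filter.1 hv).2
    rw [abs_lt] at h1 h2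
    simp only [Finset.mem_product, Finset.mem_Ioo]
    omega
  refine (Finset.card_le_card hsub).trans ?_
  rw [Finset.card_product, Int.card_Ioo, Int.card_Ioo]
  have h1 : ∀ a : ℤ, (a + r - (a - r) - 1).toNat ≤ 2 * r := fun a => by omega
  calc _ ≤ 2 * r * (2 * r) := Nat.mul_le_mul (h1 _) (h1 _)
    _ = 4 * (r * r) := by ring

theorem overlapSum_le {k j m : ℕ} (hm : m ≤ j) {u v : ℤ × ℤ}
    (h : ∀ i < m, ¬ Close (2 ^ (i * k)) u v) : overlapSum k j u v ≤ j - m := by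
  obtain ⟨d, rfl⟩ := Nat.exists_eq_add_of_le hm
  rw [overlapSum, Finset.sum_range_add, Finset.sum_eq_zero, zero_add]
  · refine (Finset.sum_le_card_nsmul _ _ 1 fun i _ => overlap_le_one k _ u v).trans (le_of_eq ?_)
    rw [Finset.card_range, nsmul_eq_mul]
    push_cast
    ring
  · intro i hi
    refine overlap_eq_zero ?_
    by_contra hcon
    push Not at hcon
    exact h i (Finset.mem_range.1 hi) hcon

-- The points `v` are grouped by the first scale `m` at which they are close to `u`. There are at
-- most `4 * 4 ^ (m * k)` of them, each of weight at most `exp (γ ^ 2 * k * (j - m))`. Since `exp (γ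
-- ^ 2) ≤ 4`, the bound is largest for `m = r`, and there are `r + 1` groups.
open Classical in
theorem sum_exp_overlapSum_le {k : ℕ} {γ : ℝ} (hγ : γ ^ 2 ≤ 1 / 4) {r j : ℕ} (hr : r ≤ j)
    (T : Finset (ℤ × ℤ)) (u : ℤ × ℤ) :
    ∑ v ∈ T.filter (Close (2 ^ (r * k)) u), Real.exp (γ ^ 2 * k * overlapSum k j u v) ≤
      (r + 1) * (4 * (2 ^ (r * k) * 2 ^ (r * k)) * Real.exp (γ ^ 2 * k * (j - r))) := by
  have hg : 0 ≤ γ ^ 2 * k := by positivity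
  have hpt : ∀ v ∈ T.filter (Close (2 ^ (r * k)) u),
      Real.exp (γ ^ 2 * k * overlapSum k j u v) ≤ ∑ m ∈ Finset.range (r + 1),
        if Close (2 ^ (m * k)) u v then Real.exp (γ ^ 2 * k * (j - m)) else 0 := by
    intro v hv
    have hex : ∃ m, Close (2 ^ (m * k)) u v := ⟨r, (Finset.mem_filter.1 hv).2⟩
    set m := Nat.find hex
    have hmr : m ≤ r := Nat.find_min' hex (Finset.mem_filter.1 hv).2
    refine le_trans ?_ (Finset.single_le_sum (f := fun m : ℕ =>
      if Close (2 ^ (m * k)) u v then Real.exp (γ ^ 2 * k * (j - m)) else 0)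
      (fun i _ => by positivity) (Finset.mem_range.2 (Nat.lt_succ_of_le hmr)))
    have hm : Close (2 ^ (m * k)) u v := Nat.find_spec hex
    rw [if_pos hm]
    exact Real.exp_le_exp.2 (mul_le_mul_of_nonneg_left
      (overlapSum_le (hmr.trans hr) fun i hi => Nat.find_min hex hi) hg)
  refine (Finset.sum_le_sum hpt).trans ?_
  rw [Finset.sum_comm]
  have hterm : ∀ m ∈ Finset.range (r + 1),
      (∑ v ∈ T.filter (Close (2 ^ (r * k)) u),
        if Close (2 ^ (m * k)) u v then Real.exp (γ ^ 2 * k * (j - m)) else 0) ≤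
        4 * (2 ^ (r * k) * 2 ^ (r * k)) * Real.exp (γ ^ 2 * k * (j - r)) := by
    intro m hm
    have hmr : m ≤ r := Nat.lt_succ_iff.1 (Finset.mem_range.1 hm)
    rw [← Finset.sum_filter, Finset.sum_const, nsmul_eq_mul]
    have hc : ((((T.filter (Close (2 ^ (r * k)) u)).filter (Close (2 ^ (m * k)) u)).card : ℕ) : ℝ) ≤
        4 * (2 ^ (m * k) * 2 ^ (m * k)) := by
      have := card_filter_close_le (T.filter (Close (2 ^ (r * k)) u)) (2 ^ (m * k)) u
      push_cast at this
      exact_mod_cast this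
    refine (mul_le_mul_of_nonneg_right hc (Real.exp_pos _).le).trans ?_
    obtain ⟨d, rfl⟩ := Nat.exists_eq_add_of_le hmr
    have e1 : Real.exp (γ ^ 2 * k * (j - m)) =
        Real.exp (γ ^ 2) ^ (d * k) * Real.exp (γ ^ 2 * k * (j - (m + d : ℕ))) := by
      rw [← Real.exp_nat_mul, ← Real.exp_add]
      push_cast
      ring_nf
    have e2 : Real.exp (γ ^ 2) ≤ 4 := by
      have := Real.exp_one_lt_d9
      linarith [Real.exp_le_exp.2 (hγ.trans (by norm_num : (1 / 4 : ℝ) ≤ 1))]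
    have e3 : Real.exp (γ ^ 2) ^ (d * k) ≤ 2 ^ (d * k) * 2 ^ (d * k) := by
      rw [← mul_pow]
      exact pow_le_pow_left₀ (Real.exp_pos _).le (by linarith) _
    rw [e1, add_mul m d k, pow_add]
    calc 4 * ((2 : ℝ) ^ (m * k) * 2 ^ (m * k)) *
          (Real.exp (γ ^ 2) ^ (d * k) * Real.exp (γ ^ 2 * k * (j - (m + d : ℕ))))
        ≤ 4 * ((2 : ℝ) ^ (m * k) * 2 ^ (m * k)) *
          (2 ^ (d * k) * 2 ^ (d * k) * Real.exp (γ ^ 2 * k * (j - (m + d : ℕ)))) := by gcongr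
      _ = _ := by ring
  refine (Finset.sum_le_card_nsmul _ _ _ hterm).trans ?_
  rw [Finset.card_range, nsmul_eq_mul]
  push_cast
  rfl

/-! ### Pairs of close points have small mass -/

open Classical in
theorem boxLaw_close_ge_le {k : ℕ} (hk : 1 ≤ k) {γ : ℝ} (hγ : γ ^ 2 ≤ 1 / 4) {r j : ℕ} (hr : r ≤ j)
    (T : Finset (ℤ × ℤ)) {y : ℝ} (hy : 0 < y) :
    boxLaw {ω | y ≤ ∑ u ∈ T, ∑ v ∈ T.filter (Close (2 ^ (r * k)) u),
      Real.exp (γ * fieldBelow k j u ω) * Real.exp (γ * fieldBelow k j v ω)} ≤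
      ENNReal.ofReal (T.card * (Real.exp (γ ^ 2 * k * j) *
        ((r + 1) * (4 * (2 ^ (r * k) * 2 ^ (r * k)) * Real.exp (γ ^ 2 * k * (j - r))))) / y) := by
  set f : BoxCfg → ℝ := fun ω => ∑ u ∈ T, ∑ v ∈ T.filter (Close (2 ^ (r * k)) u),
      Real.exp (γ * fieldBelow k j u ω) * Real.exp (γ * fieldBelow k j v ω)
  have hint : Integrable f boxLaw := integrable_finsetSum _ fun u _ => integrable_finsetSum _
    fun v _ => integrable_exp_fieldBelow_mul γ k j u v
  have h0 : ∀ ω, 0 ≤ f ω := fun ω => by positivity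
  have h1 := mul_meas_ge_le_integral_of_nonneg (ae_of_all _ h0) hint y
  have h2 : ∫ ω, f ω ∂boxLaw ≤ T.card * (Real.exp (γ ^ 2 * k * j) *
      ((r + 1) * (4 * (2 ^ (r * k) * 2 ^ (r * k)) * Real.exp (γ ^ 2 * k * (j - r))))) := by
    simp only [f]
    rw [integral_finsetSum _ fun u _ => integrable_finsetSum _
      fun v _ => integrable_exp_fieldBelow_mul γ k j u v, ← nsmul_eq_mul]
    refine Finset.sum_le_card_nsmul _ _ _ fun u _ => ?_
    rw [integral_finsetSum _ fun v _ => integrable_exp_fieldBelow_mul γ k j u v]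
    simp only [integral_exp_fieldBelow_mul hk]
    rw [← Finset.mul_sum]
    exact mul_le_mul_of_nonneg_left (sum_exp_overlapSum_le hγ hr T u) (Real.exp_pos _).le
  rw [← ofReal_measureReal]
  refine ENNReal.ofReal_le_ofReal ?_
  rw [le_div_iff₀ hy, mul_comm]
  exact h1.trans h2

/-! ### The total mass is not small -/

/-- Chebyshev's inequality at half the mean. Points that are not close at scale `j` share no box of
the levels below `j`, so only close pairs contribute to the variance. The bound is useful only if
`T` is much larger than a cell of scale `j`; therefore the coarsest levels are treated apart. -/
theorem boxLaw_sum_exp_le {k : ℕ} (hk : 1 ≤ k) {γ : ℝ} (hγ : γ ^ 2 ≤ 1 / 4) (j : ℕ)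
    {T : Finset (ℤ × ℤ)} (hT : T.Nonempty) :
    boxLaw {ω | ∑ u ∈ T, Real.exp (γ * fieldBelow k j u ω) ≤
        T.card * Real.exp (γ ^ 2 * k * j / 2) / 2} ≤
      ENNReal.ofReal (16 * (j + 1) * (2 ^ (j * k) * 2 ^ (j * k)) / T.card) := by
  classical
  set a : ℝ := T.card * Real.exp (γ ^ 2 * k * j / 2) with ha
  have hc : (0 : ℝ) < T.card := by exact_mod_cast hT.card_pos
  have ha0 : 0 < a := by positivity
  set Z : BoxCfg → ℝ := fun ω => ∑ u ∈ T, Real.exp (γ * fieldBelow k j u ω)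
  have hZ : Integrable Z boxLaw := integrable_finsetSum _ fun u _ => integrable_exp_fieldBelow γ k j u
  have hZe : ∫ ω, Z ω ∂boxLaw = a := by
    simp only [Z]
    rw [integral_finsetSum _ fun u _ => integrable_exp_fieldBelow γ k j u]
    simp only [integral_exp_fieldBelow hk, Finset.sum_const, nsmul_eq_mul, ha]
  have hZZ : (fun ω => Z ω * Z ω) = fun ω => ∑ u ∈ T, ∑ v ∈ T,
      Real.exp (γ * fieldBelow k j u ω) * Real.exp (γ * fieldBelow k j v ω) :=
    funext fun ω => Finset.sum_mul_sum _ _ _ _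
  have hi2 : Integrable (fun ω => Z ω * Z ω) boxLaw := by
    rw [hZZ]
    exact integrable_finsetSum _ fun u _ => integrable_finsetSum _
      fun v _ => integrable_exp_fieldBelow_mul γ k j u v
  have hsq : Real.exp (γ ^ 2 * k * j / 2) * Real.exp (γ ^ 2 * k * j / 2) =
      Real.exp (γ ^ 2 * k * j) := by
    rw [← Real.exp_add]; ring_nf
  have hZZe : ∫ ω, Z ω * Z ω ∂boxLaw ≤
      a * a + T.card * (Real.exp (γ ^ 2 * k * j) * ((j + 1) * (4 * (2 ^ (j * k) * 2 ^ (j * k))))) := by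
    rw [hZZ, integral_finsetSum _ fun u _ => integrable_finsetSum _
      fun v _ => integrable_exp_fieldBelow_mul γ k j u v]
    have hrow : ∀ u ∈ T, ∫ ω, ∑ v ∈ T, Real.exp (γ * fieldBelow k j u ω) *
        Real.exp (γ * fieldBelow k j v ω) ∂boxLaw ≤ Real.exp (γ ^ 2 * k * j) *
          (T.card + (j + 1) * (4 * (2 ^ (j * k) * 2 ^ (j * k)))) := by
      intro u _
      rw [integral_finsetSum _ fun v _ => integrable_exp_fieldBelow_mul γ k j u v]
      simp only [integral_exp_fieldBelow_mul hk]
      rw [← Finset.mul_sum]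
      refine mul_le_mul_of_nonneg_left ?_ (Real.exp_pos _).le
      have h1 := sum_exp_overlapSum_le (k := k) hγ (le_refl j) T u
      rw [sub_self, mul_zero, Real.exp_zero, mul_one] at h1
      have h2 : ∑ v ∈ T.filter (fun v => ¬ Close (2 ^ (j * k)) u v),
          Real.exp (γ ^ 2 * k * overlapSum k j u v) ≤ T.card := by
        have h3 : ∀ v ∈ T.filter (fun v => ¬ Close (2 ^ (j * k)) u v),
            Real.exp (γ ^ 2 * k * overlapSum k j u v) ≤ 1 := by
          intro v hv
          have h4 := (Finset.mem_filter.1 hv).2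
          have h5 : overlapSum k j u v ≤ j - j := by
            refine overlapSum_le le_rfl fun i hi hcl => h4 ?_
            have : (2 : ℤ) ^ (i * k) ≤ 2 ^ (j * k) :=
              pow_le_pow_right₀ (by norm_num) (Nat.mul_le_mul_right k hi.le)
            exact ⟨hcl.1.trans_le this, hcl.2.trans_le this⟩
          rw [sub_self] at h5
          exact Real.exp_le_one_iff.2 (mul_nonpos_of_nonneg_of_nonpos (by positivity) h5)
        refine (Finset.sum_le_card_nsmul _ _ 1 h3).trans ?_
        rw [nsmul_eq_mul, mul_one]
        exact_mod_cast Finset.card_filter_le _ _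
      rw [← Finset.sum_filter_add_sum_filter_not T (Close (2 ^ (j * k)) u)]
      linarith
    refine (Finset.sum_le_card_nsmul _ _ _ hrow).trans (le_of_eq ?_)
    rw [nsmul_eq_mul, ha, ← hsq]
    ring
  set f : BoxCfg → ℝ := fun ω => (Z ω - a) ^ 2
  have hf : f = fun ω => Z ω * Z ω - 2 * a * Z ω + a * a := funext fun ω => by simp only [f]; ring
  have hfi : Integrable f boxLaw := by
    rw [hf]
    exact (hi2.sub (hZ.const_mul (2 * a))).add (integrable_const _)
  have hfe : ∫ ω, f ω ∂boxLaw ≤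
      T.card * (Real.exp (γ ^ 2 * k * j) * ((j + 1) * (4 * (2 ^ (j * k) * 2 ^ (j * k))))) := by
    have hs : Integrable (fun ω => Z ω * Z ω - 2 * a * Z ω) boxLaw := hi2.sub (hZ.const_mul (2 * a))
    simp only [hf]
    rw [integral_add hs (integrable_const _), integral_sub hi2 (hZ.const_mul (2 * a)), integral_const_mul, hZe]
    simp only [integral_const, probReal_univ, one_smul]
    linarith
  have h1 := mul_meas_ge_le_integral_of_nonneg (ae_of_all _ fun ω => sq_nonneg (Z ω - a)) hfi
    (a / 2 * (a / 2))
  have hsub : {ω | Z ω ≤ a / 2} ⊆ {ω | a / 2 * (a / 2) ≤ (Z ω - a) ^ 2} := by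
    intro ω hω
    simp only [Set.mem_ofPred_eq] at hω ⊢
    nlinarith
  refine (measure_mono hsub).trans ?_
  rw [← ofReal_measureReal]
  refine ENNReal.ofReal_le_ofReal ?_
  rw [le_div_iff₀ hc]
  have h2 := h1.trans hfe
  generalize boxLaw.real {ω | a / 2 * (a / 2) ≤ (Z ω - a) ^ 2} = p at h2 ⊢
  have h3 : a / 2 * (a / 2) = T.card * Real.exp (γ ^ 2 * k * j) * (T.card / 4) := by
    rw [ha, ← hsq]; ring
  rw [h3] at h2
  have h4 : 0 < T.card * Real.exp (γ ^ 2 * k * j) := by positivity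
  have h5 : T.card * Real.exp (γ ^ 2 * k * j) *
      (p * T.card) ≤
      T.card * Real.exp (γ ^ 2 * k * j) * (16 * (j + 1) * (2 ^ (j * k) * 2 ^ (j * k))) := by
    linarith
  exact le_of_mul_le_mul_left h5 h4

/-! ### The highest levels -/

/-- A plain union bound over `T`. When `d` is a small fraction of all levels, the variance is small
enough for `y` to be a small multiple of `n`. -/
theorem boxLaw_exists_low_le {k : ℕ} (hk : 1 ≤ k) (T : Finset (ℤ × ℤ)) (j d : ℕ) {l : ℝ}
    (hl : 0 ≤ l) (y : ℝ) :
    boxLaw {ω | ∃ z ∈ T, fieldBelow k (j + d) z ω - fieldBelow k j z ω ≤ -y} ≤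
      T.card * ENNReal.ofReal (Real.exp (l ^ 2 * (k * d) / 2 - l * y)) := by
  have hsub : {ω | ∃ z ∈ T, fieldBelow k (j + d) z ω - fieldBelow k j z ω ≤ -y} ⊆
      ⋃ z ∈ T, {ω | y ≤ lin ω (-∑ i ∈ (Finset.range d).map (addLeftEmbedding j), levCoef k i z)} := by
    rintro ω ⟨z, hz, h⟩
    refine Set.mem_biUnion hz ?_
    rw [fieldBelow, fieldBelow, Finset.sum_range_add, add_sub_cancel_left] at h
    simp only [Set.mem_ofPred_eq, map_neg, map_sum, Finset.sum_map, addLeftEmbedding_apply]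
    simp only [lev] at h
    linarith
  refine (measure_mono hsub).trans ((measure_biUnion_finset_le _ _).trans ?_)
  rw [← nsmul_eq_mul]
  refine Finset.sum_le_card_nsmul _ _ _ fun z _ => (boxLaw_lin_ge _ y l hl).trans ?_
  have h1 := linCov_sum_levCoef hk ((Finset.range d).map (addLeftEmbedding j)) z z
  simp only [map_neg, LinearMap.neg_apply, neg_neg, h1, overlap_self, Finset.sum_const,
    Finset.card_map, Finset.card_range, nsmul_eq_mul, mul_one]
  exact le_rfl

/-! ### The lower bound for the distance -/

theorem close_of_near_cell {s : ℤ} (hs : 0 < s) {h : ℕ} {u v : ℤ × ℤ}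
    (hn : Near (64 * h) (cell s u) (cell s v)) : Close (s * (64 * h + 1)) u v := by
  have key : ∀ x y : ℤ, |x / s - y / s| ≤ 64 * h → |x - y| < s * (64 * h + 1) := by
    intro x y hxy
    have h1 := Int.emod_add_mul_ediv x s
    have h2 := Int.emod_add_mul_ediv y s
    have h3 := Int.emod_nonneg x hs.ne'
    have h4 := Int.emod_nonneg y hs.ne'
    have h5 := Int.emod_lt_of_pos x hs
    have h6 := Int.emod_lt_of_pos y hs
    rw [abs_le] at hxy
    rw [abs_lt]
    constructor <;> nlinarith
  exact ⟨key _ _ hn.1, key _ _ hn.2⟩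

/-- Cells of scale `j` are counted in the whole box instead of in one cell of the next scale, so `h`
is free to grow with `n`. The levels from `j` on lower every weight by at most the factor `exp (-(γ
* y))`. -/
theorem le_fppDist_of_not_hasBadChain {k n j h : ℕ} {γ q y : ℝ} (hγ : 0 ≤ γ) (hq : 0 ≤ q)
    (hj : j ≤ n / k) {ω : BoxCfg}
    (hno : ¬ HasBadChain h (subcells (2 ^ (n - j * k)) (0, 0)) fun c => ω ∈ Thin k γ j q c)
    (htop : ∀ z ∈ subcells (2 ^ n) (0, 0), -y ≤ fieldBelow k (n / k) z ω - fieldBelow k j z ω)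
    {u v : LatticeBox (2 ^ n)} (hne : Nonempty ((latticeGraph (2 ^ n)).Path u v))
    (hfar : ¬ Close (2 ^ (j * k) * (64 * h + 1)) (toPt u) (toPt v)) :
    16 * h * q * Real.exp (-(γ * y)) ≤ fppDist γ (coarseMBRW k n ω) u v := by
  refine le_ciInf fun p => ?_
  set w : (latticeGraph (2 ^ n)).Walk u v := p.1
  have hs : (0 : ℤ) < 2 ^ (j * k) := by positivity
  have hjn : j * k ≤ n := (Nat.mul_le_mul_right k hj).trans (Nat.div_mul_le_self n k)
  have hsup : w.support.map toPt = toPt u :: w.support.tail.map toPt := by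
    conv_lhs => rw [← SimpleGraph.Walk.cons_tail_support w]
    rw [List.map_cons]
  have hchain : List.IsChain IsNbr (toPt u :: w.support.tail.map toPt) := by
    rw [← hsup, List.isChain_map]
    exact w.isChain_adj_support
  have hlast : (toPt u :: w.support.tail.map toPt).getLast (List.cons_ne_nil _ _) = toPt v := by
    simp only [← hsup, List.getLast_map, SimpleGraph.Walk.getLast_support]
  have hcell : cell (2 ^ (j * k)) (toPt u) ∈ subcells (2 ^ (n - j * k)) (0, 0) := by
    rw [mem_subcells (by positivity), cell_cell (by positivity), ← pow_add,
      Nat.add_sub_cancel' hjn, ← mem_subcells (by positivity)]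
    exact toPt_mem u
  have hmain := le_sum_of_not_hasBadChain hs (fun z => Real.exp (γ * fieldBelow k j z ω))
    (fun z => (Real.exp_pos _).le) hq (fun c => ω ∈ Thin k γ j q c)
    (fun c hc a p z h1 h2 h3 h4 => not_lt.1 fun hlt => hc ⟨a, p, z, ⟨h1, h2, h3, h4⟩, hlt⟩)
    hno hchain hcell (by rw [hlast]; exact fun hn => hfar (close_of_near_cell hs hn))
  rw [← hsup, List.map_map] at hmain
  refine (mul_le_mul_of_nonneg_right hmain (Real.exp_pos _).le).trans ?_
  rw [← List.sum_map_mul_right]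
  refine List.sum_le_sum fun z _ => ?_
  rw [Function.comp_apply, ← Real.exp_add, coarseMBRW_eq]
  refine Real.exp_le_exp.2 ?_
  have := mul_le_mul_of_nonneg_left (htop _ (toPt_mem z)) hγ
  linarith

theorem boxLaw_hasBadChain_thin_le {k h : ℕ} (hk : 1 ≤ k) {γ x : ℝ} (hγ : 0 ≤ γ) (hx : 0 < x)
    (hh : 1 ≤ h) (hhk : 64 * h < 2 ^ k) {p : ENNReal}
    (hp₁ : 9 * (32 * ENNReal.ofReal (Real.exp (-(x ^ 2 / (32 * k))))) ≤ p / 2)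
    (hp₂ : 50 ^ 32 * p ≤ 1 / 2) (hp₃ : 2 ^ k * 2 ^ k * (1 / 2) ^ h ≤ p / 2) (j : ℕ)
    {h' : ℕ} (hh' : 1 ≤ h') (S : Finset (ℤ × ℤ)) :
    boxLaw {ω | HasBadChain h' S fun c => ω ∈ Thin k γ j ((16 * h * Real.exp (-(γ * x))) ^ j) c} ≤
      S.card * (1 / 2) ^ h' := by
  refine (boxLaw_hasBadChain_le hh' S _ (cellRegion (2 ^ (j * k)))
    (fun c => measurableSet_thin k γ j _ c) (fun c c' => disjoint_cellRegion (by positivity)) (p / 2)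
    (boxLaw_thin_le hk hγ hx hh hhk hp₁ hp₂ hp₃ j)).trans ?_
  gcongr
  exact (mul_le_mul_right ENNReal.half_le_self _).trans hp₂

/-! ### The mass of the pairs at a typical distance -/

-- A pair outside `S` has a bad first point, a bad second point, or is a bad pair. Each case carries
-- mass at most `δ`.
open Classical in
theorem le_lqgPairMass {N : ℕ} [NeZero N] (γ : ℝ) (φ : LatticeBox N → ℝ)
    (S : Set (LatticeBox N × LatticeBox N)) (B : LatticeBox N → Prop)
    (C : LatticeBox N → LatticeBox N → Prop) (hS : ∀ u v, (u, v) ∉ S → B u ∨ B v ∨ C u v) {δ : ℝ}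
    (hB : ∑ u with B u, Real.exp (γ * φ u) ≤ δ * ∑ w, Real.exp (γ * φ w))
    (hC : ∑ u, ∑ v with C u v, Real.exp (γ * φ u) * Real.exp (γ * φ v) ≤
      δ * ((∑ w, Real.exp (γ * φ w)) * ∑ w, Real.exp (γ * φ w))) :
    1 - 3 * δ ≤ lqgPairMass γ φ S := by
  set Z := ∑ w, Real.exp (γ * φ w) with hZ
  have hZ0 : 0 < Z := Finset.sum_pos (fun _ _ => Real.exp_pos _) ⟨0, Finset.mem_univ _⟩
  set m : LatticeBox N → ℝ := lqgMass γ φ with hm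
  have hm0 : ∀ u, 0 ≤ m u := fun u => div_nonneg (Real.exp_pos _).le hZ0.le
  have hm1 : ∑ u, m u = 1 := by
    simp only [hm, lqgMass, ← Finset.sum_div, ← hZ]
    exact div_self hZ0.ne'
  have hB' : ∑ u with B u, m u ≤ δ := by
    simp only [hm, lqgMass, ← Finset.sum_div, ← hZ]
    exact (div_le_iff₀ hZ0).2 hB
  have hC' : ∑ u, ∑ v with C u v, m u * m v ≤ δ := by
    simp only [hm, lqgMass, ← hZ, div_mul_div_comm, ← Finset.sum_div]
    exact (div_le_iff₀ (mul_pos hZ0 hZ0)).2 hC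
  have hprod : ∀ F : LatticeBox N → LatticeBox N → ℝ,
      ∑ p : LatticeBox N × LatticeBox N, F p.1 p.2 = ∑ u, ∑ v, F u v := fun F =>
    Fintype.sum_prod_type fun p => F p.1 p.2
  have htot : ∑ p : LatticeBox N × LatticeBox N, m p.1 * m p.2 = 1 := by
    rw [hprod fun u v => m u * m v, ← Finset.sum_mul_sum, hm1, one_mul]
  have hcompl : ∑ p with p ∉ S, m p.1 * m p.2 ≤ δ + δ + δ := by
    have h1 : ∀ p : LatticeBox N × LatticeBox N, (if p ∉ S then m p.1 * m p.2 else 0) ≤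
        (if B p.1 then m p.1 * m p.2 else 0) + (if B p.2 then m p.1 * m p.2 else 0) +
          (if C p.1 p.2 then m p.1 * m p.2 else 0) := by
      intro p
      have h0 := mul_nonneg (hm0 p.1) (hm0 p.2)
      by_cases hp : p ∉ S
      · rcases hS p.1 p.2 hp with h | h | h <;> simp only [hp, h, if_true, not_false_eq_true] <;>
          split_ifs <;> linarith
      · rw [if_neg hp]
        split_ifs <;> linarith
    rw [Finset.sum_filter]
    refine (Finset.sum_le_sum fun p _ => h1 p).trans ?_
    rw [Finset.sum_add_distrib, Finset.sum_add_distrib,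
      hprod fun u v => if B u then m u * m v else 0, hprod fun u v => if B v then m u * m v else 0,
      hprod fun u v => if C u v then m u * m v else 0]
    simp only [← Finset.sum_filter]
    refine add_le_add (add_le_add (le_of_eq_of_le ?_ hB') (le_of_eq_of_le ?_ hB')) hC'
    · rw [Finset.sum_filter]
      refine Finset.sum_congr rfl fun u _ => ?_
      by_cases h : B u <;> simp [h, ← Finset.mul_sum, hm1]
    · simp only [← Finset.mul_sum]
      rw [← Finset.sum_mul, hm1, one_mul]
  have := Finset.sum_filter_add_sum_filter_not Finset.univ (· ∈ S) fun p => m p.1 * m p.2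
  rw [htot] at this
  rw [lqgPairMass]
  linarith

theorem sum_toPt {n : ℕ} {M : Type*} [AddCommMonoid M] (F : ℤ × ℤ → M) :
    ∑ z : LatticeBox (2 ^ n), F (toPt z) = ∑ w ∈ subcells (2 ^ n) (0, 0), F w := by
  refine Finset.sum_bij (fun z _ => toPt z) (fun z _ => toPt_mem z)
    (fun a _ b _ h => toPt_injective h) (fun w hw => ?_) fun _ _ => rfl
  obtain ⟨z, hz⟩ := exists_toPt_eq hw
  exact ⟨z, Finset.mem_univ z, hz⟩

/-! ### The probability that typical pairs do not have most of the mass -/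

/-- Almost all of the mass sits on pairs of vertices with distance between `D` and `2 * U`. -/
theorem le_lqgPairMass_coarseMBRW {k n m M r : ℕ} (hm : 0 < m) (hM : 0 < M) (hK : 2 ^ k = M * m)
    {γ x D U z₀ δ : ℝ} (hU : 0 < U) (hδ : 0 ≤ δ) (hz₀ : 0 ≤ z₀) {ω : BoxCfg}
    (hZ : z₀ ≤ ∑ w ∈ subcells (2 ^ n) (0, 0), Real.exp (γ * fieldBelow k (n / k) w ω))
    (hW : ∑ w ∈ subcells (2 ^ n) (0, 0),
      Real.exp (γ * fieldBelow k (n / k) w ω) * netWeight γ k n m x w ω ≤ U * (δ * z₀))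
    (hC : open Classical in ∑ u ∈ subcells (2 ^ n) (0, 0),
      ∑ v ∈ (subcells (2 ^ n) (0, 0)).filter (Close (2 ^ (r * k)) u),
        Real.exp (γ * fieldBelow k (n / k) u ω) * Real.exp (γ * fieldBelow k (n / k) v ω) ≤
      δ * (z₀ * z₀))
    (hD : ∀ u v : LatticeBox (2 ^ n), ¬ Close (2 ^ (r * k)) (toPt u) (toPt v) →
      D ≤ fppDist γ (coarseMBRW k n ω) u v) :
    1 - 3 * δ ≤ lqgPairMass γ (coarseMBRW k n ω) {p | D ≤ fppDist γ (coarseMBRW k n ω) p.1 p.2 ∧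
      fppDist γ (coarseMBRW k n ω) p.1 p.2 ≤ 2 * U} := by
  classical
  have hZsum : ∑ w : LatticeBox (2 ^ n), Real.exp (γ * coarseMBRW k n ω w) =
      ∑ w ∈ subcells (2 ^ n) (0, 0), Real.exp (γ * fieldBelow k (n / k) w ω) := by
    simp only [coarseMBRW_eq]
    exact sum_toPt fun w => Real.exp (γ * fieldBelow k (n / k) w ω)
  have hW0 : ∀ w, 0 ≤ netWeight γ k n m x w ω := fun w =>
    Finset.sum_nonneg fun _ _ => by split_ifs <;> positivity
  refine le_lqgPairMass γ _ _ (fun u => U < netWeight γ k n m x (toPt u) ω)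
    (fun u v => Close (2 ^ (r * k)) (toPt u) (toPt v)) (fun u v huv => ?_) ?_ ?_
  · by_contra hcon
    push Not at hcon
    obtain ⟨h1, h2, h3⟩ := hcon
    refine huv ⟨hD u v h3, ?_⟩
    have := (nonempty_path_and_fppDist_le hm hM hK γ x ω u v).2
    simp only
    linarith
  · rw [hZsum]
    refine le_trans ?_ (mul_le_mul_of_nonneg_left hZ hδ)
    -- Markov's inequality for the measure of points: where the network weighs more than `U`, the
    -- mass times `U` is below the mass times the weight.
    rw [← mul_le_mul_iff_right₀ hU]
    refine le_trans ?_ hW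
    rw [← sum_toPt fun w => Real.exp (γ * fieldBelow k (n / k) w ω) * netWeight γ k n m x w ω,
      Finset.mul_sum, Finset.sum_filter]
    refine Finset.sum_le_sum fun u _ => ?_
    have h1 := hW0 (toPt u)
    rw [coarseMBRW_eq]
    split_ifs with h
    · rw [mul_comm]
      gcongr
    · positivity
  · rw [hZsum]
    refine le_trans ?_ (hC.trans (mul_le_mul_of_nonneg_left (mul_le_mul hZ hZ hz₀ (hz₀.trans hZ)) hδ))
    rw [← sum_toPt fun u => ∑ v ∈ (subcells (2 ^ n) (0, 0)).filter (Close (2 ^ (r * k)) u),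
        Real.exp (γ * fieldBelow k (n / k) u ω) * Real.exp (γ * fieldBelow k (n / k) v ω)]
    refine le_of_eq (Finset.sum_congr rfl fun u _ => ?_)
    rw [Finset.sum_filter, Finset.sum_filter, ← sum_toPt]
    simp only [coarseMBRW_eq]

theorem boxLaw_sum_exp_mul_netWeight_ge_le {k : ℕ} (hk : 1 ≤ k) {γ : ℝ} (hγ₀ : 0 ≤ γ)
    (hγ : γ ≤ 1 / 2) {x : ℝ} (hx : 0 < x) {m M h : ℕ} (hm : 0 < m) (hM : 0 < M)
    (hK : 2 ^ k = M * m) (hh : 2 * h ≤ m)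
    (hQ : ((2 * m : ℕ) * (32 * ENNReal.ofReal (Real.exp (-(x ^ 2 / (32 * k)))))) ^ h ≤
      ENNReal.ofReal (Real.exp (-(8 * k)))) (n : ℕ) (T : Finset (ℤ × ℤ)) {y : ℝ} (hy : 0 < y) :
    boxLaw {ω | y ≤ ∑ u ∈ T,
      Real.exp (γ * fieldBelow k (n / k) u ω) * netWeight γ k n m x u ω} ≤
      ENNReal.ofReal (T.card * (2 ^ k * 2 ^ k * ((1 + (n / k : ℕ) * (2 ^ k * 2 ^ k)) *
        (10 * 2 ^ k * Real.exp (γ * x + γ ^ 2 * k / 2)) ^ (n / k))) / y) := by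
  have hW0 : ∀ u ω, 0 ≤ netWeight γ k n m x u ω := fun w ω =>
    Finset.sum_nonneg fun _ _ => by split_ifs <;> positivity
  set f : ℤ × ℤ → BoxCfg → ENNReal := fun u ω =>
    ENNReal.ofReal (Real.exp (γ * fieldBelow k (n / k) u ω) * netWeight γ k n m x u ω)
  have hf : ∀ u, Measurable (f u) := by
    intro u
    simp only [f, ofReal_exp_mul_netWeight]
    exact Finset.measurable_sum _ fun w _ => Finset.measurable_fun_prod _ fun i _ =>
      (measurable_netFactor γ k m x u i w).mono (coordAlg_le _) le_rfl
  have hsub : {ω | y ≤ ∑ u ∈ T, Real.exp (γ * fieldBelow k (n / k) u ω) * netWeight γ k n m x u ω} ⊆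
      {ω | ENNReal.ofReal y ≤ ∑ u ∈ T, f u ω} := by
    intro ω hω
    simp only [Set.mem_ofPred_eq, f] at hω ⊢
    rw [← ENNReal.ofReal_sum_of_nonneg fun u _ => mul_nonneg (Real.exp_pos _).le (hW0 u ω)]
    exact ENNReal.ofReal_le_ofReal hω
  refine (measure_mono hsub).trans ?_
  have hy' : ENNReal.ofReal y ≠ 0 := by simpa using hy
  refine (meas_ge_le_lintegral_div (Finset.aemeasurable_fun_sum _ fun u _ => (hf u).aemeasurable) hy'
    ENNReal.ofReal_ne_top).trans ?_
  rw [ENNReal.ofReal_div_of_pos hy, lintegral_finsetSum _ fun u _ => hf u]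
  refine ENNReal.div_le_div_right ?_ _
  rw [ENNReal.ofReal_mul (Nat.cast_nonneg _), ENNReal.ofReal_natCast, ← nsmul_eq_mul]
  refine Finset.sum_le_card_nsmul _ _ _ fun u _ =>
    (lintegral_exp_mul_netWeight_le hk hγ₀ hγ hx hm hM hK hh hQ n u).trans (le_of_eq ?_)
  have h2 : (2 : ENNReal) ^ k = ENNReal.ofReal (2 ^ k) := by
    rw [ENNReal.ofReal_pow (by norm_num)]
    norm_num
  rw [h2, ← ENNReal.ofReal_natCast, ← ENNReal.ofReal_one, ← ENNReal.ofReal_pow (by positivity),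
    ← ENNReal.ofReal_mul (by positivity), ← ENNReal.ofReal_mul (by positivity),
    ← ENNReal.ofReal_add (by positivity) (by positivity), ← ENNReal.ofReal_mul (by positivity),
    ← ENNReal.ofReal_mul (by positivity)]

/-- Six events can fail. The levels are cut at `j` for the distances and at `j'` for the total mass;
the two cuts are separate because the loss `y'` must be far smaller than the distance at `r` that
defines close pairs, while `y` is only compared with the exponent of the distance. Here `z₀` is the
resulting lower bound for the total mass. -/
theorem boxLaw_lqgPairMass_lt_le {k : ℕ} (hk : 1 ≤ k) {γ : ℝ} (hγ₀ : 0 ≤ γ) (hγ : γ ≤ 1 / 2)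
    {x : ℝ} (hx : 0 < x) {m M h : ℕ} (hm : 0 < m) (hM : 0 < M) (hK : 2 ^ k = M * m) (hh : 2 * h ≤ m)
    (hQ : ((2 * m : ℕ) * (32 * ENNReal.ofReal (Real.exp (-(x ^ 2 / (32 * k)))))) ^ h ≤
      ENNReal.ofReal (Real.exp (-(8 * k))))
    {n r j d j' d' h' : ℕ} (hj : j + d = n / k) (hj' : j' + d' = n / k) (hr : r ≤ n / k)
    (hh' : (2 : ℤ) ^ (j * k) * (64 * h' + 1) ≤ 2 ^ (r * k)) {q D U δ l l' y y' z₀ : ℝ} (hq : 0 ≤ q)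
    (hD : D ≤ 16 * h' * q * Real.exp (-(γ * y))) (hU : 0 < U) (hδ : 0 < δ) (hl : 0 ≤ l)
    (hl' : 0 ≤ l') (hz₀ : z₀ = (subcells (2 ^ n) (0, 0)).card * Real.exp (γ ^ 2 * k * j' / 2) / 2 *
      Real.exp (-(γ * y'))) :
    boxLaw {ω | lqgPairMass γ (coarseMBRW k n ω) {p | D ≤ fppDist γ (coarseMBRW k n ω) p.1 p.2 ∧
      fppDist γ (coarseMBRW k n ω) p.1 p.2 ≤ 2 * U} < 1 - 3 * δ} ≤
    boxLaw {ω | HasBadChain h' (subcells (2 ^ (n - j * k)) (0, 0)) fun c => ω ∈ Thin k γ j q c} +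
    (subcells (2 ^ n) (0, 0)).card * ENNReal.ofReal (Real.exp (l ^ 2 * (k * d) / 2 - l * y)) +
    (subcells (2 ^ n) (0, 0)).card * ENNReal.ofReal (Real.exp (l' ^ 2 * (k * d') / 2 - l' * y')) +
    ENNReal.ofReal (16 * (j' + 1) * (2 ^ (j' * k) * 2 ^ (j' * k)) / (subcells (2 ^ n) (0, 0)).card) +
    ENNReal.ofReal ((subcells (2 ^ n) (0, 0)).card *
      (2 ^ k * 2 ^ k * ((1 + (n / k : ℕ) * (2 ^ k * 2 ^ k)) *
        (10 * 2 ^ k * Real.exp (γ * x + γ ^ 2 * k / 2)) ^ (n / k))) / (U * (δ * z₀))) +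
    ENNReal.ofReal ((subcells (2 ^ n) (0, 0)).card * (Real.exp (γ ^ 2 * k * (n / k : ℕ)) *
      ((r + 1) * (4 * (2 ^ (r * k) * 2 ^ (r * k)) * Real.exp (γ ^ 2 * k * ((n / k : ℕ) - r))))) /
      (δ * (z₀ * z₀))) := by
  classical
  have hγ2 : γ ^ 2 ≤ 1 / 4 := by nlinarith
  have hcard := card_subcells (2 ^ n) (0, 0)
  push_cast at hcard
  have hne : (subcells (2 ^ n) (0, 0)).Nonempty := by
    rw [← Finset.card_pos, hcard]
    positivity
  have hcpos : (0 : ℝ) < (subcells (2 ^ n) (0, 0)).card := by exact_mod_cast hne.card_pos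
  have hz₀' : 0 < z₀ := by
    rw [hz₀]
    positivity
  set T := subcells (2 ^ n) (0, 0)
  refine le_trans (measure_mono (t := {ω | HasBadChain h' (subcells (2 ^ (n - j * k)) (0, 0))
      fun c => ω ∈ Thin k γ j q c} ∪
    {ω | ∃ z ∈ T, fieldBelow k (j + d) z ω - fieldBelow k j z ω ≤ -y} ∪
    {ω | ∃ z ∈ T, fieldBelow k (j' + d') z ω - fieldBelow k j' z ω ≤ -y'} ∪
    {ω | ∑ u ∈ T, Real.exp (γ * fieldBelow k j' u ω) ≤
        T.card * Real.exp (γ ^ 2 * k * j' / 2) / 2} ∪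
    {ω | U * (δ * z₀) ≤ ∑ u ∈ T,
      Real.exp (γ * fieldBelow k (n / k) u ω) * netWeight γ k n m x u ω} ∪
    {ω | δ * (z₀ * z₀) ≤ ∑ u ∈ T, ∑ v ∈ T.filter (Close (2 ^ (r * k)) u),
      Real.exp (γ * fieldBelow k (n / k) u ω) * Real.exp (γ * fieldBelow k (n / k) v ω)}) ?_) ?_
  · intro ω hω
    by_contra hcon
    simp only [Set.mem_union, not_or, Set.mem_ofPred_eq, not_exists, not_and, not_le] at hcon
    obtain ⟨⟨⟨⟨⟨h1, h2⟩, h3⟩, h4⟩, h5⟩, h6⟩ := hcon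
    rw [hj] at h2
    rw [hj'] at h3
    refine absurd (le_lqgPairMass_coarseMBRW (r := r) hm hM hK hU hδ.le hz₀'.le ?_ h5.le h6.le
      fun u v huv => ?_) (not_le.2 hω)
    · rw [hz₀]
      refine (mul_le_mul_of_nonneg_right h4.le (Real.exp_pos _).le).trans ?_
      rw [Finset.sum_mul]
      refine Finset.sum_le_sum fun u hu => ?_
      rw [← Real.exp_add, Real.exp_le_exp]
      have := mul_le_mul_of_nonneg_left (h3 u hu).le hγ₀
      linarith
    · refine hD.trans (le_fppDist_of_not_hasBadChain hγ₀ hq (by omega) h1 (fun z hz => (h2 z hz).le)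
        (nonempty_path_and_fppDist_le hm hM hK γ x ω u v).1 fun hcl => huv ?_)
      exact ⟨hcl.1.trans_le hh', hcl.2.trans_le hh'⟩
  · refine (measure_union_le _ _).trans (add_le_add ?_ ?_)
    · refine (measure_union_le _ _).trans (add_le_add ?_ ?_)
      · refine (measure_union_le _ _).trans (add_le_add ?_ ?_)
        · refine (measure_union_le _ _).trans (add_le_add ?_ ?_)
          · refine (measure_union_le _ _).trans (add_le_add le_rfl ?_)
            exact boxLaw_exists_low_le hk T j d hl y
          · exact boxLaw_exists_low_le hk T j' d' hl' y'
        · exact boxLaw_sum_exp_le hk hγ2 j' hne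
      · exact boxLaw_sum_exp_mul_netWeight_ge_le hk hγ₀ hγ hx hm hM hK hh hQ n T (by positivity)
    · exact boxLaw_close_ge_le hk hγ2 hr T (by positivity)

/-! ### Asymptotics -/

theorem tendsto_mul_exp_neg (C : ℝ) {c : ℝ} (hc : 0 < c) :
    Tendsto (fun n : ℕ => C * (n + 1) * Real.exp (-(c * n))) atTop (𝓝 0) := by
  have h1 : Tendsto (fun n : ℕ => c * (n : ℝ)) atTop atTop :=
    tendsto_natCast_atTop_atTop.const_mul_atTop hc
  have h2 := (Real.tendsto_pow_mul_exp_neg_atTop_nhds_zero 1).comp h1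
  have h3 := (Real.tendsto_pow_mul_exp_neg_atTop_nhds_zero 0).comp h1
  have h4 := ((h2.const_mul (1 / c)).add h3).const_mul C
  simp only [mul_zero, add_zero] at h4
  refine h4.congr fun n => ?_
  simp only [Function.comp_apply, pow_one, pow_zero]
  field_simp

theorem tendsto_ofReal_mul_exp_neg (C : ℝ) {c : ℝ} (hc : 0 < c) :
    Tendsto (fun n : ℕ => ENNReal.ofReal (C * (n + 1) * Real.exp (-(c * n)))) atTop (𝓝 0) := by
  have := ENNReal.tendsto_ofReal (tendsto_mul_exp_neg C hc)
  rwa [ENNReal.ofReal_zero] at this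

theorem two_pow_eq_exp (a : ℕ) : (2 : ℝ) ^ a = Real.exp (Real.log 2 * a) := by
  rw [mul_comm, Real.exp_nat_mul, Real.exp_log (by norm_num)]

theorem mul_div_bounds {k n A : ℕ} (hk : 1 ≤ k) (hA : 1 ≤ A) :
    (k * (n / k / A : ℕ) : ℝ) ≤ n / A ∧ (n : ℝ) / A - 2 * k ≤ k * (n / k / A : ℕ) := by
  have hA0 : (0 : ℝ) < A := by exact_mod_cast hA
  have hA1 : (1 : ℝ) ≤ A := by exact_mod_cast hA
  have hk0 : (0 : ℝ) ≤ k := Nat.cast_nonneg k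
  rw [Nat.div_div_eq_div_mul]
  have h1 : (k * A : ℝ) * (n / (k * A) : ℕ) ≤ n := by exact_mod_cast Nat.mul_div_le n (k * A)
  have h2 : (n : ℝ) ≤ k * A * (n / (k * A) : ℕ) + k * A := by
    have := Nat.div_add_mod n (k * A)
    have h3 := (Nat.mod_lt n (Nat.mul_pos hk hA)).le
    exact_mod_cast (by omega : n ≤ k * A * (n / (k * A)) + k * A)
  constructor
  · rw [le_div_iff₀ hA0]
    linarith
  · rw [sub_le_iff_le_add, div_le_iff₀ hA0]
    nlinarith [mul_nonneg hk0 hA0.le]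

theorem card_box_eq (n : ℕ) :
    ((subcells (2 ^ n) (0, 0)).card : ℝ) = Real.exp (2 * Real.log 2 * n) := by
  have h := card_subcells (2 ^ n) (0, 0)
  push_cast at h
  rw [h]
  push_cast
  rw [two_pow_eq_exp, ← Real.exp_add]
  ring_nf

theorem card_mul_half_pow_le {n a : ℕ} (ha : a ≤ n) :
    ((subcells (2 ^ a) (0, 0)).card : ENNReal) * (1 / 2) ^ (4 * n) ≤
      ENNReal.ofReal (1 * (n + 1) * Real.exp (-(1 * n))) := by
  have h := card_subcells (2 ^ a) (0, 0)
  push_cast at h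
  have h2 : (1 / 2 : ENNReal) = ENNReal.ofReal (1 / 2) := by
    rw [ENNReal.ofReal_div_of_pos (by norm_num)]
    norm_num
  rw [h, h2, ← ENNReal.ofReal_natCast, ← ENNReal.ofReal_pow (by norm_num),
    ← ENNReal.ofReal_mul (by positivity)]
  refine ENNReal.ofReal_le_ofReal ?_
  push_cast
  rw [div_pow, one_pow, two_pow_eq_exp, two_pow_eq_exp, one_div, ← Real.exp_neg, ← Real.exp_add,
    ← Real.exp_add]
  have h3 : (a : ℝ) ≤ n := by exact_mod_cast ha
  have h4 : (0 : ℝ) ≤ a := Nat.cast_nonneg a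
  have h5 := Real.log_two_gt_d9
  calc _ ≤ Real.exp (-(1 * n)) := by
        rw [Real.exp_le_exp]
        push_cast
        nlinarith
    _ ≤ _ := le_mul_of_one_le_left (Real.exp_pos _).le (by linarith)

theorem card_mul_exp_le {n : ℕ} {a : ℝ} (ha : a ≤ -(2 * n)) :
    ((subcells (2 ^ n) (0, 0)).card : ENNReal) * ENNReal.ofReal (Real.exp a) ≤
      ENNReal.ofReal (1 * (n + 1) * Real.exp (-(1 / 2 * n))) := by
  rw [← ENNReal.ofReal_natCast, ← ENNReal.ofReal_mul (by positivity), card_box_eq, ← Real.exp_add]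
  refine ENNReal.ofReal_le_ofReal ?_
  have h4 : (0 : ℝ) ≤ n := Nat.cast_nonneg n
  have h5 := Real.log_two_lt_d9
  calc _ ≤ Real.exp (-(1 / 2 * n)) := by
        rw [Real.exp_le_exp]
        nlinarith
    _ ≤ _ := le_mul_of_one_le_left (Real.exp_pos _).le (by linarith)

theorem sum_exp_ratio_le {k n j d : ℕ} {b : ℝ} (hjn : (j : ℝ) ≤ n) (hjd : (k * j : ℝ) + k * d ≤ n)
    (hd : b * n - 2 * k ≤ k * d) :
    16 * ((j : ℝ) + 1) * (2 ^ (j * k) * 2 ^ (j * k)) / (subcells (2 ^ n) (0, 0)).card ≤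
      16 * Real.exp (2 * k) * (n + 1) * Real.exp (-(b * n)) := by
  rw [card_box_eq, two_pow_eq_exp, ← Real.exp_add, div_le_iff₀ (Real.exp_pos _)]
  have h5 := Real.log_two_gt_d9
  have h6 : (0 : ℝ) ≤ k * d := by positivity
  have h7 : Real.exp (Real.log 2 * (j * k : ℕ) + Real.log 2 * (j * k : ℕ)) ≤
      Real.exp (2 * k) * Real.exp (-(b * n)) * Real.exp (2 * Real.log 2 * n) := by
    rw [← Real.exp_add, ← Real.exp_add, Real.exp_le_exp]
    push_cast
    nlinarith
  calc _ ≤ 16 * ((n : ℝ) + 1) * (Real.exp (2 * k) * Real.exp (-(b * n)) *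
        Real.exp (2 * Real.log 2 * n)) := by gcongr
    _ = _ := by ring

/-- The main terms `log 2 * n` and `γ ^ 2 * k * j / 2` cancel. The constant `10` per scale costs at
most `3 / 100 * e * n`, the bound `x` at most `e / 8 * n`, and the terms with `a` are negligible.
The gain `e * log 2 * n` exceeds all this by more than `e / 4 * n`. -/
theorem netWeight_ratio_le {k n j d : ℕ} {γ e a y : ℝ} (hγ₀ : 0 ≤ γ) (hγ : γ ≤ 1 / 2) (he : 0 < e)
    (hjd : j + d = n / k) (hkJ : (k * (n / k : ℕ) : ℝ) ≤ n) (hJn : ((n / k : ℕ) : ℝ) ≤ n)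
    (hek : 100 ≤ e * k) (ha : 100 * a ≤ e) (hkd : (k * d : ℝ) ≤ a * n) (hy : y = a * n / 10) :
    (subcells (2 ^ n) (0, 0)).card * ((2 : ℝ) ^ k * 2 ^ k * ((1 + (n / k : ℕ) * (2 ^ k * 2 ^ k)) *
        (10 * 2 ^ k * Real.exp (γ * (e / 4 * k) + γ ^ 2 * k / 2)) ^ (n / k))) /
      (Real.exp ((1 + e) * Real.log 2 * n) / 2 * (Real.exp (-(a * n / 10)) *
        ((subcells (2 ^ n) (0, 0)).card * Real.exp (γ ^ 2 * k * j / 2) / 2 *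
          Real.exp (-(γ * y))))) ≤
      4 * (2 ^ k * 2 ^ k * (2 ^ k * 2 ^ k)) * (n + 1) * Real.exp (-(e / 4 * n)) := by
  have hP : (0 : ℝ) < (subcells (2 ^ n) (0, 0)).card := by
    rw [card_box_eq]; exact Real.exp_pos _
  set P : ℝ := ((subcells (2 ^ n) (0, 0)).card : ℝ)
  set J := n / k with hJ
  have hn : (0 : ℝ) ≤ n := Nat.cast_nonneg n
  have h4k : (1 : ℝ) ≤ 2 ^ k * 2 ^ k := by
    rw [← mul_pow]; exact one_le_pow₀ (by norm_num)
  have hten : (10 : ℝ) ≤ Real.exp 3 := by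
    have h1 := Real.exp_one_gt_d9
    have h2 : Real.exp 3 = Real.exp 1 ^ 3 := by rw [← Real.exp_nat_mul]; norm_num
    rw [h2]
    calc (10 : ℝ) ≤ 2.7 ^ 3 := by norm_num
      _ ≤ _ := pow_le_pow_left₀ (by norm_num) (by linarith) 3
  have hL1 := Real.log_two_gt_d9
  have hL2 := Real.log_two_lt_d9
  set E := Real.exp (3 + Real.log 2 * k + (γ * (e / 4 * k) + γ ^ 2 * k / 2)) with hE
  have hΛ : 10 * (2 : ℝ) ^ k * Real.exp (γ * (e / 4 * k) + γ ^ 2 * k / 2) ≤ E := by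
    rw [hE, Real.exp_add (3 + Real.log 2 * k), Real.exp_add 3, ← two_pow_eq_exp]
    gcongr
  have hEJ : E ^ J = Real.exp (J * (3 + Real.log 2 * k + (γ * (e / 4 * k) + γ ^ 2 * k / 2))) := by
    rw [hE, ← Real.exp_nat_mul]
  rw [div_le_iff₀ (by positivity)]
  have hmain : E ^ J ≤ Real.exp (-(e / 4 * n)) * Real.exp ((1 + e) * Real.log 2 * n) *
      Real.exp (-(a * n / 10)) * Real.exp (γ ^ 2 * k * j / 2) * Real.exp (-(γ * y)) := by
    rw [hEJ, ← Real.exp_add, ← Real.exp_add, ← Real.exp_add, ← Real.exp_add, Real.exp_le_exp]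
    have hjJ : (J : ℝ) = j + d := by exact_mod_cast hjd.symm
    have e1 : 3 * (J : ℝ) ≤ 3 / 100 * e * n := by
      have : 100 * (J : ℝ) ≤ e * k * J := mul_le_mul_of_nonneg_right hek (Nat.cast_nonneg J)
      nlinarith
    have e2 : Real.log 2 * (k * J) ≤ Real.log 2 * n := mul_le_mul_of_nonneg_left hkJ (by linarith)
    have e3 : γ * (e / 4) * (k * J) ≤ e / 8 * n := by
      calc γ * (e / 4) * (k * J) ≤ 1 / 2 * (e / 4) * n := by gcongr
        _ = e / 8 * n := by ring
    have e4 : γ ^ 2 * k * d / 2 ≤ a * n / 8 := by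
      have h1 : γ ^ 2 ≤ 1 / 4 := by nlinarith
      have h2 : γ ^ 2 * (k * d) ≤ 1 / 4 * (k * d) := mul_le_mul_of_nonneg_right h1 (by positivity)
      linarith
    have han : 0 ≤ a * n := le_trans (by positivity) hkd
    have e5 : γ * y ≤ a * n / 20 := by
      rw [hy]
      nlinarith
    have e6 : a * n ≤ e / 100 * n := by nlinarith
    have e7 : 0.69 * (e * n) ≤ Real.log 2 * (e * n) :=
      mul_le_mul_of_nonneg_right (by linarith) (by positivity)
    have e8 : 0 ≤ e * n := by positivity
    have e9 : (J : ℝ) * (3 + Real.log 2 * k + (γ * (e / 4 * k) + γ ^ 2 * k / 2)) =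
      3 * J + Real.log 2 * (k * J) + γ * (e / 4) * (k * J) + γ ^ 2 * k * j / 2 +
        γ ^ 2 * k * d / 2 := by rw [hjJ]; ring
    rw [e9]
    linarith
  have hJ1 : 1 + (J : ℝ) * (2 ^ k * 2 ^ k) ≤ 2 ^ k * 2 ^ k * (n + 1) := by nlinarith
  calc P * ((2 : ℝ) ^ k * 2 ^ k * ((1 + J * (2 ^ k * 2 ^ k)) *
        (10 * 2 ^ k * Real.exp (γ * (e / 4 * k) + γ ^ 2 * k / 2)) ^ J))
      ≤ P * ((2 : ℝ) ^ k * 2 ^ k * ((2 ^ k * 2 ^ k * (n + 1)) *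
        (Real.exp (-(e / 4 * n)) * Real.exp ((1 + e) * Real.log 2 * n) *
      Real.exp (-(a * n / 10)) * Real.exp (γ ^ 2 * k * j / 2) * Real.exp (-(γ * y))))) := by
        gcongr
        exact (pow_le_pow_left₀ (by positivity) hΛ J).trans hmain
    _ = _ := by ring

/-- Restricting `v` to a box that is `t` scales smaller gains `2 * log 2 * k * t` from the count and
loses only `γ ^ 2 * k * t` from the correlation. With `k * t` about `a * n / 2` the difference
outweighs `δ`, the loss `y` and the `d` levels cut off. -/
theorem close_ratio_le {k n j d r t : ℕ} {γ a y : ℝ} (hγ₀ : 0 ≤ γ) (hγ : γ ≤ 1 / 2)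
    (hjd : j + d = n / k) (hrt : r + t = n / k) (hkJ : (k * (n / k : ℕ) : ℝ) ≤ n)
    (hJn : ((n / k : ℕ) : ℝ) ≤ n) (hkd : (k * d : ℝ) ≤ a * n / 400)
    (ht : a / 2 * n - 2 * k ≤ k * t) (hy : y = a * n / 10) :
    (subcells (2 ^ n) (0, 0)).card * (Real.exp (γ ^ 2 * k * (n / k : ℕ)) *
      ((r + 1) * (4 * (2 ^ (r * k) * 2 ^ (r * k)) * Real.exp (γ ^ 2 * k * ((n / k : ℕ) - r))))) /
      (Real.exp (-(a * n / 10)) *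
        (((subcells (2 ^ n) (0, 0)).card * Real.exp (γ ^ 2 * k * j / 2) / 2 *
          Real.exp (-(γ * y))) * ((subcells (2 ^ n) (0, 0)).card * Real.exp (γ ^ 2 * k * j / 2) / 2 *
          Real.exp (-(γ * y))))) ≤
      16 * Real.exp (3 * k) * (n + 1) * Real.exp (-(a / 4 * n)) := by
  have hP : (0 : ℝ) < (subcells (2 ^ n) (0, 0)).card := by
    rw [card_box_eq]; exact Real.exp_pos _
  have hP' := card_box_eq n
  set P : ℝ := ((subcells (2 ^ n) (0, 0)).card : ℝ)
  set J := n / k with hJ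
  have hn : (0 : ℝ) ≤ n := Nat.cast_nonneg n
  have hk0 : (0 : ℝ) ≤ k := Nat.cast_nonneg k
  have hL1 := Real.log_two_gt_d9
  have hL2 := Real.log_two_lt_d9
  have hjJ : (J : ℝ) = j + d := by exact_mod_cast hjd.symm
  have hrJ : (J : ℝ) = r + t := by exact_mod_cast hrt.symm
  have hγ2 : γ ^ 2 ≤ 1 / 4 := by nlinarith
  rw [div_le_iff₀ (by positivity)]
  have hmain : Real.exp (γ ^ 2 * k * J) * (2 ^ (r * k) * 2 ^ (r * k)) *
      Real.exp (γ ^ 2 * k * (J - r)) ≤ Real.exp (3 * k) * Real.exp (-(a / 4 * n)) *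
      Real.exp (-(a * n / 10)) * P * (Real.exp (γ ^ 2 * k * j / 2) * Real.exp (γ ^ 2 * k * j / 2)) *
      (Real.exp (-(γ * y)) * Real.exp (-(γ * y))) := by
    rw [hP', two_pow_eq_exp]
    simp only [← Real.exp_add]
    rw [Real.exp_le_exp]
    push_cast
    have han : 0 ≤ a * n := by nlinarith [(by positivity : (0 : ℝ) ≤ k * d)]
    have e1 : γ ^ 2 * (k * d) ≤ a * n / 1600 := by
      calc γ ^ 2 * (k * d) ≤ 1 / 4 * (k * d) := by gcongr
        _ ≤ _ := by linarith
    have e2 : γ ^ 2 * (k * t) ≤ 1 / 4 * (k * t) := by gcongr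
    have e3 : γ * y ≤ a * n / 20 := by
      rw [hy]
      nlinarith
    have e4 : Real.log 2 * (k * J) ≤ Real.log 2 * n := mul_le_mul_of_nonneg_left hkJ (by linarith)
    have e5 : 0.69 * (k * t : ℝ) ≤ Real.log 2 * (k * t) :=
      mul_le_mul_of_nonneg_right (by linarith) (by positivity)
    have e6 : γ ^ 2 * k * J = γ ^ 2 * k * j + γ ^ 2 * (k * d) := by rw [hjJ]; ring
    have e7 : γ ^ 2 * k * (J - r) = γ ^ 2 * (k * t) := by rw [hrJ]; ring
    have e8 : Real.log 2 * (k * J) = Real.log 2 * (r * k) + Real.log 2 * (k * t) := by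
      rw [hrJ]; ring
    rw [e6, e7]
    linarith
  have hrn : (r : ℝ) ≤ n := by
    have : (0 : ℝ) ≤ t := Nat.cast_nonneg t
    linarith
  calc P * (Real.exp (γ ^ 2 * k * J) *
      ((r + 1) * (4 * (2 ^ (r * k) * 2 ^ (r * k)) * Real.exp (γ ^ 2 * k * (J - r)))))
      = 4 * P * (r + 1) * (Real.exp (γ ^ 2 * k * J) * (2 ^ (r * k) * 2 ^ (r * k)) *
      Real.exp (γ ^ 2 * k * (J - r))) := by ring
    _ ≤ 4 * P * (n + 1) * (Real.exp (3 * k) * Real.exp (-(a / 4 * n)) *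
      Real.exp (-(a * n / 10)) * P * (Real.exp (γ ^ 2 * k * j / 2) * Real.exp (γ ^ 2 * k * j / 2)) *
      (Real.exp (-(γ * y)) * Real.exp (-(γ * y)))) := by gcongr
    _ = _ := by ring

/-- Here `16 * h = 2 ^ k / 8`, so each scale loses `3 * log 2` in the exponent besides `γ * (e / 4 *
k)`. The first loss is small because `e * k` is at least `100`. -/
theorem lower_rate_le {k n j d h h' : ℕ} {γ e a y : ℝ} (hγ₀ : 0 ≤ γ) (hγ : γ ≤ 1 / 2) (he : 0 < e)
    (h128 : 2 ^ k = 128 * h) (hh' : 1 ≤ h') (hjd : j + d = n / k)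
    (hkJ : (n : ℝ) ≤ k * (n / k : ℕ) + k) (hkJ' : (k * (n / k : ℕ) : ℝ) ≤ n) (hek : 100 ≤ e * k)
    (ha : 100 * a ≤ e) (hkd : (k * d : ℝ) ≤ a * n) (hy : y ≤ e * n / 5) (hn : 10 * k ≤ e * n) :
    Real.exp ((1 - e) * Real.log 2 * n) ≤
      16 * h' * (16 * h * Real.exp (-(γ * (e / 4 * k)))) ^ j * Real.exp (-(γ * y)) := by
  have hL1 := Real.log_two_gt_d9
  have hL2 := Real.log_two_lt_d9
  have hk0 : (0 : ℝ) ≤ k := Nat.cast_nonneg k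
  have hn0 : (0 : ℝ) ≤ n := Nat.cast_nonneg n
  have h16 : (16 * h : ℝ) = Real.exp (Real.log 2 * k - 3 * Real.log 2) := by
    have h1 : (2 : ℝ) ^ k = 128 * h := by exact_mod_cast h128
    have h2 : Real.exp (3 * Real.log 2) = 8 := by
      have := two_pow_eq_exp 3
      push_cast at this
      rw [mul_comm, ← this]
      norm_num
    rw [Real.exp_sub, ← two_pow_eq_exp, h1, h2]
    ring
  have hh1 : (1 : ℝ) ≤ h' := by exact_mod_cast hh'
  rw [h16, ← Real.exp_add, ← Real.exp_nat_mul, mul_assoc (16 * (h' : ℝ)), ← Real.exp_add]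
  refine le_trans ?_ (le_mul_of_one_le_left (Real.exp_pos _).le (by linarith))
  rw [Real.exp_le_exp]
  have hjJ : ((n / k : ℕ) : ℝ) = j + d := by exact_mod_cast hjd.symm
  rw [hjJ] at hkJ hkJ'
  have hd0 : (0 : ℝ) ≤ d := Nat.cast_nonneg d
  have hj0 : (0 : ℝ) ≤ j := Nat.cast_nonneg j
  have hkd0 : (0 : ℝ) ≤ k * d := by positivity
  have e1 : (n - a * n - k : ℝ) ≤ k * j := by linarith
  have e6 : a * n ≤ e / 100 * n := by nlinarith
  have e2 : Real.log 2 * (n - e / 100 * n - e / 10 * n) ≤ Real.log 2 * (k * j) :=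
    mul_le_mul_of_nonneg_left (by linarith) (by linarith)
  have e3 : 3 * (j : ℝ) ≤ 3 / 100 * e * n := by
    have : 100 * (j : ℝ) ≤ e * k * j := mul_le_mul_of_nonneg_right hek hj0
    have : e * (k * j) ≤ e * n := mul_le_mul_of_nonneg_left (by linarith) he.le
    linarith
  have e4 : 3 * Real.log 2 * j ≤ 3 / 100 * e * n := by nlinarith
  have e5 : γ * (e / 4) * (k * j) ≤ e / 8 * n := by
    calc γ * (e / 4) * (k * j) ≤ 1 / 2 * (e / 4) * n := by
          gcongr
          linarith
      _ = e / 8 * n := by ring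
  have e7 : γ * y ≤ e * n / 10 := by
    have : γ * y ≤ γ * (e * n / 5) := mul_le_mul_of_nonneg_left hy hγ₀
    have h2 : γ * (e * n / 5) ≤ 1 / 2 * (e * n / 5) :=
      mul_le_mul_of_nonneg_right hγ (by positivity)
    linarith
  have e8 : 0.69 * (e * n) ≤ Real.log 2 * (e * n) :=
    mul_le_mul_of_nonneg_right (by linarith) (by positivity)
  have e9 : Real.log 2 * (e * n) ≤ 0.7 * (e * n) :=
    mul_le_mul_of_nonneg_right (by linarith) (by positivity)
  have e10 : 0 ≤ e * n := by positivity
  have e11 : j * (Real.log 2 * k - 3 * Real.log 2 + -(γ * (e / 4 * k))) =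
    Real.log 2 * (k * j) - 3 * Real.log 2 * j - γ * (e / 4) * (k * j) := by ring
  rw [e11]
  linarith

/-! ### The conditions on the scale factor hold for large `K`. -/

theorem eventually_mul_exp_neg_le (C : ℝ) {c b : ℝ} (hc : 0 < c) (hb : 0 < b) :
    ∀ᶠ n : ℕ in atTop, C * (n + 1) * Real.exp (-(c * n)) ≤ b :=
  (tendsto_mul_exp_neg C hc).eventually_le_const hb

theorem eventually_road_rate_le {η : ℝ} (hη : 0 < η) :
    ∃ s : ℕ, ∀ᶠ k : ℕ in atTop,
      ((2 * 2 ^ (s + 1) : ℕ) * (32 * ENNReal.ofReal (Real.exp (-((η * k) ^ 2 / (32 * k)))))) ^ (2 ^ s) ≤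
        ENNReal.ofReal (Real.exp (-(8 * k))) := by
  -- For large `k` each line fails with probability at most `exp (-(η ^ 2 / 64 * k))`. The `2 ^ s`
  -- independent lines give `exp (-(8 * k))` once `2 ^ s * η ^ 2 ≥ 512`. So the block size depends
  -- on `η` but not on `k`.
  obtain ⟨s, hs⟩ := pow_unbounded_of_one_lt (512 / η ^ 2) (by norm_num : (1 : ℝ) < 2)
  have hη2 : 0 < η ^ 2 := by positivity
  refine ⟨s, ?_⟩
  filter_upwards [eventually_mul_exp_neg_le (2 * 2 ^ (s + 1) * 32) (c := η ^ 2 / 64) (b := 1)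
    (by positivity) one_pos, eventually_ge_atTop 1] with k hk hk1
  have hk0 : (1 : ℝ) ≤ k := by exact_mod_cast hk1
  have e1 : (η * k) ^ 2 / (32 * k) = η ^ 2 / 64 * k + η ^ 2 / 64 * k := by
    field_simp
    norm_num
  have e2 : (2 * 2 ^ (s + 1) : ℝ) * (32 * Real.exp (-((η * k) ^ 2 / (32 * k)))) ≤
      Real.exp (-(η ^ 2 / 64 * k)) := by
    rw [e1, neg_add, Real.exp_add]
    have h1 : 0 < Real.exp (-(η ^ 2 / 64 * k)) := Real.exp_pos _
    have h2 : 2 * 2 ^ (s + 1) * 32 * Real.exp (-(η ^ 2 / 64 * k)) ≤ 1 := by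
      refine le_trans (mul_le_mul_of_nonneg_right ?_ h1.le) hk
      exact le_mul_of_one_le_right (by positivity) (by linarith)
    calc _ = 2 * 2 ^ (s + 1) * 32 * Real.exp (-(η ^ 2 / 64 * k)) * Real.exp (-(η ^ 2 / 64 * k)) := by
          ring
      _ ≤ _ := by nlinarith
  have h32 : (32 : ENNReal) = ENNReal.ofReal 32 := by norm_num
  rw [← ENNReal.ofReal_natCast, h32, ← ENNReal.ofReal_mul (by positivity),
    ← ENNReal.ofReal_mul (by positivity), ← ENNReal.ofReal_pow (by positivity)]
  refine ENNReal.ofReal_le_ofReal ?_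
  push_cast
  refine (pow_le_pow_left₀ (by positivity) e2 _).trans ?_
  rw [← Real.exp_nat_mul, Real.exp_le_exp]
  push_cast
  rw [div_lt_iff₀ hη2] at hs
  nlinarith

theorem three_mul_le_two_pow (j : ℕ) (hj : 6 ≤ j) : 3 * (j + 7) ≤ 2 ^ j := by
  induction j, hj using Nat.le_induction with
  | base => norm_num
  | succ j hj ih =>
    rw [pow_succ]
    omega

theorem eventually_thin_rate_le {η : ℝ} (hη : 0 < η) :
    ∃ p : ENNReal, 50 ^ 32 * p ≤ 1 / 2 ∧ ∀ᶠ k : ℕ in atTop,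
      9 * (32 * ENNReal.ofReal (Real.exp (-((η * k) ^ 2 / (32 * k))))) ≤ p / 2 ∧
        2 ^ k * 2 ^ k * (1 / 2) ^ (2 ^ (k - 7)) ≤ p / 2 := by
  -- The bound is `p = 2 * b`, for which `50 ^ 32 * p` is exactly one half. It does not depend on
  -- `k`.
  set b : ℝ := 1 / (4 * 50 ^ 32) with hb
  have hb0 : 0 < b := by positivity
  have h2 : (2 : ENNReal) = ENNReal.ofReal 2 := by norm_num
  have h9 : (9 : ENNReal) = ENNReal.ofReal 9 := by norm_num
  have h32 : (32 : ENNReal) = ENNReal.ofReal 32 := by norm_num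
  have h50 : (50 : ENNReal) = ENNReal.ofReal 50 := by norm_num
  have hhalf : (1 / 2 : ENNReal) = ENNReal.ofReal (1 / 2) := by
    rw [ENNReal.ofReal_div_of_pos (by norm_num), ← h2, ENNReal.ofReal_one]
  have hp2 : ENNReal.ofReal (2 * b) / 2 = ENNReal.ofReal b := by
    rw [h2, ← ENNReal.ofReal_div_of_pos (by norm_num)]
    congr 1
    ring
  refine ⟨ENNReal.ofReal (2 * b), ?_, ?_⟩
  · rw [h50, hhalf, ← ENNReal.ofReal_pow (by norm_num), ← ENNReal.ofReal_mul (by positivity)]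
    refine ENNReal.ofReal_le_ofReal (le_of_eq ?_)
    rw [hb]
    field_simp
    norm_num
  · filter_upwards [eventually_mul_exp_neg_le 288 (c := η ^ 2 / 32) (by positivity) hb0,
      eventually_mul_exp_neg_le 1 (c := 1 / 2) (by norm_num) hb0, eventually_ge_atTop 13]
      with k h3 h4 hk
    have hk0 : (13 : ℝ) ≤ k := by exact_mod_cast hk
    rw [hp2]
    constructor
    · rw [h9, h32, ← ENNReal.ofReal_mul (by positivity), ← ENNReal.ofReal_mul (by positivity)]
      refine ENNReal.ofReal_le_ofReal (le_trans ?_ h3)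
      have e1 : (η * k) ^ 2 / (32 * k) = η ^ 2 / 32 * k := by field_simp
      rw [e1]
      have := Real.exp_pos (-(η ^ 2 / 32 * k))
      nlinarith
    · rw [hhalf, h2, ← ENNReal.ofReal_pow (by norm_num), ← ENNReal.ofReal_pow (by norm_num),
        ← ENNReal.ofReal_mul (by positivity), ← ENNReal.ofReal_mul (by positivity)]
      refine ENNReal.ofReal_le_ofReal (le_trans ?_ h4)
      have e1 : 3 * k ≤ 2 ^ (k - 7) := by
        have := three_mul_le_two_pow (k - 7) (by omega)
        omega
      have e2 : (1 / 2 : ℝ) ^ (2 ^ (k - 7)) ≤ (1 / 2) ^ (3 * k) :=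
        pow_le_pow_of_le_one (by norm_num) (by norm_num) e1
      have e3 : (2 : ℝ) ^ k * 2 ^ k * (1 / 2) ^ (3 * k) = Real.exp (-(Real.log 2 * k)) := by
        rw [Real.exp_neg, ← two_pow_eq_exp, pow_mul', one_div, inv_pow]
        field_simp
      calc (2 : ℝ) ^ k * 2 ^ k * (1 / 2) ^ (2 ^ (k - 7)) ≤ 2 ^ k * 2 ^ k * (1 / 2) ^ (3 * k) := by
            gcongr
        _ = Real.exp (-(Real.log 2 * k)) := e3
        _ ≤ Real.exp (-(1 / 2 * k)) := by
            rw [Real.exp_le_exp]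
            have := Real.log_two_gt_d9
            nlinarith
        _ ≤ _ := le_mul_of_one_le_left (Real.exp_pos _).le (by linarith)

/-- The choice of parameters: `a` is `1 / B ^ 2` and `b` is of order `a ^ 2`. About `a * n / k`
coarsest levels are cut for the distances, half as many define closeness, and about `b * n / k` are
cut for the total mass. Deviations in a union bound are of the order of the square root of the
fraction cut, which makes them about `n / B` and `a * n`. -/
theorem boxLaw_lqgPairMass_lt_le_exp {k n t d' s : ℕ} (hk : 7 ≤ k) {γ e a b B : ℝ} (hγ₀ : 0 ≤ γ)
    (hγ : γ ≤ 1 / 2) (he : 0 < e) (hB₀ : 0 < B) (hB : a * (B * B) = 1) (hae : 100 * a ≤ e)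
    (hB' : 10 ≤ e * B) (hba : b = a * a / 400) (ha₀ : 0 < a) (ha₁ : a ≤ 1) (hek : 100 ≤ e * k)
    (hs : s + 1 ≤ k)
    (hQ : ((2 * 2 ^ (s + 1) : ℕ) *
      (32 * ENNReal.ofReal (Real.exp (-((e / 4 * k) ^ 2 / (32 * k)))))) ^ (2 ^ s) ≤
        ENNReal.ofReal (Real.exp (-(8 * k))))
    {p : ENNReal} (hp : 50 ^ 32 * p ≤ 1 / 2)
    (hp₁ : 9 * (32 * ENNReal.ofReal (Real.exp (-((e / 4 * k) ^ 2 / (32 * k))))) ≤ p / 2)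
    (hp₂ : 2 ^ k * 2 ^ k * (1 / 2) ^ (2 ^ (k - 7)) ≤ p / 2)
    (hn : 1 ≤ n) (hnk : 10 * k ≤ e * n) (hn256 : 256 * (n + 1) ≤ Real.exp (a / 4 * n - k))
    (ht₂ : 2 * t ≤ n / k) (ht : k * t ≤ a / 2 * n) (ht' : a / 2 * n - 2 * k ≤ k * t)
    (hd'J : d' ≤ n / k) (hd' : k * d' ≤ b * n) (hd'' : b * n - 2 * k ≤ k * d') :
    boxLaw {ω | lqgPairMass γ (coarseMBRW k n ω)
      {p | Real.exp ((1 - e) * Real.log 2 * n) ≤ fppDist γ (coarseMBRW k n ω) p.1 p.2 ∧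
        fppDist γ (coarseMBRW k n ω) p.1 p.2 ≤ 2 * (Real.exp ((1 + e) * Real.log 2 * n) / 2)} <
      1 - 3 * Real.exp (-(a * n / 10))} ≤
    ENNReal.ofReal (1 * (n + 1) * Real.exp (-(1 * n))) +
      ENNReal.ofReal (1 * (n + 1) * Real.exp (-(1 / 2 * n))) +
      ENNReal.ofReal (1 * (n + 1) * Real.exp (-(1 / 2 * n))) +
      ENNReal.ofReal (16 * Real.exp (2 * k) * (n + 1) * Real.exp (-(b * n))) +
      ENNReal.ofReal (4 * (2 ^ k * 2 ^ k * (2 ^ k * 2 ^ k)) * (n + 1) * Real.exp (-(e / 4 * n))) +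
      ENNReal.ofReal (16 * Real.exp (3 * k) * (n + 1) * Real.exp (-(a / 4 * n))) := by
  have hk1 : 1 ≤ k := by omega
  have hk0 : (0 : ℝ) < k := by exact_mod_cast hk1
  have hn0 : (1 : ℝ) ≤ n := by exact_mod_cast hn
  have hJ1 : (k * (n / k : ℕ) : ℝ) ≤ n := by exact_mod_cast Nat.mul_div_le n k
  have hkJ : (n : ℝ) ≤ k * (n / k : ℕ) + k := by
    have h1 := Nat.div_add_mod n k
    have h2 := Nat.mod_lt n hk1
    exact_mod_cast (by omega : n ≤ k * (n / k) + k)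
  have hJn : ((n / k : ℕ) : ℝ) ≤ n := by exact_mod_cast Nat.div_le_self n k
  have han : 0 < a * n := by positivity
  have hbn : b * n ≤ a * n / 400 := by
    have h1 : b * n = a * (a * n) / 400 := by rw [hba]; ring
    have h2 : a * (a * n) ≤ 1 * (a * n) := mul_le_mul_of_nonneg_right ha₁ han.le
    linarith
  have hkd2 : (k * (2 * t : ℕ) : ℝ) ≤ a * n := by
    push_cast
    linarith
  have hj : (n / k - 2 * t) + 2 * t = n / k := by omega
  have hj' : (n / k - d') + d' = n / k := by omega
  have hr : (n / k - t) + t = n / k := by omega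
  have hjn : ((n / k - d' : ℕ) : ℝ) ≤ n := le_trans (by exact_mod_cast Nat.sub_le _ _) hJn
  have hjd' : (k * (n / k - d' : ℕ) : ℝ) + k * d' ≤ n := by
    rw [← mul_add]
    exact le_trans (by exact_mod_cast (congrArg (k * ·) hj').le) hJ1
  have h128 : 2 ^ k = 128 * 2 ^ (k - 7) := by
    rw [show (128 : ℕ) = 2 ^ 7 by norm_num, ← pow_add]
    congr 1
    omega
  have h64 : 64 * 2 ^ (k - 7) < 2 ^ k := by
    have : 0 < 2 ^ (k - 7) := by positivity
    omega
  have hx : 0 < e / 4 * k := by positivity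
  have hmM : 2 ^ k = 2 ^ (k - (s + 1)) * 2 ^ (s + 1) := by
    rw [← pow_add]
    congr 1
    omega
  -- The `t` scales between the cut for the distances and the scale of closeness leave room for
  -- chains of length of order `n`.
  have hcells : (2 : ℤ) ^ ((n / k - 2 * t) * k) * (64 * (4 * n : ℕ) + 1) ≤
      2 ^ ((n / k - t) * k) := by
    have h1 : (n / k - t) * k = (n / k - 2 * t) * k + t * k := by
      rw [← add_mul]
      congr 1
      omega
    rw [h1, pow_add]
    refine mul_le_mul_of_nonneg_left ?_ (by positivity)
    have h2 : (256 * (n + 1) : ℝ) ≤ 2 ^ (t * k) := by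
      refine hn256.trans ?_
      rw [two_pow_eq_exp, Real.exp_le_exp]
      push_cast
      have h4 := Real.log_two_gt_d9
      have h5 : (0 : ℝ) ≤ k * t := by positivity
      have h6 : 1 / 2 * (k * t : ℝ) ≤ Real.log 2 * (k * t) :=
        mul_le_mul_of_nonneg_right (by linarith) h5
      linarith
    have h3 : (256 * (n + 1) : ℤ) ≤ 2 ^ (t * k) := by exact_mod_cast h2
    push_cast
    linarith
  have hy : 2 * n / B ≤ e * n / 5 := by
    rw [div_le_iff₀ hB₀]
    have : 10 * (n : ℝ) ≤ e * B * n := mul_le_mul_of_nonneg_right hB' (by linarith)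
    linarith
  have hlow := lower_rate_le (h' := 4 * n) hγ₀ hγ he h128 (by omega) hj hkJ hJ1 hek hae hkd2 hy hnk
  -- The choice `l = 2 * B` gives at most `2 * n - 4 * n`, which beats the `exp (2 * log 2 * n)`
  -- points of the box. The next estimate has the same balance.
  have hexp₂ : (2 * B) ^ 2 * (k * (2 * t : ℕ)) / 2 - 2 * B * (2 * n / B) ≤ -(2 * n) := by
    have h1 : 2 * B * (2 * n / B) = 4 * n := by
      field_simp
      norm_num
    have h2 : (2 * B) ^ 2 * (k * (2 * t : ℕ)) ≤ (2 * B) ^ 2 * (a * n) :=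
      mul_le_mul_of_nonneg_left hkd2 (by positivity)
    have h3 : (2 * B) ^ 2 * (a * n) = 4 * n * (a * (B * B)) := by ring
    rw [h3, hB] at h2
    linarith
  have hexp₃ : (40 * (B * B)) ^ 2 * (k * d') / 2 - 40 * (B * B) * (a * n / 10) ≤ -(2 * n) := by
    have h1 : 40 * (B * B) * (a * n / 10) = 4 * n * (a * (B * B)) := by ring
    have h2 : (40 * (B * B)) ^ 2 * (k * d') ≤ (40 * (B * B)) ^ 2 * (b * n) :=
      mul_le_mul_of_nonneg_left hd' (by positivity)
    have h3 : (40 * (B * B)) ^ 2 * (b * n) = 4 * n * (a * (B * B)) * (a * (B * B)) := by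
      rw [hba]; ring
    rw [h3, hB] at h2
    rw [h1, hB]
    linarith
  have hmain := boxLaw_lqgPairMass_lt_le hk1 hγ₀ hγ hx (m := 2 ^ (s + 1)) (by positivity)
    (by positivity) hmM (h := 2 ^ s) (pow_succ' 2 s).ge hQ hj hj' (Nat.sub_le _ t) hcells
    (by positivity) hlow
    (U := Real.exp ((1 + e) * Real.log 2 * n) / 2) (by positivity)
    (Real.exp_pos (-(a * n / 10))) (l := 2 * B) (by positivity) (l' := 40 * (B * B)) (by positivity)
    (y' := a * n / 10) rfl
  refine hmain.trans ?_
  refine add_le_add (add_le_add (add_le_add (add_le_add (add_le_add ?_ ?_) ?_) ?_) ?_) ?_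
  · exact (boxLaw_hasBadChain_thin_le hk1 hγ₀ hx Nat.one_le_two_pow h64 hp₁ hp hp₂ _
      (by omega) _).trans (card_mul_half_pow_le (Nat.sub_le _ _))
  · exact card_mul_exp_le hexp₂
  · exact card_mul_exp_le hexp₃
  · exact ENNReal.ofReal_le_ofReal (sum_exp_ratio_le hjn hjd' hd'')
  · exact ENNReal.ofReal_le_ofReal (netWeight_ratio_le hγ₀ hγ he hj' hJ1 hJn hek hae
      (by linarith) rfl)
  · exact ENNReal.ofReal_le_ofReal (close_ratio_le hγ₀ hγ hj' hr hJ1 hJn (by linarith) ht' rfl)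

theorem tendsto_boxLaw_lqgPairMass_lt {k : ℕ} (hk : 7 ≤ k) {γ e : ℝ} (hγ₀ : 0 ≤ γ) (hγ : γ ≤ 1 / 2)
    (he : 0 < e) {B : ℕ} (hB : 100 ≤ e * (B * B)) (hB' : 10 ≤ e * B) (hek : 100 ≤ e * k) {s : ℕ}
    (hs : s + 1 ≤ k)
    (hQ : ((2 * 2 ^ (s + 1) : ℕ) *
      (32 * ENNReal.ofReal (Real.exp (-((e / 4 * k) ^ 2 / (32 * k)))))) ^ (2 ^ s) ≤
        ENNReal.ofReal (Real.exp (-(8 * k))))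
    {p : ENNReal} (hp : 50 ^ 32 * p ≤ 1 / 2)
    (hp₁ : 9 * (32 * ENNReal.ofReal (Real.exp (-((e / 4 * k) ^ 2 / (32 * k))))) ≤ p / 2)
    (hp₂ : 2 ^ k * 2 ^ k * (1 / 2) ^ (2 ^ (k - 7)) ≤ p / 2) :
    Tendsto (fun n : ℕ => boxLaw {ω | lqgPairMass γ (coarseMBRW k n ω)
      {p | Real.exp ((1 - e) * Real.log 2 * n) ≤ fppDist γ (coarseMBRW k n ω) p.1 p.2 ∧
        fppDist γ (coarseMBRW k n ω) p.1 p.2 ≤ 2 * (Real.exp ((1 + e) * Real.log 2 * n) / 2)} <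
      1 - 3 * Real.exp (-(1 / (B * B) * n / 10))}) atTop (𝓝 0) := by
  have hk1 : 1 ≤ k := by omega
  have hB1 : 1 ≤ B := by
    by_contra hcon
    obtain rfl : B = 0 := by omega
    norm_num at hB
  have hB0 : (1 : ℝ) ≤ B := by exact_mod_cast hB1
  have hBB : (0 : ℝ) < B * B := by positivity
  have hBB1 : 1 ≤ B * B := Nat.mul_pos hB1 hB1
  set a : ℝ := 1 / (B * B) with ha
  have ha0 : 0 < a := by positivity
  have ha1 : a ≤ 1 := by
    rw [ha, div_le_one hBB]
    nlinarith
  have hae : 100 * a ≤ e := by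
    rw [ha, mul_one_div, div_le_iff₀ hBB]
    exact hB
  have hBa : a * (B * B) = 1 := by
    rw [ha]
    field_simp
  have hb0 : 0 < a * a / 400 := by positivity
  have hsum := (((((tendsto_ofReal_mul_exp_neg 1 one_pos).add
    (tendsto_ofReal_mul_exp_neg 1 (c := 1 / 2) (by norm_num))).add
    (tendsto_ofReal_mul_exp_neg 1 (c := 1 / 2) (by norm_num))).add
    (tendsto_ofReal_mul_exp_neg (16 * Real.exp (2 * k)) hb0)).add
    (tendsto_ofReal_mul_exp_neg (4 * (2 ^ k * 2 ^ k * (2 ^ k * 2 ^ k))) (c := e / 4)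
      (by positivity))).add
    (tendsto_ofReal_mul_exp_neg (16 * Real.exp (3 * k)) (c := a / 4) (by positivity))
  simp only [add_zero] at hsum
  refine tendsto_of_tendsto_of_tendsto_of_le_of_le' tendsto_const_nhds hsum
    (Eventually.of_forall fun _ => zero_le) ?_
  filter_upwards [eventually_ge_atTop 1, tendsto_natCast_atTop_atTop.eventually_ge_atTop
    (10 * (k : ℝ) / e), eventually_mul_exp_neg_le 256 (c := a / 4) (by positivity)
    (Real.exp_pos (-k))] with n hn1 hnk hn256
  rw [div_le_iff₀ he, mul_comm (n : ℝ)] at hnk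
  rw [Real.exp_neg, ← div_eq_mul_inv, div_le_iff₀ (Real.exp_pos _), ← Real.exp_add,
    neg_add_eq_sub] at hn256
  have htb := mul_div_bounds (n := n) hk1 (A := 2 * (B * B)) (by omega)
  have hta : (n : ℝ) / (2 * (B * B) : ℕ) = a / 2 * n := by
    rw [ha]
    push_cast
    field_simp
  rw [hta] at htb
  have hdb := mul_div_bounds (n := n) hk1 (A := 400 * (B * B) * (B * B))
    (Nat.mul_pos (by omega) hBB1)
  have hda : (n : ℝ) / (400 * (B * B) * (B * B) : ℕ) = a * a / 400 * n := by
    rw [ha]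
    push_cast
    field_simp
  rw [hda] at hdb
  have ht2 : 2 * (n / k / (2 * (B * B))) ≤ n / k :=
    (Nat.mul_le_mul_right _ (by omega : 2 ≤ 2 * (B * B))).trans (Nat.mul_div_le _ _)
  exact boxLaw_lqgPairMass_lt_le_exp hk hγ₀ hγ he (by linarith) hBa hae hB' rfl ha0 ha1 hek hs hQ
    hp hp₁ hp₂ hn1 hnk hn256 ht2 htb.1 htb.2 (Nat.div_le_self _ _) hdb.1 hdb.2

/-! ### Powers of `N` and transfer to an arbitrary family of box variables. -/

theorem lqgPairMass_mono {N : ℕ} (γ : ℝ) (φ : LatticeBox N → ℝ)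
    {S S' : Set (LatticeBox N × LatticeBox N)} (h : S ⊆ S') :
    lqgPairMass γ φ S ≤ lqgPairMass γ φ S' := by
  classical
  have h0 : ∀ u, 0 ≤ lqgMass γ φ u := fun u => by unfold lqgMass; positivity
  refine Finset.sum_le_sum_of_subset_of_nonneg (fun p hp => ?_) fun p _ _ =>
    mul_nonneg (h0 _) (h0 _)
  simp only [Finset.mem_filter] at hp ⊢
  exact ⟨hp.1, h hp.2⟩

theorem two_pow_rpow_eq_exp (n : ℕ) (y : ℝ) :
    ((2 : ℝ) ^ n) ^ y = Real.exp (y * Real.log 2 * n) := by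
  rw [two_pow_eq_exp, ← Real.exp_mul]
  ring_nf

theorem theorem1p1 (γ : ℝ) (hγ₀ : 0 < γ) (hγ : γ < 1 / 2) (ε : ℝ) (hε : 0 < ε) :
    ∃ (K₀ : ℕ) (ρ : ℝ), 0 < ρ ∧
      ∀ (k : ℕ), 1 ≤ k → K₀ ≤ 2 ^ k →
        ∀ (Ω : Type*) [MeasurableSpace Ω] (P : Measure Ω) [IsProbabilityMeasure P]
          (b : ℕ × (ℤ × ℤ) → Ω → ℝ), IsBoxNoise P b →
          Tendsto
            (fun n : ℕ => P {ω | 1 - ((2 : ℝ) ^ n) ^ (-ρ) ≤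
              lqgPairMass γ (coarseMBRW k n fun i => b i ω)
                {p | ((2 : ℝ) ^ n) ^ (1 - ε) ≤
                      fppDist γ (coarseMBRW k n fun i => b i ω) p.1 p.2 ∧
                    fppDist γ (coarseMBRW k n fun i => b i ω) p.1 p.2 ≤
                      ((2 : ℝ) ^ n) ^ (1 + ε)}})
            atTop (𝓝 1) := by
  set e := min ε 1 with he_def
  have he : 0 < e := lt_min hε one_pos
  have he1 : e ≤ 1 := min_le_right _ _
  obtain ⟨B, hB⟩ := exists_nat_ge (10 / e)
  have hBe : 10 ≤ e * B := by
    rw [div_le_iff₀ he] at hB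
    linarith
  have hB10 : (10 : ℝ) ≤ B := by
    have : (0 : ℝ) ≤ B := Nat.cast_nonneg B
    nlinarith
  have hBB : 100 ≤ e * (B * B) := by nlinarith
  obtain ⟨s, hs⟩ := eventually_road_rate_le (η := e / 4) (by positivity)
  obtain ⟨p, hp, hp'⟩ := eventually_thin_rate_le (η := e / 4) (by positivity)
  obtain ⟨k₀, hk₀⟩ := eventually_atTop.1 (hs.and (hp'.and
    ((tendsto_natCast_atTop_atTop.eventually_ge_atTop (100 / e)).and
      ((eventually_ge_atTop 7).and (eventually_ge_atTop (s + 1))))))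
  set a : ℝ := 1 / (B * B) with ha
  have ha0 : 0 < a := by positivity
  -- The exponent is half of the `a / 10` in the mass bound. The other half absorbs the factor
  -- three, and `log 2 < 1` allows the passage to powers of `N`.
  refine ⟨2 ^ k₀, a / 20, by positivity, fun k hk hkK Ω _ P _ b hb => ?_⟩
  obtain ⟨hQ, ⟨hp₁, hp₂⟩, hek, hk7, hsk⟩ := hk₀ k ((Nat.pow_le_pow_iff_right (by norm_num)).1 hkK)
  have hlim := tendsto_boxLaw_lqgPairMass_lt hk7 hγ₀.le hγ.le he hBB hBe
    (by rw [div_le_iff₀ he] at hek; linarith) hsk hQ hp hp₁ hp₂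
  have hlim' := ENNReal.Tendsto.sub (tendsto_const_nhds (x := (1 : ENNReal))) hlim
    (Or.inl ENNReal.one_ne_top)
  rw [tsub_zero] at hlim'
  refine tendsto_of_tendsto_of_tendsto_of_le_of_le' hlim' tendsto_const_nhds ?_
    (Eventually.of_forall fun _ => prob_le_one)
  filter_upwards [eventually_mul_exp_neg_le 3 (c := a / 20) (by positivity) one_pos] with n hn
  rw [tsub_le_iff_right]
  refine le_trans ?_ (add_le_add_right (hb.measure_preimage_le _) _)
  -- The desired event and the small exceptional one cover the whole space. Subadditivity bounds the
  -- probability from below without measurability of either.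
  rw [← measure_univ (μ := P)]
  refine (measure_mono fun ω _ => ?_).trans (measure_union_le _ _)
  by_contra hcon
  simp only [Set.mem_union, not_or, Set.mem_ofPred_eq, not_le, not_lt] at hcon
  obtain ⟨h1, h2⟩ := hcon
  have hL1 := Real.log_two_gt_d9
  have hL2 := Real.log_two_lt_d9
  have hn0 : (0 : ℝ) ≤ n := Nat.cast_nonneg n
  have hLn : 0 ≤ Real.log 2 * n := by positivity
  have hδ : 3 * Real.exp (-(a * n / 10)) ≤ ((2 : ℝ) ^ n) ^ (-(a / 20)) := by
    have h3 : Real.exp (-(a * n / 10)) = Real.exp (-(a / 20 * n)) * Real.exp (-(a / 20 * n)) := by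
      rw [← Real.exp_add]
      ring_nf
    have h4 : Real.exp (-(a / 20 * n)) ≤ ((2 : ℝ) ^ n) ^ (-(a / 20)) := by
      rw [two_pow_rpow_eq_exp, Real.exp_le_exp]
      have : Real.log 2 * n ≤ 1 * n := mul_le_mul_of_nonneg_right (by linarith) hn0
      nlinarith
    have h5 : 3 * Real.exp (-(a / 20 * n)) ≤ 1 := by
      have := Real.exp_pos (-(a / 20 * n))
      nlinarith
    rw [h3]
    nlinarith [Real.exp_pos (-(a / 20 * n))]
  have hmono : lqgPairMass γ (coarseMBRW k n fun i => b i ω)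
      {p | Real.exp ((1 - e) * Real.log 2 * n) ≤
          fppDist γ (coarseMBRW k n fun i => b i ω) p.1 p.2 ∧
        fppDist γ (coarseMBRW k n fun i => b i ω) p.1 p.2 ≤
          2 * (Real.exp ((1 + e) * Real.log 2 * n) / 2)} ≤
      lqgPairMass γ (coarseMBRW k n fun i => b i ω)
      {p | ((2 : ℝ) ^ n) ^ (1 - ε) ≤ fppDist γ (coarseMBRW k n fun i => b i ω) p.1 p.2 ∧
        fppDist γ (coarseMBRW k n fun i => b i ω) p.1 p.2 ≤ ((2 : ℝ) ^ n) ^ (1 + ε)} := by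
    have heε : e ≤ ε := min_le_left _ _
    refine lqgPairMass_mono γ _ fun p hp => ⟨le_trans ?_ hp.1, hp.2.trans ?_⟩
    · rw [two_pow_rpow_eq_exp, Real.exp_le_exp]
      nlinarith
    · rw [two_pow_rpow_eq_exp, mul_div_cancel₀ _ (two_ne_zero), Real.exp_le_exp]
      nlinarith
  linarith
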